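/- Consider the planar four-vortex problem with circulations $\Gamma_1=\Gamma_2=\Gamma_3=1$, $\Gamma_4=m\in\mathbb R$: $\dot z_i = J\sum_{j\ne i}\frac{\Gamma_j}{r_{ij}^2}(z_j-z_i)$ for $z_i\in\mathbb R^2$, where $r_{ij}=\|z_i-z_j\|$ and $J=\begin{bmatrix}0&1\\-1&0\end{bmatrix}$. Assume $\sum_i\Gamma_i\neq 0$ and let $c=\frac{\sum_i\Gamma_iz_i}{\sum_i\Gamma_i}$ be the center of vorticity. A relative equilibrium with angular velocity $\omega\ne0$ is a configuration $z$ of four distinct points with $-\omega(z_i-c)=\sum_{j\ne i}\frac{\Gamma_j}{r_{ij}^2}(z_j-z_i)$ for all $i$; it is collinear if the four points lie on a line. A collinear relative equilibrium belongs to Group I if vortex 4 is exterior to the other three vortices, and to Group II if vortex 4 lies between two of the other three. Let $K$ apply $J$ to each of the four planar components, and let $B$ be the linearization at $z$ of the vector field in rotating coordinates, $\bigl(J\sum_{j\ne i}\frac{\Gamma_j}{r_{ij}^2}(z_j-z_i)+\omega J(z_i-c)\bigr)_{i}$, with $c$ fixed. For $m\neq 0$ this is $B=K(M^{-1}D^2H(z)+\omega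 I)$ with $H=-\sum_{i<j}\Gamma_i\Gamma_j\ln r_{ij}$ and $M=\mathrm{diag}(\Gamma_1,\Gamma_1,\dots,\Gamma_4,\Gamma_4)$. The normalized eigenvalues of $z$ are the eigenvalues of $\omega^{-1}B$, counted with algebraic multiplicity. Four of them are the trivial ones $0,0,i,-i$; the other four are called nontrivial. A relative equilibrium is spectrally stable if its nontrivial eigenvalues are nonzero and purely imaginary. It is linearly stable if, in addition, the restriction of $\omega^{-1}B$ to the $M$-orthogonal complement of $\mathrm{span}\{z-c,K(z-c)\}$ is, in some real basis, block diagonal with blocks $\begin{bmatrix}0&\beta_i\\-\beta_i&0\end{bmatrix}$. It is unstable if some eigenvalue has positive real part. **Theorem.** The polynomial $\Psi(m)=64m^6+320m^5+96m^4-220m^3+505m^2+522m+9$ has exactly two real roots $m^*<m_c$ in $(-1,0)$; they satisfy $|m^*+0.8564136|<10^{-7}$ and $|m_c+0.0175413|<10^{-7}$. Group I solutions exist for every $m>-1$, and Group II solutions exist for every $m>-1/2$. Moreover: (i) Every Group I solution is linearly stable if $-1<m<m^*$, spectrally stable if $m=m^*$, and unstable if $m>m^*$. (ii) In each of the following ranges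 of $m$, all Group I solutions for the same $m$ have the same nontrivial normalized eigenvalues, with the following structure. - For $m>m_c$ they are two real pairs $\pm\lambda_1(m),\pm\lambda_2(m)$ with $\lambda_1(m)>\lambda_2(m)>0$. As $m\to m_c^+$, $\lambda_1(m)$ and $\lambda_2(m)$ tend to a common value $\lambda_c>0$, and at $m=m_c$ the nontrivial normalized eigenvalues are $\pm\lambda_c$, each with multiplicity two. As $m\to\infty$, $\lambda_1(m)\to2\sqrt6$ and $\lambda_2(m)\to2\sqrt2$. - For $m^*<m<m_c$ they form a complex quartuplet $\pm\alpha\pm i\beta$ with $\alpha,\beta>0$. - For $-1<m<m^*$ they are $\pm i\nu_1(m),\pm i\nu_2(m)$ with $\nu_1(m),\nu_2(m)$ real. As $m\to-1^+$, $\nu_1(m)\to0$ and $\nu_2(m)\to1$, so they approach $0,0,\pm i$. (iii) For every $m>-1/2$, every Group II solution is unstable, and all Group II solutions have the same nontrivial normalized eigenvalues, namely two real pairs $\pm\lambda_1(m),\pm\lambda_2(m)$ with $\lambda_1(m)>\lambda_2(m)>0$. As $m\to-1/2^+$, $\lambda_1(m)\to\infty$ and $\lambda_2(m)\to\frac{2\sqrt{14}}5$.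 As $m\to\infty$, $\lambda_1(m)\to2\sqrt2$ and $\lambda_2(m)\to0$. -/

import Mathlib

open Filter Topology

namespace PointVortex

noncomputable section

/-- The Euclidean plane. -/
abbrev Plane : Type := EuclideanSpace ℝ (Fin 2)

/-- Positions of `n` vortices in the plane, that is, a point of `ℝ²ⁿ`. -/
abbrev Config (n : ℕ) : Type := Fin n → Plane

/-- Multiplication of a vector of the plane by the symplectic matrix `J = [[0, 1], [-1, 0]]`. -/
def J (v : Plane) : Plane := !₂[v 1, -(v 0)]

/-- The velocity field of the planar `n`-vortex problem with circulations `Γ`,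
`ż_i = J ∑_{j ≠ i} (Γ_j / r_{ij}²) (z_j - z_i)`. These are the Hamiltonian equations
`Γ_i ż_i = J ∂H/∂z_i`, `H = -∑_{i<j} Γ_i Γ_j ln r_{ij}`, after cancelling the common factor `Γ_i`,
so that they make sense for a vortex of circulation zero as well. -/
def velocity {n : ℕ} (Γ : Fin n → ℝ) (z : Config n) : Config n := fun i =>
  J (∑ j ∈ Finset.univ.erase i, (Γ j / dist (z i) (z j) ^ 2) • (z j - z i))

/-- The center of vorticity `c = (1/Γ) ∑ Γ_i z_i`, where `Γ = ∑ Γ_i` (meaningful if `Γ ≠ 0`). -/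
def center {n : ℕ} (Γ : Fin n → ℝ) (z : Config n) : Plane :=
  (∑ i, Γ i)⁻¹ • ∑ i, Γ i • z i

/-- The velocity field in coordinates rotating about `c` with angular velocity `ω`:
if `z` is a motion of the vortices, then `y_i(t) = c + e^{ωJt} (z_i(t) - c)` satisfies
`ẏ = rotatingField Γ ω c y`. -/
def rotatingField {n : ℕ} (Γ : Fin n → ℝ) (ω : ℝ) (c : Plane) (z : Config n) : Config n := fun i =>
  velocity Γ z i + ω • J (z i - c)

/-- `z` is (the initial position of) a relative equilibrium with angular velocity `ω`: the vortices
are at distinct points, the total circulation and `ω` are nonzero, and `z` is a rest point in the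
coordinates rotating about the center of vorticity, that is,
`-ω (z_i - c) = ∑_{j ≠ i} (Γ_j / r_{ij}²) (z_j - z_i)` for each `i`. Equivalently,
`z_i(t) = c + e^{-ωJt} (z_i - c)` is a motion of the vortices. -/
def IsRelativeEquilibrium {n : ℕ} (Γ : Fin n → ℝ) (ω : ℝ) (z : Config n) : Prop :=
  Function.Injective z ∧ ∑ i, Γ i ≠ 0 ∧ ω ≠ 0 ∧ rotatingField Γ ω (center Γ z) z = 0

/-- The scaled stability matrix `ω⁻¹ B`, where `B = K (M⁻¹ D²H(z) + ω I)` is the linearization of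
the equations of motion in rotating coordinates at the rest point `z`. -/
def scaledStability {n : ℕ} (Γ : Fin n → ℝ) (ω : ℝ) (z : Config n) : Config n →ₗ[ℝ] Config n :=
  ω⁻¹ • (fderiv ℝ (rotatingField Γ ω (center Γ z)) z : Config n →ₗ[ℝ] Config n)

/-- The normalized eigenvalues: the complex roots of the characteristic polynomial of the scaled
stability matrix, with algebraic multiplicity. -/
def normalizedEigenvalues {n : ℕ} (Γ : Fin n → ℝ) (ω : ℝ) (z : Config n) : Multiset ℂ :=
  (scaledStability Γ ω z).charpoly.aroots ℂ

/-- `s` is the multiset of nontrivial normalized eigenvalues: the normalized eigenvalues are the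
four trivial ones, `0, 0, i, -i`, together with those in `s`. -/
def HasNontrivialEigenvalues {n : ℕ} (Γ : Fin n → ℝ) (ω : ℝ) (z : Config n)
    (s : Multiset ℂ) : Prop :=
  normalizedEigenvalues Γ ω z = {0, 0, Complex.I, -Complex.I} + s

/-- Spectral stability: the nontrivial eigenvalues are nonzero (nondegeneracy) and lie on the
imaginary axis. -/
def IsSpectrallyStable {n : ℕ} (Γ : Fin n → ℝ) (ω : ℝ) (z : Config n) : Prop :=
  ∃ s : Multiset ℂ, HasNontrivialEigenvalues Γ ω z s ∧ ∀ μ ∈ s, μ ≠ 0 ∧ μ.re = 0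

/-- The `M`-orthogonal complement of `V = span {z - c, K (z - c)}`, where
`M = diag (Γ_1, Γ_1, …, Γ_n, Γ_n)`, `c` is the center of vorticity, and `K` applies `J` to each
of the `n` planar components. -/
def perp {n : ℕ} (Γ : Fin n → ℝ) (z : Config n) : Submodule ℝ (Config n) where
  carrier := {w | ∑ i, Γ i * inner ℝ (z i - center Γ z) (w i) = 0 ∧
    ∑ i, Γ i * inner ℝ (J (z i - center Γ z)) (w i) = 0}
  zero_mem' := by simp
  add_mem' := by
    rintro a b ⟨ha, ha'⟩ ⟨hb, hb'⟩
    simp [inner_add_right, mul_add, Finset.sum_add_distrib, ha, ha', hb, hb']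
  smul_mem' := by
    rintro r a ⟨ha, ha'⟩
    simp [inner_smul_right, mul_left_comm _ r, ← Finset.mul_sum, ha, ha']

/-- Linear stability: spectral stability, and the restriction of the scaled stability matrix to the
`M`-orthogonal complement of `span {z - c, K (z - c)}` is, in a suitable real basis, block diagonal
with blocks `[[0, β_i], [-β_i, 0]]`. -/
def IsLinearlyStable {n : ℕ} (Γ : Fin n → ℝ) (ω : ℝ) (z : Config n) : Prop :=
  IsSpectrallyStable Γ ω z ∧
    ∃ (k : ℕ) (b : Module.Basis (Fin k × Fin 2) ℝ (perp Γ z)) (β : Fin k → ℝ), ∀ i,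
      scaledStability Γ ω z (b (i, 0)) = -β i • (b (i, 1) : Config n) ∧
      scaledStability Γ ω z (b (i, 1)) = β i • (b (i, 0) : Config n)

/-- Instability: some eigenvalue has positive real part. -/
def IsUnstable {n : ℕ} (Γ : Fin n → ℝ) (ω : ℝ) (z : Config n) : Prop :=
  ∃ μ ∈ normalizedEigenvalues Γ ω z, 0 < μ.re

/-- The circulations `Γ₁ = Γ₂ = Γ₃ = 1`, `Γ₄ = m`. -/
def circ (m : ℝ) : Fin 4 → ℝ := ![1, 1, 1, m]

/-- Group I: collinear relative equilibria for the circulations `1, 1, 1, m` in which vortex 4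
(index `3`) lies exterior to the three equal-strength vortices. -/
def IsGroupI (m ω : ℝ) (z : Config 4) : Prop :=
  IsRelativeEquilibrium (circ m) ω z ∧ Collinear ℝ (Set.range z) ∧
    ∀ i j : Fin 4, i ≠ 3 → j ≠ 3 → ¬ Wbtw ℝ (z i) (z 3) (z j)

/-- Group II: collinear relative equilibria for the circulations `1, 1, 1, m` in which vortex 4
(index `3`) lies between two equal-strength vortices. -/
def IsGroupII (m ω : ℝ) (z : Config 4) : Prop :=
  IsRelativeEquilibrium (circ m) ω z ∧ Collinear ℝ (Set.range z) ∧
    ∃ i j : Fin 4, i ≠ 3 ∧ j ≠ 3 ∧ Sbtw ℝ (z i) (z 3) (z j)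

/-- The nontrivial normalized eigenvalues consist of the two real pairs `±a`, `±b`. -/
def HasRealPairs (m ω : ℝ) (z : Config 4) (a b : ℝ) : Prop :=
  HasNontrivialEigenvalues (circ m) ω z {(a : ℂ), -(a : ℂ), (b : ℂ), -(b : ℂ)}

/-- The nontrivial normalized eigenvalues consist of the two imaginary pairs `±i a`, `±i b`. -/
def HasImaginaryPairs (m ω : ℝ) (z : Config 4) (a b : ℝ) : Prop :=
  HasNontrivialEigenvalues (circ m) ω z
    {Complex.I * a, -(Complex.I * a), Complex.I * b, -(Complex.I * b)}

/-- The nontrivial normalized eigenvalues consist of the quartuplet `±a ± i b`. -/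
def HasQuartuplet (m ω : ℝ) (z : Config 4) (a b : ℝ) : Prop :=
  HasNontrivialEigenvalues (circ m) ω z
    {a + Complex.I * b, a - Complex.I * b, -a + Complex.I * b, -a - Complex.I * b}

/-- The polynomial `Ψ` whose roots include the two bifurcation values. -/
def Psi (m : ℝ) : ℝ :=
  64 * m ^ 6 + 320 * m ^ 5 + 96 * m ^ 4 - 220 * m ^ 3 + 505 * m ^ 2 + 522 * m + 9

end

end PointVortex

open PointVortex

/-!
Let the three unit vortices have the coordinates `a, b, c` on the line, relative to vortex 4.

*Linearization.* In the orthonormal frame along and across the line, the scaled stability matrix is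
`[[0, 1 - S], [-(1 + S), 0]]`, where `S = ω⁻¹ A` and `A u = (∑ j, Γ j (u i - u j) / r_{ij}²)ᵢ`
(`scaledStability_frame`). Hence an eigenvalue `μ` of `S` contributes the pair `±√(μ² - 1)`
(`charpoly_scaledStability`). The eigenvalues `0` and `1` of `S`, coming from translation and
dilation, account for `± i, 0, 0`.

*Spectrum.* The equilibrium equations say that the cubic `Q` with roots `a, b, c` divides
`y Q'' + 2 (m - ω y (y + d)) Q'`, which gives polynomial equations in the elementary symmetric
functions `e₁, e₂, e₃` (`equilibrium_iff_symmEquations`). They determine `e₃` and `ω`, and leave a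
quadratic equation for `x = e₂ / e₁²`, with coefficients depending on `m` (`ratioQuad`). In the
basis `1, y, y²` and the indicator of vortex 4, the matrix `S` is block triangular, and the two
nontrivial eigenvalues are the roots of `t² - s t + p` with `s = 5 + σ`,
`p = 6 + 2 σ + m σ / (m + 3)` and `σ = (m - 1) / ((m + 3) x)`
(`LineEquilibrium.charpoly_interaction`). So everything is a function of `m` and `x`.

*The two groups.* Newton's inequality shows that `x` is the larger root of the quadratic for
Group I, and the signs of the coefficients of `Q` show that it is the smaller root for Group II.
Conversely, for these roots the cubic has a positive discriminant, hence three real roots.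

*Signs.* Each statement about the eigenvalues is a statement about the signs of `s² - 4 p`,
`p + 1 - s` and `s - 2`. Each of these compares `x` with a rational function of `m`, and is
decided by the sign of the quadratic at that function, which factors. For `s² - 4 p` the result is
`Ψ(m)` (`ratioQuad_collision`): the eigenvalues of `S` collide at the roots of `Ψ`, inside `(-1, 1)`
for `m*` and outside for `m_c`. The limits follow from the continuity of these functions.

*Linear stability.* For `-1 < m < m*` the matrix `S` has four distinct eigenvalues
`0, 1, μ₁, μ₂` and is symmetric for the form weighted by the circulations; the eigenvectors for
`0, μ₁, μ₂` span the complement of the coordinates relative to the center, and each gives an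
invariant plane on which the flow rotates (`exists_rotation_basis`).
-/

namespace PointVortex

/-! ### Linearization along a line -/

/-- The planar rotation `J` as a continuous linear map. -/
noncomputable def rotL : Plane →L[ℝ] Plane :=
  LinearMap.toContinuousLinearMap
    { toFun := J
      map_add' := fun a b => by ext i; fin_cases i <;> simp [J, add_comm]
      map_smul' := fun r a => by ext i; fin_cases i <;> simp [J] }

@[simp] theorem rotL_apply (v : Plane) : rotL v = J v := rfl

theorem J_injective : Function.Injective J := by
  intro a b h
  have h0 : J a 0 = J b 0 := by rw [h]
  have h1 : J a 1 = J b 1 := by rw [h]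
  simp only [J, PiLp.toLp_apply, Matrix.cons_val_zero, Matrix.cons_val_one] at h0 h1
  ext i
  fin_cases i
  · simpa using h1
  · exact h0

/-- The derivative of inversion in a circle is a scaled reflection; this is why the displacements
along the line and across it decouple, with opposite signs. -/
theorem hasFDerivAt_smul_div_norm_sq (γ : ℝ) {e : Plane} (he : ‖e‖ = 1) {r : ℝ} (hr : r ≠ 0) :
    HasFDerivAt (fun v : Plane => (γ / ‖v‖ ^ 2) • v)
      ((γ / r ^ 2) • (ContinuousLinearMap.id ℝ Plane
        - (2 : ℝ) • (innerSL ℝ e).smulRight e)) (r • e) := by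
  have hn : ‖r • e‖ ^ 2 = r ^ 2 := by rw [norm_smul, he, mul_one, Real.norm_eq_abs, sq_abs]
  have h1 : HasFDerivAt (fun v : Plane => ‖v‖ ^ 2) ((2 : ℝ) • innerSL ℝ (r • e)) (r • e) :=
    (hasStrictFDerivAt_norm_sq (F := Plane) (r • e)).hasFDerivAt.congr_fderiv (by
      rw [two_smul, two_smul])
  have h2 : HasFDerivAt (fun v : Plane => γ / ‖v‖ ^ 2)
      ((-(γ / (r ^ 2) ^ 2)) • ((2 : ℝ) • innerSL ℝ (r • e))) (r • e) := by
    have hd : HasDerivAt (fun t : ℝ => γ / t) (-(γ / (r ^ 2) ^ 2)) (‖r • e‖ ^ 2) := by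
      rw [hn]
      simpa [div_eq_mul_inv] using (hasDerivAt_inv (pow_ne_zero 2 hr)).const_mul γ
    exact HasDerivAt.comp_hasFDerivAt (h₂ := fun t : ℝ => γ / t) (r • e) hd h1
  refine (h2.smul (hasFDerivAt_id (𝕜 := ℝ) (r • e))).congr_fderiv ?_
  ext1 v
  simp only [hn, add_apply, smul_apply, sub_apply, ContinuousLinearMap.smulRight_apply,
    innerSL_apply_apply, ContinuousLinearMap.id_apply, inner_smul_left, id]
  simp only [smul_eq_mul, RCLike.conj_to_real]
  match_scalars
  · ring
  · field_simp

/-- The operator `u ↦ (∑ j, Γ j (u i - u j) / (y i - y j)²)ᵢ`, which governs the linearization at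
vortices with coordinates `y` on a line. The term `j = i` is `0 / 0 = 0`. -/
noncomputable def interaction {n : ℕ} (Γ y : Fin n → ℝ) : (Fin n → ℝ) →ₗ[ℝ] (Fin n → ℝ) where
  toFun u i := ∑ j, Γ j * (u i - u j) / (y i - y j) ^ 2
  map_add' u v := by
    ext i
    simp only [Pi.add_apply, ← Finset.sum_add_distrib]
    exact Finset.sum_congr rfl fun j _ => by ring
  map_smul' c u := by
    ext i
    simp only [Pi.smul_apply, smul_eq_mul, RingHom.id_apply, Finset.mul_sum]
    exact Finset.sum_congr rfl fun j _ => by ring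

theorem interaction_apply {n : ℕ} (Γ y u : Fin n → ℝ) (i : Fin n) :
    interaction Γ y u i = ∑ j, Γ j * (u i - u j) / (y i - y j) ^ 2 := rfl

/-- The displacement with components `u` along `e` and `v` along the normal `-J e`. -/
noncomputable def frame {n : ℕ} (e : Plane) (u v : Fin n → ℝ) : Config n :=
  fun i => u i • e - v i • J e

theorem J_J (e : Plane) : J (J e) = -e := by
  ext i; fin_cases i <;> simp [J]

theorem inner_self_J (e : Plane) : inner ℝ e (J e) = 0 := by
  simp [J, PiLp.inner_apply, Fin.sum_univ_two]; ring

theorem fderiv_rotatingField_frame {n : ℕ} (Γ : Fin n → ℝ) (ω : ℝ) (c : Plane) {z : Config n}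
    {z₀ e : Plane} (he : ‖e‖ = 1) {y : Fin n → ℝ} (hz : ∀ i, z i = z₀ + y i • e)
    (hy : Function.Injective y) (u v : Fin n → ℝ) :
    fderiv ℝ (rotatingField Γ ω c) z (frame e u v) =
      frame e (ω • v - interaction Γ y v) (-(ω • u + interaction Γ y u)) := by
  have key : HasFDerivAt (rotatingField Γ ω c)
      (ContinuousLinearMap.pi fun i => rotL ∘L
        (∑ j ∈ Finset.univ.erase i, ((Γ j / (y j - y i) ^ 2) • (ContinuousLinearMap.id ℝ Plane
          - (2 : ℝ) • (innerSL ℝ e).smulRight e)) ∘L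
          (ContinuousLinearMap.proj (R := ℝ) (φ := fun _ : Fin n => Plane) j
            - ContinuousLinearMap.proj (R := ℝ) (φ := fun _ : Fin n => Plane) i))
        + ω • (rotL ∘L ContinuousLinearMap.proj (R := ℝ) (φ := fun _ : Fin n => Plane) i)) z := by
    rw [hasFDerivAt_pi]
    intro i
    refine HasFDerivAt.add ?_ ?_
    · refine rotL.hasFDerivAt.comp z (HasFDerivAt.fun_sum fun j hj => ?_)
      have hji : y j - y i ≠ 0 := sub_ne_zero.2 fun h => (Finset.ne_of_mem_erase hj) (hy h)
      have h1 : HasFDerivAt (fun w : Config n => w j - w i)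
          (ContinuousLinearMap.proj (R := ℝ) (φ := fun _ : Fin n => Plane) j
            - ContinuousLinearMap.proj (R := ℝ) (φ := fun _ : Fin n => Plane) i) z :=
        (ContinuousLinearMap.proj (R := ℝ) (φ := fun _ : Fin n => Plane) j
            - ContinuousLinearMap.proj (R := ℝ) (φ := fun _ : Fin n => Plane) i).hasFDerivAt
      have h2 := hasFDerivAt_smul_div_norm_sq (Γ j) he hji
      have hzz : (y j - y i) • e = z j - z i := by rw [hz, hz, sub_smul]; abel
      rw [hzz] at h2
      have h3 := h2.comp z h1
      have : (fun w : Config n => (Γ j / dist (w i) (w j) ^ 2) • (w j - w i)) =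
          (fun v : Plane => (Γ j / ‖v‖ ^ 2) • v) ∘ fun w : Config n => w j - w i := by
        ext1 w
        simp only [Function.comp, dist_eq_norm, norm_sub_rev (w i)]
      rw [this]
      exact h3
    · have h1 : HasFDerivAt (fun w : Config n => w i - c)
          (ContinuousLinearMap.proj (R := ℝ) (φ := fun _ : Fin n => Plane) i) z :=
        (ContinuousLinearMap.proj (R := ℝ) (φ := fun _ : Fin n => Plane) i).hasFDerivAt.sub_const c
      exact (rotL.hasFDerivAt.comp z h1).const_smul ω
  have hee : inner ℝ e e = 1 := by rw [real_inner_self_eq_norm_sq, he, one_pow]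
  have hJ : ∀ a b : ℝ, J (a • e + b • J e) = -(b • e) + a • J e := fun a b => by
    have := map_add rotL (a • e) (b • J e)
    rw [map_smul, map_smul] at this
    simp only [rotL_apply, J_J] at this
    rw [this, smul_neg, add_comm]
  rw [key.fderiv]
  ext1 i
  simp only [ContinuousLinearMap.coe_pi', add_apply, ContinuousLinearMap.comp_apply, sum_apply,
    smul_apply, sub_apply, ContinuousLinearMap.proj_apply, rotL_apply,
    ContinuousLinearMap.id_apply, ContinuousLinearMap.smulRight_apply, innerSL_apply_apply]
  have h1 : ∀ j ∈ Finset.univ.erase i, (Γ j / (y j - y i) ^ 2) •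
      (frame e u v j - frame e u v i -
        (2 : ℝ) • (inner ℝ e (frame e u v j - frame e u v i)) • e) =
      (Γ j * (u i - u j) / (y i - y j) ^ 2) • e + (Γ j * (v i - v j) / (y i - y j) ^ 2) • J e := by
    intro j _
    have h2 : frame e u v j - frame e u v i = (u j - u i) • e + (v i - v j) • J e := by
      simp only [frame, sub_smul]; abel
    have h3 : inner ℝ e (frame e u v j - frame e u v i) = u j - u i := by
      rw [h2, inner_add_right, inner_smul_right, inner_smul_right, hee, inner_self_J]; ring
    rw [h3, h2, show (y i - y j) ^ 2 = (y j - y i) ^ 2 by ring]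
    module
  have h4 : ∀ w : Fin n → ℝ, ∑ j ∈ Finset.univ.erase i, Γ j * (w i - w j) / (y i - y j) ^ 2
      = interaction Γ y w i := fun w => by
    rw [interaction_apply, ← Finset.add_sum_erase _ _ (Finset.mem_univ i)]
    simp
  rw [Finset.sum_congr rfl h1, Finset.sum_add_distrib, ← Finset.sum_smul, ← Finset.sum_smul, h4, h4,
    hJ]
  have h5 : frame e u v i = u i • e + (-v i) • J e := by simp only [frame]; module
  rw [h5, hJ]
  simp only [frame, Pi.sub_apply, Pi.add_apply, Pi.neg_apply, Pi.smul_apply, smul_eq_mul]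
  module

/-- In the frame along and across the line, the scaled stability matrix is the block matrix
`[[0, 1 - S], [-(1 + S), 0]]` with `S` the scaled interaction operator. -/
theorem scaledStability_frame {n : ℕ} (Γ : Fin n → ℝ) {ω : ℝ} (hω : ω ≠ 0) {z : Config n}
    {z₀ e : Plane} (he : ‖e‖ = 1) {y : Fin n → ℝ} (hz : ∀ i, z i = z₀ + y i • e)
    (hy : Function.Injective y) (u v : Fin n → ℝ) :
    scaledStability Γ ω z (frame e u v) =
      frame e (v - (ω⁻¹ • interaction Γ y) v) (-(u + (ω⁻¹ • interaction Γ y) u)) := by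
  simp only [scaledStability, LinearMap.smul_apply, ContinuousLinearMap.coe_coe]
  rw [fderiv_rotatingField_frame Γ ω _ he hz hy]
  ext1 i
  simp only [frame, Pi.sub_apply, Pi.add_apply, Pi.neg_apply, Pi.smul_apply, smul_eq_mul]
  match_scalars <;> field_simp

/-! ### Equilibrium equations and characteristic polynomial on a line -/

theorem center_line {n : ℕ} {Γ : Fin n → ℝ} (hΓ : ∑ i, Γ i ≠ 0) {z : Config n}
    {z₀ e : Plane} {y : Fin n → ℝ} (hz : ∀ i, z i = z₀ + y i • e) :
    center Γ z = z₀ + ((∑ i, Γ i * y i) / ∑ i, Γ i) • e := by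
  simp only [center, hz, smul_add, Finset.sum_add_distrib, smul_smul, ← Finset.sum_smul]
  rw [inv_mul_cancel₀ hΓ, one_smul, inv_mul_eq_div]

/-- The rest points of the rotating field on a line, by scalar equations; the term `j = i` of the
sum is `Γ i / 0 = 0`. -/
theorem rotatingField_line_eq_zero_iff {n : ℕ} {Γ : Fin n → ℝ} (hΓ : ∑ i, Γ i ≠ 0) (ω : ℝ)
    {z : Config n} {z₀ e : Plane} (he : ‖e‖ = 1) {y : Fin n → ℝ}
    (hz : ∀ i, z i = z₀ + y i • e) :
    rotatingField Γ ω (center Γ z) z = 0 ↔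
      ∀ i, ∑ j, Γ j / (y i - y j) = ω * (y i - (∑ i, Γ i * y i) / ∑ i, Γ i) := by
  rw [center_line hΓ hz, funext_iff]
  refine forall_congr' fun i => ?_
  set a := (∑ i, Γ i * y i) / ∑ i, Γ i
  have h1 : ∀ j ∈ Finset.univ.erase i, (Γ j / dist (z i) (z j) ^ 2) • (z j - z i) =
      (-(Γ j / (y i - y j))) • e := by
    intro j _
    have h2 : z i - z j = (y i - y j) • e := by rw [hz, hz]; module
    have h3 : z j - z i = -((y i - y j) • e) := by rw [← h2]; abel
    rw [dist_eq_norm, h2, norm_smul, he, mul_one, Real.norm_eq_abs, sq_abs, h3, ← neg_smul,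
      smul_smul]
    congr 1
    rcases eq_or_ne (y i - y j) 0 with h | h
    · simp [h]
    · field_simp
  have h4 : ∑ j ∈ Finset.univ.erase i, Γ j / (y i - y j) = ∑ j, Γ j / (y i - y j) := by
    rw [← Finset.add_sum_erase _ _ (Finset.mem_univ i)]
    simp
  have h5 : z i - (z₀ + a • e) = (y i - a) • e := by rw [hz]; module
  have h6 : rotatingField Γ ω (z₀ + a • e) z i =
      rotL ((ω * (y i - a) - ∑ j, Γ j / (y i - y j)) • e) := by
    simp only [rotatingField, velocity]
    rw [Finset.sum_congr rfl h1, ← Finset.sum_smul, Finset.sum_neg_distrib, h4, h5,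
      ← rotL_apply, ← rotL_apply, ← map_smul, ← map_add]
    congr 1
    module
  have he0 : e ≠ 0 := fun h => by simp [h] at he
  have hJ0 : (0 : Plane) = rotL 0 := (map_zero _).symm
  rw [h6, Pi.zero_apply, hJ0, rotL_apply, rotL_apply, J_injective.eq_iff, smul_eq_zero,
    or_iff_left he0, sub_eq_zero]
  exact eq_comm

theorem norm_J (e : Plane) : ‖J e‖ = ‖e‖ := by
  simp [J, EuclideanSpace.norm_eq, add_comm]

/-- The coordinates of a displacement with respect to the orthonormal frame `e`, `-J e`. -/
noncomputable def frameEquiv {n : ℕ} {e : Plane} (he : ‖e‖ = 1) :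
    (Fin n ⊕ Fin n → ℝ) ≃ₗ[ℝ] Config n where
  toFun g := frame e (g ∘ Sum.inl) (g ∘ Sum.inr)
  map_add' a b := by ext1 i; simp only [frame, Function.comp, Pi.add_apply]; module
  map_smul' r a := by
    ext1 i
    simp only [frame, Function.comp, Pi.smul_apply, smul_eq_mul, RingHom.id_apply]
    module
  invFun w := Sum.elim (fun i => inner ℝ e (w i)) (fun i => -inner ℝ (J e) (w i))
  left_inv g := by
    have hJJ : ‖J e‖ = 1 := by rw [norm_J, he]
    have hJe : inner ℝ (J e) e = 0 := by rw [real_inner_comm]; exact inner_self_J e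
    ext (i | i)
    · simp [frame, inner_sub_right, inner_smul_right, he, inner_self_J]
    · simp [frame, inner_sub_right, inner_smul_right, hJJ, hJe]
  right_inv w := by
    have hee : inner ℝ e e = 1 := by rw [real_inner_self_eq_norm_sq, he, one_pow]
    simp only [PiLp.inner_apply, Fin.sum_univ_two, RCLike.inner_apply, conj_trivial] at hee
    ext i j
    fin_cases j
    · simp [frame, J, PiLp.inner_apply, Fin.sum_univ_two]
      linear_combination (w i 0) * hee
    · simp [frame, J, PiLp.inner_apply, Fin.sum_univ_two]
      linear_combination (w i 1) * hee

theorem frameEquiv_apply {n : ℕ} {e : Plane} (he : ‖e‖ = 1) (g : Fin n ⊕ Fin n → ℝ) :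
    frameEquiv he g = frame e (g ∘ Sum.inl) (g ∘ Sum.inr) := rfl

/-- If `N` has characteristic polynomial `t (t - 1) (t² - s t + p)` then the block matrix
`[[0, 1 - N], [-(1 + N), 0]]` has the eigenvalues `√(μ² - 1)` for `μ` an eigenvalue of `N`:
`det (t² + 1 - N²) = det (r - N) det (r + N)` where `r² = t² + 1`. -/
theorem charpoly_fromBlocks_one_sub_one_add (N : Matrix (Fin 4) (Fin 4) ℝ) {s p : ℝ}
    (hN : ∀ t : ℝ, N.charpoly.eval t = t * (t - 1) * (t ^ 2 - s * t + p)) :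
    (Matrix.fromBlocks 0 (1 - N) (-(1 + N)) 0).charpoly =
      Polynomial.X ^ 2 * (Polynomial.X ^ 2 + 1) *
        (Polynomial.X ^ 4 - Polynomial.C (s ^ 2 - 2 * p - 2) * Polynomial.X ^ 2 +
          Polynomial.C ((p + 1) ^ 2 - s ^ 2)) := by
  refine Polynomial.eq_of_infinite_eval_eq _ _ (Set.Infinite.mono (s := {t : ℝ | t ≠ 0}) ?_
    (Set.infinite_of_finite_compl (by simp [Set.compl_def])))
  intro t ht
  have ht' : t ≠ 0 := ht
  have hdet : ∀ r : ℝ, (Matrix.scalar (Fin 4) r - N).det =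
      r * (r - 1) * (r ^ 2 - s * r + p) := fun r => by rw [← hN, Matrix.eval_charpoly]
  set r := √(t ^ 2 + 1)
  have hr : r ^ 2 = t ^ 2 + 1 := Real.sq_sqrt (by positivity)
  have hblock : Matrix.scalar (Fin 4 ⊕ Fin 4) t - Matrix.fromBlocks 0 (1 - N) (-(1 + N)) 0 =
      Matrix.fromBlocks (t • 1) (N - 1) (1 + N) (t • 1) := by
    rw [Matrix.scalar_apply, ← Matrix.smul_one_eq_diagonal, ← Matrix.fromBlocks_one,
      Matrix.fromBlocks_smul, sub_eq_add_neg, Matrix.fromBlocks_neg, Matrix.fromBlocks_add]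
    simp
  have hinv : Invertible (t • (1 : Matrix (Fin 4) (Fin 4) ℝ)) :=
    ⟨t⁻¹ • 1, by simp [smul_smul, ht'], by simp [smul_smul, ht']⟩
  have hinv' : ⅟(t • (1 : Matrix (Fin 4) (Fin 4) ℝ)) = t⁻¹ • 1 :=
    invOf_eq_right_inv (by simp [smul_smul, ht'])
  have hprod : t • (t • (1 : Matrix (Fin 4) (Fin 4) ℝ) - (1 + N) * (t⁻¹ • 1) * (N - 1)) =
      -((Matrix.scalar (Fin 4) r - N) * (Matrix.scalar (Fin 4) (-r) - N)) := by
    have h1 : Matrix.scalar (Fin 4) r = r • (1 : Matrix (Fin 4) (Fin 4) ℝ) := by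
      rw [Matrix.scalar_apply, ← Matrix.smul_one_eq_diagonal]
    have h2 : Matrix.scalar (Fin 4) (-r) = (-r) • (1 : Matrix (Fin 4) (Fin 4) ℝ) := by
      rw [Matrix.scalar_apply, ← Matrix.smul_one_eq_diagonal]
    rw [h1, h2]
    simp only [smul_sub, sub_mul, mul_sub, add_mul, one_mul, mul_one, smul_mul_assoc,
      mul_smul_comm, smul_smul, mul_inv_cancel₀ ht', one_smul, smul_add]
    have : (-r * r) • (1 : Matrix (Fin 4) (Fin 4) ℝ) = -((t * t + 1) • 1) := by
      rw [← neg_smul]; congr 1; linear_combination -hr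
    rw [this]
    module
  rw [Set.mem_ofPred_eq, Matrix.eval_charpoly, hblock, Matrix.det_fromBlocks₁₁, hinv']
  have h3 : (t • (1 : Matrix (Fin 4) (Fin 4) ℝ)).det = t ^ 4 := by simp
  have h4 := congrArg Matrix.det hprod
  rw [Matrix.det_smul, Matrix.det_neg, Matrix.det_mul, hdet, hdet] at h4
  simp only [Fintype.card_fin] at h4
  rw [h3, h4]
  simp only [Polynomial.eval_mul, Polynomial.eval_pow, Polynomial.eval_X, Polynomial.eval_add,
    Polynomial.eval_sub, Polynomial.eval_one, Polynomial.eval_C]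
  have h5 : r ^ 4 = (t ^ 2 + 1) ^ 2 := by rw [← hr]; ring
  have h6 : (-1) ^ 4 * (r * (r - 1) * (r ^ 2 - s * r + p) *
      (-r * (-r - 1) * ((-r) ^ 2 - s * -r + p))) =
      r ^ 2 * (r ^ 2 - 1) * ((r ^ 2 + p) ^ 2 - s ^ 2 * r ^ 2) := by ring
  rw [h6, hr]
  ring

/-- The characteristic polynomial of the scaled stability matrix of four vortices on a line. -/
theorem charpoly_scaledStability {Γ : Fin 4 → ℝ} {ω : ℝ} (hω : ω ≠ 0) {z : Config 4}
    {z₀ e : Plane} (he : ‖e‖ = 1) {y : Fin 4 → ℝ} (hz : ∀ i, z i = z₀ + y i • e)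
    (hy : Function.Injective y) {s p : ℝ}
    (hS : ∀ t : ℝ, (ω⁻¹ • interaction Γ y).charpoly.eval t =
      t * (t - 1) * (t ^ 2 - s * t + p)) :
    (scaledStability Γ ω z).charpoly =
      Polynomial.X ^ 2 * (Polynomial.X ^ 2 + 1) *
        (Polynomial.X ^ 4 - Polynomial.C (s ^ 2 - 2 * p - 2) * Polynomial.X ^ 2 +
          Polynomial.C ((p + 1) ^ 2 - s ^ 2)) := by
  set S := ω⁻¹ • interaction Γ y with hSdef
  have hN : ∀ t : ℝ, S.toMatrix'.charpoly.eval t = t * (t - 1) * (t ^ 2 - s * t + p) := by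
    intro t
    rw [← hS, ← LinearMap.charpoly_toMatrix S (Pi.basisFun ℝ (Fin 4)),
      LinearMap.toMatrix_eq_toMatrix']
  rw [← charpoly_fromBlocks_one_sub_one_add _ hN, ← Matrix.charpoly_toLin',
    ← LinearEquiv.charpoly_conj (frameEquiv he)]
  congr 1
  refine LinearMap.ext fun w => ?_
  obtain ⟨g, rfl⟩ := (frameEquiv he).surjective w
  rw [LinearEquiv.conj_apply_apply, LinearEquiv.symm_apply_apply, frameEquiv_apply,
    scaledStability_frame Γ hω he hz hy, frameEquiv_apply, Matrix.toLin'_apply,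
    Matrix.fromBlocks_mulVec]
  simp only [Sum.elim_comp_inl, Sum.elim_comp_inr, Matrix.zero_mulVec, zero_add, add_zero,
    Matrix.sub_mulVec, Matrix.neg_mulVec, Matrix.add_mulVec, Matrix.one_mulVec,
    LinearMap.toMatrix'_mulVec]
  rfl

/-! ### Collinear equilibria with three equal vortices -/

/-- The equations, in the elementary symmetric functions `e₁, e₂, e₃` of the coordinates relative
to vortex 4 of the three equal vortices, of a collinear relative equilibrium with circulations
`1, 1, 1, m` and angular velocity `ω`; the center of vorticity has the coordinate `-d`. -/
structure SymmEquations (m ω d e₁ e₂ e₃ : ℝ) : Prop where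
  quad : 6 + 6 * m + 4 * ω * e₂ - 2 * ω * d * e₁ - 2 * ω * e₁ ^ 2 = 0
  lin : -(2 + 4 * m) * e₁ + 4 * ω * d * e₂ + 2 * ω * e₁ * e₂ - 6 * ω * e₃ = 0
  force : ω * d * e₃ = -e₂
  center : (3 + m) * d = -e₁

/-- A quadratic polynomial with three distinct roots is zero. -/
theorem quadratic_eq_zero_of_three_roots {a b c r₂ r₁ r₀ : ℝ} (hab : a ≠ b) (hac : a ≠ c)
    (hbc : b ≠ c) (ha : r₂ * a ^ 2 + r₁ * a + r₀ = 0) (hb : r₂ * b ^ 2 + r₁ * b + r₀ = 0)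
    (hc : r₂ * c ^ 2 + r₁ * c + r₀ = 0) : r₂ = 0 ∧ r₁ = 0 ∧ r₀ = 0 := by
  have h1 : r₂ * (a + b) + r₁ = 0 :=
    mul_left_cancel₀ (sub_ne_zero.2 hab) (by linear_combination ha - hb)
  have h2 : r₂ * (a + c) + r₁ = 0 :=
    mul_left_cancel₀ (sub_ne_zero.2 hac) (by linear_combination ha - hc)
  have h3 : r₂ = 0 :=
    mul_left_cancel₀ (sub_ne_zero.2 hbc) (by linear_combination h1 - h2)
  subst h3
  have h4 : r₁ = 0 := by linarith
  subst h4
  exact ⟨rfl, rfl, by linarith⟩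

section

variable {m ω d a b c : ℝ}

/-- The equilibrium condition at the root `a` of the cubic `Q` with roots `a, b, c` says that
`y Q'' + 2 (m - ω y (y + d)) Q'` vanishes there; reduced modulo `Q` it is quadratic in `a`. -/
theorem equilibrium_at_root_iff (ha : a ≠ 0) (hab : a ≠ b) (hac : a ≠ c) :
    1 / (a - b) + 1 / (a - c) + m / a = ω * (a + d) ↔
      (6 + 6 * m + 4 * ω * (a * b + a * c + b * c) - 2 * ω * d * (a + b + c)
          - 2 * ω * (a + b + c) ^ 2) * a ^ 2
        + (-(2 + 4 * m) * (a + b + c) + 4 * ω * d * (a * b + a * c + b * c)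
          + 2 * ω * (a + b + c) * (a * b + a * c + b * c) - 6 * ω * (a * b * c)) * a
        + (2 * m * (a * b + a * c + b * c)
          - (2 * ω * (a + b + c) + 6 * ω * d) * (a * b * c)) = 0 := by
  have h1 : a - b ≠ 0 := sub_ne_zero.2 hab
  have h2 : a - c ≠ 0 := sub_ne_zero.2 hac
  have key : 1 / (a - b) + 1 / (a - c) + m / a - ω * (a + d) =
      (a * ((a - c) + (a - b)) + (m - ω * a * (a + d)) * ((a - b) * (a - c))) /
        (a * (a - b) * (a - c)) := by
    field_simp
    ring
  rw [← sub_eq_zero, key, div_eq_zero_iff, or_iff_left (by positivity)]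
  constructor <;> intro h
  · linear_combination 2 * h
  · linear_combination h / 2

theorem equilibrium_four_iff (ha : a ≠ 0) (hb : b ≠ 0) (hc : c ≠ 0) :
    -(1 / a + 1 / b + 1 / c) = ω * d ↔ ω * d * (a * b * c) = -(a * b + a * c + b * c) := by
  have key : 1 / a + 1 / b + 1 / c = (a * b + a * c + b * c) / (a * b * c) := by
    field_simp
    ring
  rw [key, ← neg_div, div_eq_iff (by positivity)]
  exact eq_comm

/-- The equilibrium equations are equivalent to polynomial equations in the elementary symmetric
functions. -/
theorem equilibrium_iff_symmEquations (hm : 3 + m ≠ 0) (ha : a ≠ 0) (hb : b ≠ 0) (hc : c ≠ 0)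
    (hab : a ≠ b) (hac : a ≠ c) (hbc : b ≠ c) (hd : d = -(a + b + c) / (3 + m)) :
    (1 / (a - b) + 1 / (a - c) + m / a = ω * (a + d) ∧
      1 / (b - a) + 1 / (b - c) + m / b = ω * (b + d) ∧
      1 / (c - a) + 1 / (c - b) + m / c = ω * (c + d) ∧
      -(1 / a + 1 / b + 1 / c) = ω * d) ↔
    SymmEquations m ω d (a + b + c) (a * b + a * c + b * c) (a * b * c) := by
  rw [equilibrium_at_root_iff ha hab hac, equilibrium_at_root_iff hb hab.symm hbc,
    equilibrium_at_root_iff hc hac.symm hbc.symm, equilibrium_four_iff ha hb hc]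
  constructor
  · rintro ⟨h1, h2, h3, h4⟩
    have hq := quadratic_eq_zero_of_three_roots hab hac hbc h1
      (r₂ := 6 + 6 * m + 4 * ω * (a * b + a * c + b * c) - 2 * ω * d * (a + b + c)
          - 2 * ω * (a + b + c) ^ 2)
      (r₁ := -(2 + 4 * m) * (a + b + c) + 4 * ω * d * (a * b + a * c + b * c)
          + 2 * ω * (a + b + c) * (a * b + a * c + b * c) - 6 * ω * (a * b * c))
      (r₀ := 2 * m * (a * b + a * c + b * c)
          - (2 * ω * (a + b + c) + 6 * ω * d) * (a * b * c))
      (by linear_combination h2) (by linear_combination h3)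
    exact ⟨hq.1, hq.2.1, h4, by rw [hd]; field_simp⟩
  · rintro ⟨h1, h2, h4, h5⟩
    -- the constant term of the reduced equation is a consequence of the other two relations
    have h0 : 2 * m * (a * b + a * c + b * c)
          - (2 * ω * (a + b + c) + 6 * ω * d) * (a * b * c) = 0 := by
      linear_combination 2 * m * h4 - 2 * ω * (a * b * c) * h5
    refine ⟨?_, ?_, ?_, h4⟩
    · linear_combination a ^ 2 * h1 + a * h2 + h0
    · linear_combination b ^ 2 * h1 + b * h2 + h0
    · linear_combination c ^ 2 * h1 + c * h2 + h0

end

namespace SymmEquations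

variable {m ω d e₁ e₂ e₃ : ℝ}

theorem e₁_ne_zero (h : SymmEquations m ω d e₁ e₂ e₃) (hm : 3 + m ≠ 0) (hm' : 1 + m ≠ 0) :
    e₁ ≠ 0 := by
  rintro rfl
  have hd : d = 0 := by
    have := h.center
    rw [neg_zero, mul_eq_zero] at this
    exact this.resolve_left hm
  have h2 : e₂ = 0 := by have := h.force; rw [hd] at this; linarith
  have := h.quad
  rw [h2, hd] at this
  exact hm' (by linarith)

theorem e₂_ne_zero (h : SymmEquations m ω d e₁ e₂ e₃) (hm : 3 + m ≠ 0) (hm' : 1 + m ≠ 0)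
    (hω : ω ≠ 0) (h3 : e₃ ≠ 0) : e₂ ≠ 0 := by
  rintro rfl
  have hf := h.force
  rw [neg_zero, mul_eq_zero, mul_eq_zero, or_iff_left h3, or_iff_right hω] at hf
  refine h.e₁_ne_zero hm hm' ?_
  have := h.center
  rw [hf] at this
  linarith

theorem omega_mul (h : SymmEquations m ω d e₁ e₂ e₃) : ω * e₁ * e₃ = (3 + m) * e₂ := by
  linear_combination ω * e₃ * h.center - (3 + m) * h.force

theorem rel_quad (h : SymmEquations m ω d e₁ e₂ e₃) :
    (3 + 3 * m) * e₁ * e₃ = e₂ * ((m + 2) * e₁ ^ 2 - 2 * (3 + m) * e₂) := by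
  linear_combination e₁ * e₃ / 2 * h.quad - (2 * e₂ - e₁ ^ 2) * h.omega_mul + e₁ ^ 2 * h.force

theorem rel_lin (h : SymmEquations m ω d e₁ e₂ e₃) :
    e₃ * ((1 + 2 * m) * e₁ ^ 2 + 3 * (3 + m) * e₂) = (1 + m) * e₁ * e₂ ^ 2 := by
  linear_combination (-e₁ * e₃ / 2) * h.lin + (e₁ * e₂ - 3 * e₃) * h.omega_mul
    + 2 * e₁ * e₂ * h.force

/-- The quadratic equation satisfied by `e₂ / e₁²`. -/
theorem quadratic (h : SymmEquations m ω d e₁ e₂ e₃) (h2 : e₂ ≠ 0) :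
    6 * (3 + m) ^ 2 * e₂ ^ 2 + (4 * m + 9) * (m - 1) * e₁ ^ 2 * e₂
      - (m + 2) * (2 * m + 1) * e₁ ^ 4 = 0 := by
  refine mul_left_cancel₀ h2 ?_
  linear_combination ((1 + 2 * m) * e₁ ^ 2 + 3 * (3 + m) * e₂) * h.rel_quad
    - (3 + 3 * m) * e₁ * h.rel_lin

end SymmEquations

/-! ### The spectrum of the interaction matrix -/

section

variable {m ω d a b c : ℝ}

theorem interaction_circ_apply (a b c : ℝ) (u : Fin 4 → ℝ) :
    interaction (circ m) ![a, b, c, 0] u =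
      ![(u 0 - u 1) / (a - b) ^ 2 + (u 0 - u 2) / (a - c) ^ 2 + m * (u 0 - u 3) / a ^ 2,
        (u 1 - u 0) / (b - a) ^ 2 + (u 1 - u 2) / (b - c) ^ 2 + m * (u 1 - u 3) / b ^ 2,
        (u 2 - u 0) / (c - a) ^ 2 + (u 2 - u 1) / (c - b) ^ 2 + m * (u 2 - u 3) / c ^ 2,
        (u 3 - u 0) / a ^ 2 + (u 3 - u 1) / b ^ 2 + (u 3 - u 2) / c ^ 2] := by
  ext i
  rw [interaction_apply, Fin.sum_univ_four]
  fin_cases i <;> simp [circ]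

/-- In the basis consisting of the polynomials `1, y, y²` in the coordinate and the indicator of
vortex 4, the scaled interaction matrix is block triangular, with diagonal entries `0` and `1`
and one `2 × 2` block; the entries are symmetric functions of the coordinates. -/
theorem charpoly_interaction (hω : ω ≠ 0) (ha : a ≠ 0) (hb : b ≠ 0) (hc : c ≠ 0)
    (hab : a ≠ b) (hac : a ≠ c) (hbc : b ≠ c)
    (hEa : 1 / (a - b) + 1 / (a - c) + m / a = ω * (a + d))
    (hEb : 1 / (b - a) + 1 / (b - c) + m / b = ω * (b + d))
    (hEc : 1 / (c - a) + 1 / (c - b) + m / c = ω * (c + d))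
    (hE4 : -(1 / a + 1 / b + 1 / c) = ω * d) {e₁ e₂ e₃ D : ℝ} (he₁ : e₁ = a + b + c)
    (he₂ : e₂ = a * b + a * c + b * c) (he₃ : e₃ = a * b * c)
    (hD : ω * D * e₃ ^ 2 = (1 + m) * e₂ ^ 2 - (2 + m) * e₁ * e₃) (t : ℝ) :
    (ω⁻¹ • interaction (circ m) ![a, b, c, 0]).charpoly.eval t =
      t * (t - 1) * (t ^ 2 - (2 + D) * t + (2 * D + m * (m - 1) * e₂ / (ω * e₃) ^ 2)) := by
  have h3 : e₃ ≠ 0 := by rw [he₃]; positivity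
  set S := ω⁻¹ • interaction (circ m) ![a, b, c, 0] with hS
  have hab' := sub_ne_zero.2 hab
  have hac' := sub_ne_zero.2 hac
  have hbc' := sub_ne_zero.2 hbc
  have hba' := sub_ne_zero.2 hab.symm
  have hca' := sub_ne_zero.2 hac.symm
  have hcb' := sub_ne_zero.2 hbc.symm
  have row_one : ∀ x y z : ℝ, x ≠ 0 → x - y ≠ 0 → x - z ≠ 0 →
      1 / (x - y) + 1 / (x - z) + m / x = ω * (x + d) →
      (x - y) / (x - y) ^ 2 + (x - z) / (x - z) ^ 2 + m * x / x ^ 2 = ω * (d + x) := by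
    intro x y z hx hy hz hE
    have h1 : (x - y) / (x - y) ^ 2 = 1 / (x - y) := by field_simp
    have h2 : (x - z) / (x - z) ^ 2 = 1 / (x - z) := by field_simp
    have h3 : m * x / x ^ 2 = m / x := by field_simp
    rw [h1, h2, h3, hE, add_comm d]
  have row_two : ∀ x y z : ℝ, x ≠ 0 → x - y ≠ 0 → x - z ≠ 0 →
      1 / (x - y) + 1 / (x - z) + m / x = ω * (x + d) →
      (x ^ 2 - y ^ 2) / (x - y) ^ 2 + (x ^ 2 - z ^ 2) / (x - z) ^ 2 + m * x ^ 2 / x ^ 2 =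
        ω * ((-2 + -m) / ω + x * (2 * d) + x ^ 2 * 2) := by
    intro x y z hx hy hz hE
    have h1 : (x ^ 2 - y ^ 2) / (x - y) ^ 2 = 2 * x * (1 / (x - y)) - 1 := by field_simp; ring
    have h2 : (x ^ 2 - z ^ 2) / (x - z) ^ 2 = 2 * x * (1 / (x - z)) - 1 := by field_simp; ring
    have h3 : m * x ^ 2 / x ^ 2 = 2 * x * (m / x) - m := by field_simp; ring
    have h4 : ω * ((-2 + -m) / ω + x * (2 * d) + x ^ 2 * 2) =
        -2 - m + ω * (x * (2 * d) + x ^ 2 * 2) := by field_simp; ring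
    rw [h1, h2, h3, h4]
    linear_combination 2 * x * hE
  have row_three : ∀ x : ℝ, x ≠ 0 → x ^ 3 - e₁ * x ^ 2 + e₂ * x - e₃ = 0 →
      -m / x ^ 2 = ω * (-(m * (e₂ ^ 2 / e₃ ^ 2 - e₁ / e₃)) / ω +
        x * (-(m * (e₃⁻¹ - e₁ * e₂ / e₃ ^ 2)) / ω) + x ^ 2 * (-(m * (e₂ / e₃ ^ 2)) / ω)) := by
    intro x hx h
    have h1 : 1 / x ^ 2 = e₂ / e₃ ^ 2 * x ^ 2 + (1 / e₃ - e₁ * e₂ / e₃ ^ 2) * x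
        + (e₂ ^ 2 / e₃ ^ 2 - e₁ / e₃) := by
      field_simp
      linear_combination (-e₃ - e₂ * x) * h
    rw [neg_div, ← mul_one_div, h1]
    field_simp
    ring
  have hinv4 : 1 / a ^ 2 + 1 / b ^ 2 + 1 / c ^ 2 = (e₂ ^ 2 - 2 * e₁ * e₃) / e₃ ^ 2 := by
    rw [he₁, he₂, he₃]; field_simp; ring
  have hDω : D = ((1 + m) * e₂ ^ 2 - (2 + m) * e₁ * e₃) / (ω * e₃ ^ 2) := by
    rw [eq_div_iff (by positivity)]; linear_combination hD
  let P : Matrix (Fin 4) (Fin 4) ℝ :=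
    !![1, a, a ^ 2, 0; 1, b, b ^ 2, 0; 1, c, c ^ 2, 0; 1, 0, 0, 1]
  let N : Matrix (Fin 4) (Fin 4) ℝ :=
    !![0, d, -(m + 2) / ω, -m * (e₂ ^ 2 / e₃ ^ 2 - e₁ / e₃) / ω;
       0, 1, 2 * d, -m * (1 / e₃ - e₁ * e₂ / e₃ ^ 2) / ω;
       0, 0, 2, -m * (e₂ / e₃ ^ 2) / ω;
       0, 0, (m - 1) / ω, D]
  have hdetP : P.det ≠ 0 := by
    have : P.det = (b - a) * (c - a) * (c - b) := by
      simp [P, Matrix.det_succ_row_zero, Fin.sum_univ_succ, Fin.succAbove]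
      ring
    rw [this]
    positivity
  have hcol : ∀ i j, S (fun k => P k j) i = (P * N) i j := by
    intro i j
    rw [hS, LinearMap.smul_apply, interaction_circ_apply, Matrix.mul_apply, Fin.sum_univ_four,
      Pi.smul_apply, smul_eq_mul, inv_mul_eq_iff_eq_mul₀ hω]
    fin_cases i <;> fin_cases j <;> simp [P, N]
    · exact row_one a b c ha hab' hac' hEa
    · exact row_two a b c ha hab' hac' hEa
    · exact row_three a ha (by rw [he₁, he₂, he₃]; ring)
    · exact row_one b a c hb hba' hbc' hEb
    · exact row_two b a c hb hba' hbc' hEb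
    · exact row_three b hb (by rw [he₁, he₂, he₃]; ring)
    · exact row_one c a b hc hca' hcb' hEc
    · exact row_two c a b hc hca' hcb' hEc
    · exact row_three c hc (by rw [he₁, he₂, he₃]; ring)
    · rw [← hE4]; field_simp; ring
    · field_simp; ring
    · simp only [one_div] at hinv4
      rw [hinv4, hDω]
      field_simp
      ring
  have hPN : S.toMatrix' * P = P * N := by
    ext i j
    rw [← hcol, ← LinearMap.toMatrix'_mulVec]
    rfl
  have h1 : S.charpoly.eval t * P.det = P.det * (Matrix.scalar (Fin 4) t - N).det := by
    rw [← LinearMap.charpoly_toMatrix S (Pi.basisFun ℝ (Fin 4)),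
      LinearMap.toMatrix_eq_toMatrix', Matrix.eval_charpoly, ← Matrix.det_mul, ← Matrix.det_mul,
      sub_mul, mul_sub, hPN, Matrix.scalar_commute _ (Commute.all t)]
  have h2 : (Matrix.scalar (Fin 4) t - N).det =
      t * (t - 1) * (t ^ 2 - (2 + D) * t + (2 * D + m * (m - 1) * e₂ / (ω * e₃) ^ 2)) := by
    simp [N, Matrix.det_succ_row_zero, Fin.sum_univ_succ, Fin.succAbove]
    field_simp
    ring
  rw [mul_comm, h2] at h1
  exact mul_left_cancel₀ hdetP h1

end

/-! ### The quadratic for `e₂ / e₁²` -/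

/-- The quadratic polynomial in `x = e₂ / e₁²` whose roots give the collinear equilibria. -/
noncomputable def ratioQuad (m x : ℝ) : ℝ :=
  6 * (m + 3) ^ 2 * x ^ 2 + (4 * m + 9) * (m - 1) * x - (m + 2) * (2 * m + 1)

/-- The discriminant of `ratioQuad m`. -/
noncomputable def ratioDisc (m : ℝ) : ℝ :=
  64 * m ^ 4 + 448 * m ^ 3 + 1153 * m ^ 2 + 1278 * m + 513

/-- The larger root of `ratioQuad m`, the value of `e₂ / e₁²` for Group I. -/
noncomputable def ratioI (m : ℝ) : ℝ :=
  (-((4 * m + 9) * (m - 1)) + √(ratioDisc m)) / (12 * (m + 3) ^ 2)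

/-- The smaller root of `ratioQuad m`, the value of `e₂ / e₁²` for Group II. -/
noncomputable def ratioII (m : ℝ) : ℝ :=
  (-((4 * m + 9) * (m - 1)) - √(ratioDisc m)) / (12 * (m + 3) ^ 2)

theorem ratioDisc_pos {m : ℝ} (hm : -1 < m) : 0 < ratioDisc m := by
  obtain ⟨n, hn, rfl⟩ : ∃ n : ℝ, 0 < n ∧ m = n - 1 := ⟨m + 1, by linarith, by ring⟩
  have : ratioDisc (n - 1) = 64 * n ^ 4 + 192 * n ^ 3 + 193 * n ^ 2 + 60 * n + 4 := by
    simp only [ratioDisc]; ring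
  rw [this]; positivity

/-- Completing the square. -/
theorem sq_eq_ratioDisc_add (m x : ℝ) :
    (12 * (m + 3) ^ 2 * x + (4 * m + 9) * (m - 1)) ^ 2 =
      ratioDisc m + 24 * (m + 3) ^ 2 * ratioQuad m x := by
  simp only [ratioDisc, ratioQuad]; ring

section

variable {m x : ℝ}

theorem ratioI_spec (hm : -1 < m) :
    12 * (m + 3) ^ 2 * ratioI m + (4 * m + 9) * (m - 1) = √(ratioDisc m) := by
  have : m + 3 ≠ 0 := by linarith
  rw [ratioI, mul_div_cancel₀ _ (by positivity)]; ring

theorem ratioII_spec (hm : -1 < m) :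
    12 * (m + 3) ^ 2 * ratioII m + (4 * m + 9) * (m - 1) = -√(ratioDisc m) := by
  have : m + 3 ≠ 0 := by linarith
  rw [ratioII, mul_div_cancel₀ _ (by positivity)]; ring

theorem ratioQuad_ratioI (hm : -1 < m) : ratioQuad m (ratioI m) = 0 := by
  have h := sq_eq_ratioDisc_add m (ratioI m)
  rw [ratioI_spec hm, Real.sq_sqrt (ratioDisc_pos hm).le] at h
  have : m + 3 ≠ 0 := by linarith
  have h2 : 24 * (m + 3) ^ 2 * ratioQuad m (ratioI m) = 0 := by linarith
  exact (mul_eq_zero.1 h2).resolve_left (by positivity)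

theorem ratioQuad_ratioII (hm : -1 < m) : ratioQuad m (ratioII m) = 0 := by
  have h := sq_eq_ratioDisc_add m (ratioII m)
  rw [ratioII_spec hm, neg_sq, Real.sq_sqrt (ratioDisc_pos hm).le] at h
  have : m + 3 ≠ 0 := by linarith
  have h2 : 24 * (m + 3) ^ 2 * ratioQuad m (ratioII m) = 0 := by linarith
  exact (mul_eq_zero.1 h2).resolve_left (by positivity)

theorem abs_lt_of_ratioQuad_neg (hm : -1 < m) (h : ratioQuad m x < 0) :
    |12 * (m + 3) ^ 2 * x + (4 * m + 9) * (m - 1)| < √(ratioDisc m) := by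
  have hk : 0 < m + 3 := by linarith
  refine Real.lt_sqrt_of_sq_lt ?_
  rw [sq_abs, sq_eq_ratioDisc_add]
  nlinarith [mul_pos_of_neg_of_neg h (neg_lt_zero.2 (show 0 < 24 * (m + 3) ^ 2 by positivity))]

theorem lt_ratioI (hm : -1 < m) (h : ratioQuad m x < 0) : x < ratioI m := by
  have hk : 0 < m + 3 := by linarith
  have h1 := (abs_lt.1 (abs_lt_of_ratioQuad_neg hm h)).2
  rw [← ratioI_spec hm] at h1
  exact lt_of_mul_lt_mul_left (by linarith) (show 0 ≤ 12 * (m + 3) ^ 2 by positivity)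

theorem ratioII_lt (hm : -1 < m) (h : ratioQuad m x < 0) : ratioII m < x := by
  have hk : 0 < m + 3 := by linarith
  have h1 := (abs_lt.1 (abs_lt_of_ratioQuad_neg hm h)).1
  rw [← ratioII_spec hm] at h1
  exact lt_of_mul_lt_mul_left (by linarith) (show 0 ≤ 12 * (m + 3) ^ 2 by positivity)

theorem sqrt_lt_abs_of_ratioQuad_pos (hm : -1 < m) (h : 0 < ratioQuad m x) :
    √(ratioDisc m) < |12 * (m + 3) ^ 2 * x + (4 * m + 9) * (m - 1)| := by
  have hk : 0 < m + 3 := by linarith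
  rw [← Real.sqrt_sq_eq_abs, sq_eq_ratioDisc_add]
  exact Real.sqrt_lt_sqrt (ratioDisc_pos hm).le (lt_add_of_pos_right _ (by positivity))

/-- The second hypothesis says that `x` is at least the critical point of `ratioQuad m`. -/
theorem ratioI_lt (hm : -1 < m) (h : 0 < ratioQuad m x)
    (hx : 0 ≤ 12 * (m + 3) ^ 2 * x + (4 * m + 9) * (m - 1)) : ratioI m < x := by
  have hk : 0 < m + 3 := by linarith
  have h1 := sqrt_lt_abs_of_ratioQuad_pos hm h
  rw [abs_of_nonneg hx, ← ratioI_spec hm] at h1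
  exact lt_of_mul_lt_mul_left (by linarith) (show 0 ≤ 12 * (m + 3) ^ 2 by positivity)

theorem lt_ratioII (hm : -1 < m) (h : 0 < ratioQuad m x)
    (hx : 12 * (m + 3) ^ 2 * x + (4 * m + 9) * (m - 1) ≤ 0) : x < ratioII m := by
  have hk : 0 < m + 3 := by linarith
  have h1 := sqrt_lt_abs_of_ratioQuad_pos hm h
  rw [abs_of_nonpos hx, ← neg_neg √(ratioDisc m), ← ratioII_spec hm] at h1
  exact lt_of_mul_lt_mul_left (by linarith) (show 0 ≤ 12 * (m + 3) ^ 2 by positivity)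

theorem eq_ratioI_or_eq_ratioII (hm : -1 < m) (h : ratioQuad m x = 0) :
    x = ratioI m ∨ x = ratioII m := by
  have hk : 0 < m + 3 := by linarith
  have h1 := sq_eq_ratioDisc_add m x
  rw [h, mul_zero, add_zero, ← Real.sq_sqrt (ratioDisc_pos hm).le, sq_eq_sq_iff_eq_or_eq_neg,
    ← ratioII_spec hm, ← ratioI_spec hm] at h1
  have h2 : 12 * (m + 3) ^ 2 ≠ 0 := by positivity
  exact h1.imp (fun h => mul_left_cancel₀ h2 (by linarith))
    (fun h => mul_left_cancel₀ h2 (by linarith))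

/-- The value of `ratioQuad m` at a fraction, without denominators. -/
theorem ratioQuad_div (m : ℝ) {u v : ℝ} (hv : v ≠ 0) :
    ratioQuad m (u / v) = (6 * (m + 3) ^ 2 * u ^ 2 + (4 * m + 9) * (m - 1) * u * v
      - (m + 2) * (2 * m + 1) * v ^ 2) / v ^ 2 := by
  simp only [ratioQuad]; field_simp

/-- By Newton's inequality this bound on `e₂ / e₁²` holds when the roots have the same sign. -/
theorem ratioQuad_newton_neg (hm : -1 < m) : ratioQuad m ((m + 2) / (3 * m + 7)) < 0 := by
  have h1 : 0 < 3 * m + 7 := by linarith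
  rw [ratioQuad_div m h1.ne', div_neg_iff]
  refine Or.inr ⟨?_, by positivity⟩
  have : 6 * (m + 3) ^ 2 * (m + 2) ^ 2 + (4 * m + 9) * (m - 1) * (m + 2) * (3 * m + 7)
      - (m + 2) * (2 * m + 1) * (3 * m + 7) ^ 2 = -(2 * ((m + 1) * (m + 2) ^ 2)) := by ring
  rw [this, neg_lt_zero]
  have h2 : 0 < m + 1 := by linarith
  have h3 : 0 < m + 2 := by linarith
  positivity

theorem newton_lt_ratioI (hm : -1 < m) : (m + 2) / (3 * m + 7) < ratioI m :=
  lt_ratioI hm (ratioQuad_newton_neg hm)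

theorem ratioI_pos (hm : -1 < m) : 0 < ratioI m :=
  (div_pos (by linarith) (by linarith)).trans (newton_lt_ratioI hm)

theorem ratioI_lt_third (hm : -1 < m) : ratioI m < 1 / 3 := by
  refine ratioI_lt hm ?_ ?_
  · rw [ratioQuad_div m (by norm_num)]
    exact div_pos (by linarith) (by norm_num)
  · nlinarith

theorem ratioII_neg (hm : -1 / 2 < m) : ratioII m < 0 := by
  refine ratioII_lt (by linarith) ?_
  simp only [ratioQuad]
  nlinarith [mul_pos (show 0 < m + 2 by linarith) (show 0 < 2 * m + 1 by linarith)]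

/-- The bound that makes `1` no eigenvalue, that is `(1 - μ₁) (1 - μ₂) > 0`. -/
theorem lt_ratioI_of_one_sub (hm : -1 < m) :
    (1 - m) * (2 * m + 3) / (2 * (m + 3) ^ 2) < ratioI m := by
  have h1 : 0 < m + 1 := by linarith
  have h3 : 0 < m + 3 := by linarith
  refine lt_ratioI hm ?_
  rw [ratioQuad_div m (by positivity), div_neg_iff]
  refine Or.inr ⟨?_, by positivity⟩
  have : 6 * (m + 3) ^ 2 * ((1 - m) * (2 * m + 3)) ^ 2
      + (4 * m + 9) * (m - 1) * ((1 - m) * (2 * m + 3)) * (2 * (m + 3) ^ 2)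
      - (m + 2) * (2 * m + 1) * (2 * (m + 3) ^ 2) ^ 2 = -(72 * (m + 1) ^ 3 * (m + 3) ^ 2) := by
    ring
  rw [this, neg_lt_zero]
  positivity

theorem ratioII_lt_of_one_sub (hm : -1 / 2 < m) :
    ratioII m < (1 - m) * (2 * m + 3) / (2 * (m + 3) ^ 2) := by
  have h1 : 0 < m + 1 := by linarith
  have h3 : 0 < m + 3 := by linarith
  refine ratioII_lt (by linarith) ?_
  rw [ratioQuad_div m (by positivity), div_neg_iff]
  refine Or.inr ⟨?_, by positivity⟩
  have : 6 * (m + 3) ^ 2 * ((1 - m) * (2 * m + 3)) ^ 2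
      + (4 * m + 9) * (m - 1) * ((1 - m) * (2 * m + 3)) * (2 * (m + 3) ^ 2)
      - (m + 2) * (2 * m + 1) * (2 * (m + 3) ^ 2) ^ 2 = -(72 * (m + 1) ^ 3 * (m + 3) ^ 2) := by
    ring
  rw [this, neg_lt_zero]
  positivity

/-- The bound that makes `μ₁ μ₂` positive. -/
theorem lt_ratioI_of_prod (hm : -1 < m) :
    (1 - m) * (m + 2) / (2 * (m + 3) ^ 2) < ratioI m := by
  have h1 : 0 < m + 1 := by linarith
  have h2 : 0 < m + 2 := by linarith
  have h3 : 0 < m + 3 := by linarith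
  have h4 : 0 < 10 * m + 14 := by linarith
  refine lt_ratioI hm ?_
  rw [ratioQuad_div m (by positivity), div_neg_iff]
  refine Or.inr ⟨?_, by positivity⟩
  have : 6 * (m + 3) ^ 2 * ((1 - m) * (m + 2)) ^ 2
      + (4 * m + 9) * (m - 1) * ((1 - m) * (m + 2)) * (2 * (m + 3) ^ 2)
      - (m + 2) * (2 * m + 1) * (2 * (m + 3) ^ 2) ^ 2
      = -((m + 3) ^ 3 * (m + 1) * (m + 2) * (10 * m + 14)) := by
    ring
  rw [this, neg_lt_zero]
  positivity

theorem ratioQuad_discriminant (h : 3 * (4 * m ^ 2 + 9 * m + 3) ≠ 0) :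
    ratioQuad m ((2 * m + 1) * (2 * m + 3) / (3 * (4 * m ^ 2 + 9 * m + 3))) =
      9 * (m + 3) ^ 2 * (m + 1) * (2 * m + 1) / (3 * (4 * m ^ 2 + 9 * m + 3)) ^ 2 := by
  rw [ratioQuad_div m h]
  congr 1
  ring

/-- The discriminant of the cubic with roots the coordinates of the equal vortices is a positive
multiple of this linear expression in `e₂ / e₁²`. -/
theorem discriminant_ratioI_pos (hm : -1 < m) :
    0 < (2 * m + 1) * (2 * m + 3) - 3 * (4 * m ^ 2 + 9 * m + 3) * ratioI m := by
  have h1 : 0 < m + 1 := by linarith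
  have h3 : 0 < m + 3 := by linarith
  have h23 : 0 < 2 * m + 3 := by linarith
  have hpos := ratioI_pos hm
  rcases lt_or_ge 0 (4 * m ^ 2 + 9 * m + 3) with hG | hG
  · -- here `m > -1/2`, and `ratioI m` lies to the left of the zero of the linear expression
    have hm2 : 0 < 2 * m + 1 := by nlinarith
    have hlt : ratioI m < (2 * m + 1) * (2 * m + 3) / (3 * (4 * m ^ 2 + 9 * m + 3)) := by
      refine ratioI_lt hm ?_ ?_
      · rw [ratioQuad_discriminant (by positivity)]
        positivity
      · have h : 12 * (m + 3) ^ 2 * ((2 * m + 1) * (2 * m + 3) / (3 * (4 * m ^ 2 + 9 * m + 3)))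
            + (4 * m + 9) * (m - 1) =
            (12 * (m + 3) ^ 2 * ((2 * m + 1) * (2 * m + 3))
              + (4 * m + 9) * (m - 1) * (3 * (4 * m ^ 2 + 9 * m + 3)))
              / (3 * (4 * m ^ 2 + 9 * m + 3)) := by
          rw [eq_div_iff (by positivity), add_mul, mul_assoc (12 * _),
            div_mul_cancel₀ _ (by positivity)]
        rw [h]
        refine div_nonneg ?_ (by positivity)
        obtain ⟨n, hn, rfl⟩ : ∃ n : ℝ, 0 < n ∧ m = n - 1 / 2 := ⟨m + 1 / 2, by linarith, by ring⟩
        have h' : 12 * (n - 1 / 2 + 3) ^ 2 * ((2 * (n - 1 / 2) + 1) * (2 * (n - 1 / 2) + 3))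
              + (4 * (n - 1 / 2) + 9) * (n - 1 / 2 - 1)
                * (3 * (4 * (n - 1 / 2) ^ 2 + 9 * (n - 1 / 2) + 3)) =
            96 * n ^ 4 + 360 * n ^ 3 + 423 * n ^ 2 + 141 * n + 63 / 4 := by ring
        rw [h']
        positivity
    rw [lt_div_iff₀ (by positivity)] at hlt
    linarith
  · rcases le_or_gt 0 (2 * m + 1) with hm2 | hm2
    · rcases hG.lt_or_eq with hG' | hG'
      · nlinarith [mul_nonneg hm2 h23.le, mul_pos_of_neg_of_neg hG' (neg_lt_zero.2 hpos)]
      · have : 0 < 2 * m + 1 := by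
          rcases hm2.lt_or_eq with h | h
          · exact h
          · nlinarith
        rw [hG']
        nlinarith [mul_pos this h23]
    · have hG' : 4 * m ^ 2 + 9 * m + 3 < 0 := by nlinarith
      have hlt : (2 * m + 1) * (2 * m + 3) / (3 * (4 * m ^ 2 + 9 * m + 3)) < ratioI m := by
        refine lt_ratioI hm ?_
        rw [ratioQuad_discriminant (by linarith)]
        refine div_neg_of_neg_of_pos (mul_neg_of_pos_of_neg (by positivity) hm2) ?_
        exact sq_pos_of_neg (by linarith)
      rw [div_lt_iff_of_neg (by linarith)] at hlt
      linarith

theorem discriminant_ratioII_pos (hm : -1 / 2 < m) :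
    0 < (2 * m + 1) * (2 * m + 3) - 3 * (4 * m ^ 2 + 9 * m + 3) * ratioII m := by
  have h1 : 0 < m + 1 := by linarith
  have h3 : 0 < m + 3 := by linarith
  have h23 : 0 < 2 * m + 3 := by linarith
  have hm2 : 0 < 2 * m + 1 := by linarith
  have hneg := ratioII_neg hm
  rcases le_or_gt 0 (4 * m ^ 2 + 9 * m + 3) with hG | hG
  · nlinarith [mul_pos hm2 h23, mul_nonneg hG (neg_pos.2 hneg).le]
  · have hlt : (2 * m + 1) * (2 * m + 3) / (3 * (4 * m ^ 2 + 9 * m + 3)) < ratioII m := by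
      refine lt_ratioII (by linarith) ?_ ?_
      · rw [ratioQuad_discriminant (by linarith)]
        refine div_pos (by positivity) (sq_pos_of_neg (by linarith))
      · have hx : (2 * m + 1) * (2 * m + 3) / (3 * (4 * m ^ 2 + 9 * m + 3)) ≤ 0 :=
          div_nonpos_of_nonneg_of_nonpos (by positivity) (by linarith)
        have hx' : 12 * (m + 3) ^ 2 *
            ((2 * m + 1) * (2 * m + 3) / (3 * (4 * m ^ 2 + 9 * m + 3))) ≤ 0 :=
          mul_nonpos_of_nonneg_of_nonpos (by positivity) hx
        have hm1 : m < 0 := by nlinarith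
        nlinarith
    rw [div_lt_iff_of_neg (by linarith)] at hlt
    linarith

end

/-! ### Coordinates of a collinear equilibrium -/

/-- `z` lies on a line with unit direction `e`, with vortex 4 at `z₀` and the three equal vortices
at the coordinates `a, b, c`, and satisfies the equations of a relative equilibrium. -/
structure LineEquilibrium (m ω : ℝ) (z : Config 4) (z₀ e : Plane) (a b c : ℝ) : Prop where
  norm_eq : ‖e‖ = 1
  line : ∀ i, z i = z₀ + ![a, b, c, 0] i • e
  ha : a ≠ 0
  hb : b ≠ 0
  hc : c ≠ 0
  hab : a ≠ b
  hac : a ≠ c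
  hbc : b ≠ c
  hω : ω ≠ 0
  eqn_a : 1 / (a - b) + 1 / (a - c) + m / a = ω * (a + -(a + b + c) / (3 + m))
  eqn_b : 1 / (b - a) + 1 / (b - c) + m / b = ω * (b + -(a + b + c) / (3 + m))
  eqn_c : 1 / (c - a) + 1 / (c - b) + m / c = ω * (c + -(a + b + c) / (3 + m))
  eqn_four : -(1 / a + 1 / b + 1 / c) = ω * (-(a + b + c) / (3 + m))

theorem sum_circ (m : ℝ) : ∑ i, circ m i = 3 + m := by
  simp [Fin.sum_univ_four, circ]; ring

theorem injective_vec {a b c : ℝ} (ha : a ≠ 0) (hb : b ≠ 0) (hc : c ≠ 0) (hab : a ≠ b)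
    (hac : a ≠ c) (hbc : b ≠ c) : Function.Injective ![a, b, c, 0] := by
  intro i j h
  fin_cases i <;> fin_cases j <;>
    simp_all [ha.symm, hb.symm, hc.symm, hab.symm, hac.symm, hbc.symm]

/-- The scalar form of the equilibrium equations for the circulations `1, 1, 1, m`. -/
theorem forall_circ_iff (m ω a b c : ℝ) :
    (∀ i, ∑ j, circ m j / (![a, b, c, 0] i - ![a, b, c, 0] j) = ω * (![a, b, c, 0] i -
        (∑ i, circ m i * ![a, b, c, 0] i) / ∑ i, circ m i)) ↔
      1 / (a - b) + 1 / (a - c) + m / a = ω * (a + -(a + b + c) / (3 + m)) ∧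
      1 / (b - a) + 1 / (b - c) + m / b = ω * (b + -(a + b + c) / (3 + m)) ∧
      1 / (c - a) + 1 / (c - b) + m / c = ω * (c + -(a + b + c) / (3 + m)) ∧
      -(1 / a + 1 / b + 1 / c) = ω * (-(a + b + c) / (3 + m)) := by
  have h4 : -(1 / a + 1 / b + 1 / c) = 1 / (-a) + 1 / (-b) + 1 / (-c) := by
    simp only [div_neg]; ring
  rw [Fin.forall_fin_succ, Fin.forall_fin_succ, Fin.forall_fin_succ, Fin.forall_fin_one, sum_circ,
    h4, neg_div]
  simp [Fin.sum_univ_four, circ, sub_eq_add_neg]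

theorem exists_lineEquilibrium {m ω : ℝ} {z : Config 4}
    (h : IsRelativeEquilibrium (circ m) ω z) (hcol : Collinear ℝ (Set.range z)) :
    ∃ z₀ e a b c, LineEquilibrium m ω z z₀ e a b c := by
  obtain ⟨hinj, hΓ, hω, hrot⟩ := h
  obtain ⟨v, hv⟩ := (collinear_iff_of_mem (Set.mem_range_self (f := z) 3)).1 hcol
  choose r hr using fun i => hv (z i) (Set.mem_range_self i)
  have hv0 : v ≠ 0 := by
    rintro rfl
    have : z 0 = z 1 := by rw [hr 0, hr 1]; simp
    exact absurd (hinj this) (by decide)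
  have hvn : ‖v‖ ≠ 0 := norm_ne_zero_iff.2 hv0
  have hr3 : r 3 = 0 := by
    have := hr 3
    rw [vadd_eq_add, right_eq_add, smul_eq_zero] at this
    exact this.resolve_right hv0
  have hline : ∀ i, z i = z 3 + ![r 0 * ‖v‖, r 1 * ‖v‖, r 2 * ‖v‖, 0] i • (‖v‖⁻¹ • v) := by
    have h1 : ∀ i, z i = z 3 + (r i * ‖v‖) • (‖v‖⁻¹ • v) := by
      intro i
      conv_lhs => rw [hr i]
      rw [smul_smul, mul_assoc, mul_inv_cancel₀ hvn, mul_one, vadd_eq_add, add_comm]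
    intro i
    have h2 : ![r 0 * ‖v‖, r 1 * ‖v‖, r 2 * ‖v‖, 0] i = r i * ‖v‖ := by
      fin_cases i <;> simp [hr3]
    rw [h2, ← h1]
  have he : ‖‖v‖⁻¹ • v‖ = 1 := by rw [norm_smul, norm_inv, norm_norm, inv_mul_cancel₀ hvn]
  have hy : Function.Injective ![r 0 * ‖v‖, r 1 * ‖v‖, r 2 * ‖v‖, 0] := fun i j hij =>
    hinj (by rw [hline i, hline j, hij])
  rw [rotatingField_line_eq_zero_iff hΓ ω he hline, forall_circ_iff] at hrot
  obtain ⟨h1, h2, h3, h4⟩ := hrot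
  exact ⟨z 3, ‖v‖⁻¹ • v, r 0 * ‖v‖, r 1 * ‖v‖, r 2 * ‖v‖, he, hline,
    hy.ne (show (0 : Fin 4) ≠ 3 by decide), hy.ne (show (1 : Fin 4) ≠ 3 by decide),
    hy.ne (show (2 : Fin 4) ≠ 3 by decide), hy.ne (show (0 : Fin 4) ≠ 1 by decide),
    hy.ne (show (0 : Fin 4) ≠ 2 by decide), hy.ne (show (1 : Fin 4) ≠ 2 by decide), hω,
    h1, h2, h3, h4⟩

namespace LineEquilibrium

variable {m ω a b c : ℝ} {z : Config 4} {z₀ e : Plane}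

theorem injective (h : LineEquilibrium m ω z z₀ e a b c) : Function.Injective ![a, b, c, 0] :=
  injective_vec h.ha h.hb h.hc h.hab h.hac h.hbc

theorem isRelativeEquilibrium (h : LineEquilibrium m ω z z₀ e a b c) (hm : 3 + m ≠ 0) :
    IsRelativeEquilibrium (circ m) ω z := by
  have he0 : e ≠ 0 := fun h0 => by simpa [h0] using h.norm_eq
  have hΓ : ∑ i, circ m i ≠ 0 := by rwa [sum_circ]
  refine ⟨fun i j hij => h.injective ?_, hΓ, h.hω, ?_⟩
  · rw [h.line i, h.line j, add_right_inj] at hij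
    exact smul_left_injective ℝ he0 hij
  · rw [rotatingField_line_eq_zero_iff hΓ ω h.norm_eq h.line, forall_circ_iff]
    exact ⟨h.eqn_a, h.eqn_b, h.eqn_c, h.eqn_four⟩

theorem collinear (h : LineEquilibrium m ω z z₀ e a b c) : Collinear ℝ (Set.range z) := by
  rw [collinear_iff_exists_forall_eq_smul_vadd]
  refine ⟨z₀, e, ?_⟩
  rintro _ ⟨i, rfl⟩
  exact ⟨_, (h.line i).trans (add_comm _ _)⟩

theorem symmEquations (h : LineEquilibrium m ω z z₀ e a b c) (hm : 3 + m ≠ 0) :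
    SymmEquations m ω (-(a + b + c) / (3 + m)) (a + b + c) (a * b + a * c + b * c)
      (a * b * c) :=
  (equilibrium_iff_symmEquations hm h.ha h.hb h.hc h.hab h.hac h.hbc rfl).1
    ⟨h.eqn_a, h.eqn_b, h.eqn_c, h.eqn_four⟩

/-- Vortex 4 lies weakly between two of the others iff their coordinates have opposite signs. -/
theorem wbtw_iff (h : LineEquilibrium m ω z z₀ e a b c) {i j : Fin 4} (hi : i ≠ 3) (hj : j ≠ 3) :
    Wbtw ℝ (z i) (z 3) (z j) ↔ ![a, b, c, 0] i * ![a, b, c, 0] j < 0 := by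
  have he0 : e ≠ 0 := fun h0 => by simpa [h0] using h.norm_eq
  have hi0 : ![a, b, c, 0] i ≠ 0 := h.injective.ne hi
  have hj0 : ![a, b, c, 0] j ≠ 0 := h.injective.ne hj
  have h3 : z 3 = z₀ := by rw [h.line 3]; simp
  rw [h3, h.line i, h.line j]
  set x := ![a, b, c, 0] i
  set y := ![a, b, c, 0] j
  have hmap : ∀ t : ℝ, AffineMap.lineMap (z₀ + x • e) (z₀ + y • e) t = z₀ ↔
      (1 - t) * x + t * y = 0 := by
    intro t
    have : AffineMap.lineMap (z₀ + x • e) (z₀ + y • e) t = z₀ + ((1 - t) * x + t * y) • e := by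
      rw [AffineMap.lineMap_apply_module]; module
    rw [this, add_eq_left, smul_eq_zero, or_iff_left he0]
  constructor
  · rintro ⟨t, ⟨ht0, ht1⟩, ht⟩
    rw [hmap] at ht
    by_contra hxy
    have hxy' : 0 < x * y := lt_of_le_of_ne (not_lt.1 hxy) (mul_ne_zero hi0 hj0).symm
    have h1 : (1 - t) * x ^ 2 + t * (x * y) = 0 := by linear_combination x * ht
    have h2 : 0 < x ^ 2 := by positivity
    nlinarith [mul_nonneg (sub_nonneg.2 ht1) h2.le, mul_nonneg ht0 hxy'.le]
  · intro hxy
    have hne : x ^ 2 - x * y ≠ 0 := by nlinarith [sq_nonneg x]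
    have hpos : 0 < x ^ 2 - x * y := by nlinarith [sq_nonneg x]
    refine ⟨x ^ 2 / (x ^ 2 - x * y), ⟨by positivity, ?_⟩, (hmap _).2 ?_⟩
    · rw [div_le_one hpos]; linarith
    · have ht : x ^ 2 / (x ^ 2 - x * y) * (x ^ 2 - x * y) = x ^ 2 := div_mul_cancel₀ _ hne
      refine mul_right_cancel₀ hne ?_
      linear_combination (y - x) * ht

/-- The normalized second symmetric function solves the quadratic equation. -/
theorem ratioQuad_eq_zero (h : LineEquilibrium m ω z z₀ e a b c) (hm : -1 < m) :
    ratioQuad m ((a * b + a * c + b * c) / (a + b + c) ^ 2) = 0 := by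
  have hs := h.symmEquations (by linarith)
  have h1 := hs.e₁_ne_zero (by linarith) (by linarith)
  have h2 := hs.e₂_ne_zero (by linarith) (by linarith) h.hω
    (mul_ne_zero (mul_ne_zero h.ha h.hb) h.hc)
  rw [ratioQuad_div m (by positivity), div_eq_zero_iff]
  left
  linear_combination hs.quadratic h2

/-- If the three equal vortices are on one side of vortex 4, the ratio is the larger root. -/
theorem ratio_eq_ratioI (h : LineEquilibrium m ω z z₀ e a b c) (hm : -1 < m) (h₁ : 0 < a * b)
    (h₂ : 0 < a * c) (h₃ : 0 < b * c) :
    (a * b + a * c + b * c) / (a + b + c) ^ 2 = ratioI m := by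
  have hs := h.symmEquations (by linarith)
  have h1 := hs.e₁_ne_zero (by linarith) (by linarith)
  have h2 : 0 < a * b + a * c + b * c := by positivity
  refine (eq_ratioI_or_eq_ratioII hm (h.ratioQuad_eq_zero hm)).resolve_right fun hII => ?_
  have hlt : (a * b + a * c + b * c) / (a + b + c) ^ 2 < (m + 2) / (3 * m + 7) :=
    hII ▸ ratioII_lt hm (ratioQuad_newton_neg hm)
  rw [div_lt_div_iff₀ (by positivity) (by linarith)] at hlt
  have hq := hs.rel_quad
  -- Newton's inequality `e₂² ≥ 3 e₁ e₃`
  have hN : 3 * ((a + b + c) * (a * b * c)) ≤ (a * b + a * c + b * c) ^ 2 := by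
    nlinarith [sq_nonneg (a * b - a * c), sq_nonneg (a * b - b * c), sq_nonneg (a * c - b * c)]
  have hm1 : 0 < 1 + m := by linarith
  have h4 := mul_le_mul_of_nonneg_left hN hm1.le
  have h5 : (a * b + a * c + b * c) * ((m + 2) * (a + b + c) ^ 2) ≤
      (a * b + a * c + b * c) * ((3 * m + 7) * (a * b + a * c + b * c)) := by
    linarith
  have h6 := le_of_mul_le_mul_left h5 h2
  linarith

/-- If vortex 4 lies between two of the others, the ratio is the smaller root. -/
theorem ratio_eq_ratioII (h : LineEquilibrium m ω z z₀ e a b c) (hm : -1 / 2 < m)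
    (hneg : a * b < 0 ∨ a * c < 0 ∨ b * c < 0) :
    (a * b + a * c + b * c) / (a + b + c) ^ 2 = ratioII m := by
  have hm' : -1 < m := by linarith
  have hs := h.symmEquations (by linarith)
  have h1 := hs.e₁_ne_zero (by linarith) (by linarith)
  refine (eq_ratioI_or_eq_ratioII hm' (h.ratioQuad_eq_zero hm')).resolve_left fun hI => ?_
  have h2 : 0 < a * b + a * c + b * c := by
    have := ratioI_pos hm'
    rw [← hI] at this
    exact (div_pos_iff_of_pos_right (by positivity)).1 this
  have hl := hs.rel_lin
  have h1sq : 0 < (a + b + c) ^ 2 := by positivity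
  have h13 : 0 < (a + b + c) * (a * b * c) := by
    have hden : 0 < (1 + 2 * m) * (a + b + c) ^ 2 + 3 * (3 + m) * (a * b + a * c + b * c) :=
      add_pos (mul_pos (by linarith) h1sq) (mul_pos (by linarith) h2)
    have : 0 < (a + b + c) * (a * b * c) *
        ((1 + 2 * m) * (a + b + c) ^ 2 + 3 * (3 + m) * (a * b + a * c + b * c)) := by
      have h' : (a + b + c) * (a * b * c) *
          ((1 + 2 * m) * (a + b + c) ^ 2 + 3 * (3 + m) * (a * b + a * c + b * c)) =
          (1 + m) * (a + b + c) ^ 2 * (a * b + a * c + b * c) ^ 2 := by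
        linear_combination (a + b + c) * hl
      rw [h']
      have : 0 < 1 + m := by linarith
      positivity
    exact (mul_pos_iff_of_pos_right hden).1 this
  -- a cubic whose coefficients alternate in sign has no negative root
  have hroot : ∀ x : ℝ, x ^ 3 - (a + b + c) * x ^ 2 + (a * b + a * c + b * c) * x - a * b * c = 0 →
      0 < (a + b + c) * x := by
    intro x hx
    by_contra hneg
    push Not at hneg
    have h' : (a + b + c) * x * x ^ 2 - (a + b + c) ^ 2 * x ^ 2 +
        (a * b + a * c + b * c) * ((a + b + c) * x) - (a + b + c) * (a * b * c) = 0 := by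
      linear_combination (a + b + c) * hx
    nlinarith [mul_nonneg (neg_nonneg.2 hneg) (sq_nonneg x), mul_nonneg h2.le (neg_nonneg.2 hneg),
      mul_nonneg h1sq.le (sq_nonneg x)]
  have ha := hroot a (by ring)
  have hb := hroot b (by ring)
  have hc := hroot c (by ring)
  have hprod : ∀ x y : ℝ, 0 < (a + b + c) * x → 0 < (a + b + c) * y → 0 < x * y := by
    intro x y hx hy
    have : 0 < (a + b + c) ^ 2 * (x * y) := by
      have := mul_pos hx hy
      linarith
    exact (mul_pos_iff_of_pos_left h1sq).1 this
  rcases hneg with h' | h' | h'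
  · exact absurd (hprod a b ha hb) h'.not_gt
  · exact absurd (hprod a c ha hc) h'.not_gt
  · exact absurd (hprod b c hb hc) h'.not_gt

end LineEquilibrium

/-! ### Existence of collinear equilibria -/

theorem exists_root_cubic (p q r : ℝ) : ∃ a : ℝ, a ^ 3 - p * a ^ 2 + q * a - r = 0 := by
  set M := 1 + |p| + |q| + |r| with hM
  have hp := abs_le.1 (le_refl |p|)
  have hq := abs_le.1 (le_refl |q|)
  have hr := abs_le.1 (le_refl |r|)
  have hp0 := abs_nonneg p
  have hq0 := abs_nonneg q
  have hr0 := abs_nonneg r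
  have hM1 : 1 ≤ M := by linarith
  have hMM : M ≤ M ^ 2 := by nlinarith
  have h1 : |q| * M ≤ |q| * M ^ 2 := mul_le_mul_of_nonneg_left hMM hq0
  have h2 : |r| ≤ |r| * M ^ 2 := le_mul_of_one_le_right hr0 (by nlinarith)
  have h3 : M ^ 3 = M ^ 2 + |p| * M ^ 2 + |q| * M ^ 2 + |r| * M ^ 2 := by
    have : M ^ 3 = M * M ^ 2 := by ring
    rw [this]; conv_lhs => rw [hM]
    ring
  have hM2 : 0 ≤ M ^ 2 := sq_nonneg M
  have h4 := mul_le_mul_of_nonneg_right hp.1 hM2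
  have h5 := mul_le_mul_of_nonneg_right hp.2 hM2
  have h6 := mul_le_mul_of_nonneg_right hq.1 (zero_le_one.trans hM1)
  have h7 := mul_le_mul_of_nonneg_right hq.2 (zero_le_one.trans hM1)
  have hcont : ContinuousOn (fun a : ℝ => a ^ 3 - p * a ^ 2 + q * a - r) (Set.Icc (-M) M) := by
    fun_prop
  have := intermediate_value_Icc (by linarith) hcont
  obtain ⟨a, -, ha⟩ := this (show (0 : ℝ) ∈ _ by
    constructor
    · nlinarith
    · nlinarith)
  exact ⟨a, ha⟩

/-- A real cubic of positive discriminant has three distinct real roots. -/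
theorem exists_roots_cubic_of_discriminant_pos {p q r : ℝ}
    (h : 0 < p ^ 2 * q ^ 2 - 4 * q ^ 3 - 4 * p ^ 3 * r + 18 * p * q * r - 27 * r ^ 2) :
    ∃ a b c : ℝ, a ≠ b ∧ a ≠ c ∧ b ≠ c ∧ a + b + c = p ∧ a * b + a * c + b * c = q ∧
      a * b * c = r := by
  obtain ⟨a, ha⟩ := exists_root_cubic p q r
  obtain rfl : r = a ^ 3 - p * a ^ 2 + q * a := by linarith
  set δ := (p - a) ^ 2 - 4 * (q - a * (p - a)) with hδ
  have hfac : p ^ 2 * q ^ 2 - 4 * q ^ 3 - 4 * p ^ 3 * (a ^ 3 - p * a ^ 2 + q * a)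
      + 18 * p * q * (a ^ 3 - p * a ^ 2 + q * a) - 27 * (a ^ 3 - p * a ^ 2 + q * a) ^ 2 =
      δ * (3 * a ^ 2 - 2 * p * a + q) ^ 2 := by rw [hδ]; ring
  rw [hfac] at h
  have hδpos : 0 < δ := by
    by_contra hneg
    nlinarith [mul_nonneg (neg_nonneg.2 (not_lt.1 hneg)) (sq_nonneg (3 * a ^ 2 - 2 * p * a + q))]
  have hne : 3 * a ^ 2 - 2 * p * a + q ≠ 0 := by
    intro h0
    rw [h0] at h
    simp at h
  have hs := Real.sq_sqrt hδpos.le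
  have hs0 := Real.sqrt_pos.2 hδpos
  have hq : (p - a + √δ) / 2 * ((p - a - √δ) / 2) = q - a * (p - a) := by
    linear_combination -hs / 4 + hδ / 4
  refine ⟨a, (p - a + √δ) / 2, (p - a - √δ) / 2, fun h1 => hne ?_, fun h1 => hne ?_,
    by linarith, by ring, ?_, ?_⟩
  · linear_combination (a - (p - a - √δ) / 2) * h1 - hq
  · linear_combination (a - (p - a + √δ) / 2) * h1 - hq
  · linear_combination hq
  · linear_combination a * hq

/-- A root of `ratioQuad m` for which the cubic has positive discriminant comes from an
equilibrium, with the coordinates normalized by `e₁ = 1`. -/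
theorem exists_lineEquilibrium_of_ratio {m x : ℝ} (hm : -1 < m) (hq : ratioQuad m x = 0)
    (hx : x ≠ 0)
    (hdisc : 0 < (2 * m + 1) * (2 * m + 3) - 3 * (4 * m ^ 2 + 9 * m + 3) * x) :
    ∃ ω z z₀ e a b c, LineEquilibrium m ω z z₀ e a b c ∧ a + b + c = 1 ∧
      a * b + a * c + b * c = x ∧ a * b * c * (1 + 2 * m + 3 * (3 + m) * x) = (1 + m) * x ^ 2 := by
  have h1 : 0 < 1 + m := by linarith
  have hk : 0 < 3 + m := by linarith
  have hq' : 3 * (1 + m) ^ 2 * x =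
      (m + 2 - 2 * (3 + m) * x) * (1 + 2 * m + 3 * (3 + m) * x) := by
    simp only [ratioQuad] at hq
    linear_combination hq
  have hden : 1 + 2 * m + 3 * (3 + m) * x ≠ 0 := by
    intro h0
    rw [h0, mul_zero] at hq'
    exact hx ((mul_eq_zero.1 hq').resolve_left (by positivity))
  set D := 1 + 2 * m + 3 * (3 + m) * x with hD
  set r := (1 + m) * x ^ 2 / D with hr
  have hrD : r * D = (1 + m) * x ^ 2 := div_mul_cancel₀ _ hden
  have hr0 : r ≠ 0 := div_ne_zero (by positivity) hden
  have hdisc' : 0 < (1 : ℝ) ^ 2 * x ^ 2 - 4 * x ^ 3 - 4 * 1 ^ 3 * r + 18 * 1 * x * r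
      - 27 * r ^ 2 := by
    have h2 : D ^ 2 * (3 + m) ^ 2 * ((1 : ℝ) ^ 2 * x ^ 2 - 4 * x ^ 3 - 4 * 1 ^ 3 * r
        + 18 * 1 * x * r - 27 * r ^ 2) =
        x ^ 2 * ((1 + m) * ((2 * m + 1) * (2 * m + 3) - 3 * (4 * m ^ 2 + 9 * m + 3) * x)) := by
      have h3 : D ^ 2 * ((1 : ℝ) ^ 2 * x ^ 2 - 4 * x ^ 3 - 4 * 1 ^ 3 * r
        + 18 * 1 * x * r - 27 * r ^ 2) = x ^ 2 * ((1 - 4 * x) * D ^ 2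
          - 4 * (1 + m) * D + 18 * x * (1 + m) * D - 27 * (1 + m) ^ 2 * x ^ 2) := by
        linear_combination ((-4 + 18 * x) * D - 27 * (r * D + (1 + m) * x ^ 2)) * hrD
      have h4 : (3 + m) ^ 2 * ((1 - 4 * x) * D ^ 2
          - 4 * (1 + m) * D + 18 * x * (1 + m) * D - 27 * (1 + m) ^ 2 * x ^ 2) =
          (1 + m) * ((2 * m + 1) * (2 * m + 3) - 3 * (4 * m ^ 2 + 9 * m + 3) * x) := by
        simp only [ratioQuad] at hq
        rw [hD]
        linear_combination (2 * m ^ 2 + 13 * m + 15 - 6 * (m + 3) ^ 2 * x) * hq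
      linear_combination (3 + m) ^ 2 * h3 + x ^ 2 * h4
    have h5 : 0 < D ^ 2 * (3 + m) ^ 2 := by positivity
    refine (mul_pos_iff_of_pos_left h5).1 ?_
    rw [h2]
    positivity
  obtain ⟨a, b, c, hab, hac, hbc, he₁, he₂, he₃⟩ := exists_roots_cubic_of_discriminant_pos hdisc'
  have ha : a ≠ 0 := fun h => hr0 (by rw [← he₃, h]; ring)
  have hb : b ≠ 0 := fun h => hr0 (by rw [← he₃, h]; ring)
  have hc : c ≠ 0 := fun h => hr0 (by rw [← he₃, h]; ring)
  have hrel : (3 + 3 * m) * r = x * (m + 2 - 2 * (3 + m) * x) := by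
    refine mul_right_cancel₀ hden ?_
    linear_combination (3 + 3 * m) * hrD + x * hq'
  have hsymm : SymmEquations m ((3 + m) * x / r) (-(a + b + c) / (3 + m)) (a + b + c)
      (a * b + a * c + b * c) (a * b * c) := by
    rw [he₁, he₂, he₃]
    refine ⟨?_, ?_, ?_, ?_⟩
    · field_simp
      linear_combination 2 * hrel
    · field_simp
      rw [hD] at hrD
      linear_combination -2 * hrD
    · field_simp
    · field_simp
  obtain ⟨h2, h3, h4, h5⟩ := (equilibrium_iff_symmEquations hk.ne' ha hb hc hab hac hbc rfl).2 hsymm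
  refine ⟨(3 + m) * x / r, fun i => 0 + ![a, b, c, 0] i • !₂[1, 0], 0, !₂[1, 0], a, b, c,
    ⟨?_, fun _ => rfl, ha, hb, hc, hab, hac, hbc, ?_, h2, h3, h4, h5⟩, he₁, he₂, ?_⟩
  · simp [EuclideanSpace.norm_eq]
  · positivity
  · rw [he₃, hrD]

theorem LineEquilibrium.isGroupI {m ω a b c : ℝ} {z : Config 4} {z₀ e : Plane}
    (h : LineEquilibrium m ω z z₀ e a b c) (hm : 3 + m ≠ 0) (ha : 0 < a) (hb : 0 < b)
    (hc : 0 < c) : IsGroupI m ω z := by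
  refine ⟨h.isRelativeEquilibrium hm, h.collinear, fun i j hi hj hw => ?_⟩
  rw [h.wbtw_iff hi hj] at hw
  have hpos : ∀ k : Fin 4, 0 ≤ ![a, b, c, 0] k := fun k => by
    fin_cases k <;> simp [ha.le, hb.le, hc.le]
  exact absurd (mul_nonneg (hpos i) (hpos j)) hw.not_ge

theorem exists_isGroupI {m : ℝ} (hm : -1 < m) : ∃ ω z, IsGroupI m ω z := by
  have h1 : 0 < 1 + m := by linarith
  have hx := ratioI_pos hm
  obtain ⟨ω, z, z₀, e, a, b, c, h, he₁, he₂, he₃⟩ := exists_lineEquilibrium_of_ratio hm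
    (ratioQuad_ratioI hm) hx.ne' (discriminant_ratioI_pos hm)
  have hden : 0 < 1 + 2 * m + 3 * (3 + m) * ratioI m := by
    have h2 := newton_lt_ratioI hm
    rw [div_lt_iff₀ (by linarith)] at h2
    have h3 : 0 < (1 + 2 * m + 3 * (3 + m) * ratioI m) * (3 * m + 7) := by
      nlinarith [mul_pos h1 (show 0 < 9 * m + 25 by linarith)]
    exact (mul_pos_iff_of_pos_right (by linarith)).1 h3
  have h3 : 0 < a * b * c := by
    refine (mul_pos_iff_of_pos_right hden).1 ?_
    rw [he₃]
    positivity
  have hroot : ∀ y : ℝ, y ^ 3 - (a + b + c) * y ^ 2 + (a * b + a * c + b * c) * y - a * b * c = 0 →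
      0 < y := by
    intro y hy
    by_contra hneg
    push Not at hneg
    rw [he₁, he₂] at hy
    nlinarith [mul_nonneg (neg_nonneg.2 hneg) (sq_nonneg y), mul_nonneg hx.le (neg_nonneg.2 hneg),
      sq_nonneg y]
  exact ⟨ω, z, h.isGroupI (by linarith) (hroot a (by ring)) (hroot b (by ring))
    (hroot c (by ring))⟩

theorem exists_isGroupII {m : ℝ} (hm : -1 / 2 < m) : ∃ ω z, IsGroupII m ω z := by
  have hx := ratioII_neg hm
  have hm' : -1 < m := by linarith
  obtain ⟨ω, z, z₀, e, a, b, c, h, he₁, he₂, -⟩ := exists_lineEquilibrium_of_ratio hm'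
    (ratioQuad_ratioII hm') hx.ne (discriminant_ratioII_pos hm)
  refine ⟨ω, z, h.isRelativeEquilibrium (by linarith), h.collinear, ?_⟩
  have hne : ∀ i : Fin 4, i ≠ 3 → z 3 ≠ z i := fun i hi =>
    (h.isRelativeEquilibrium (by linarith)).1.ne hi.symm
  have hneg : a * b < 0 ∨ a * c < 0 ∨ b * c < 0 := by
    by_contra! hcon
    linarith
  rcases hneg with h' | h' | h'
  · exact ⟨0, 1, by decide, by decide, (h.wbtw_iff (by decide) (by decide)).2 h',
      hne 0 (by decide), hne 1 (by decide)⟩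
  · exact ⟨0, 2, by decide, by decide, (h.wbtw_iff (by decide) (by decide)).2 h',
      hne 0 (by decide), hne 2 (by decide)⟩
  · exact ⟨1, 2, by decide, by decide, (h.wbtw_iff (by decide) (by decide)).2 h',
      hne 1 (by decide), hne 2 (by decide)⟩

/-! ### The nontrivial eigenvalues as functions of the ratio -/

/-- The parameter `σ = (m - 1) e₁² / ((m + 3) e₂)`, as a function of `x = e₂ / e₁²`. -/
noncomputable def sigma (m x : ℝ) : ℝ := (m - 1) / ((m + 3) * x)

/-- The sum of the two nontrivial eigenvalues of the scaled interaction matrix. -/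
noncomputable def eigSum (m x : ℝ) : ℝ := 5 + sigma m x

/-- The product of the two nontrivial eigenvalues of the scaled interaction matrix. -/
noncomputable def eigProd (m x : ℝ) : ℝ := 6 + 2 * sigma m x + m / (m + 3) * sigma m x

namespace LineEquilibrium

variable {m ω a b c : ℝ} {z : Config 4} {z₀ e : Plane}

theorem charpoly_interaction (h : LineEquilibrium m ω z z₀ e a b c) (hm : -1 < m) {x : ℝ}
    (hx : (a * b + a * c + b * c) / (a + b + c) ^ 2 = x) (t : ℝ) :
    (ω⁻¹ • interaction (circ m) ![a, b, c, 0]).charpoly.eval t =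
      t * (t - 1) * (t ^ 2 - eigSum m x * t + eigProd m x) := by
  have hk : 3 + m ≠ 0 := by linarith
  have hs := h.symmEquations hk
  have h1 := hs.e₁_ne_zero hk (by linarith)
  have h3 : a * b * c ≠ 0 := mul_ne_zero (mul_ne_zero h.ha h.hb) h.hc
  have h2 := hs.e₂_ne_zero hk (by linarith) h.hω h3
  have hω := hs.omega_mul
  have hl := hs.rel_lin
  have hω0 := h.hω
  have hkey := PointVortex.charpoly_interaction h.hω h.ha h.hb h.hc h.hab h.hac h.hbc h.eqn_a
    h.eqn_b h.eqn_c h.eqn_four rfl rfl rfl (D := 3 + sigma m x)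
  generalize a + b + c = e₁ at *
  generalize a * b + a * c + b * c = e₂ at *
  generalize a * b * c = e₃ at *
  have hσ : sigma m x = (m - 1) * e₁ ^ 2 / ((3 + m) * e₂) := by
    rw [sigma, ← hx, add_comm m 3]; field_simp
  have hω' : ω = (3 + m) * e₂ / (e₁ * e₃) := by
    rw [eq_div_iff (by positivity)]; linear_combination hω
  rw [hkey (by
    rw [hσ, hω']
    field_simp
    linear_combination hl) t]
  have hp : m * (m - 1) * e₂ / (ω * e₃) ^ 2 = m / (m + 3) * sigma m x := by
    rw [hσ, hω', add_comm m 3]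
    field_simp
  rw [hp, eigSum, eigProd]
  ring

theorem charpoly_eq (h : LineEquilibrium m ω z z₀ e a b c) (hm : -1 < m) {x : ℝ}
    (hx : (a * b + a * c + b * c) / (a + b + c) ^ 2 = x) :
    (scaledStability (circ m) ω z).charpoly =
      Polynomial.X ^ 2 * (Polynomial.X ^ 2 + 1) *
        (Polynomial.X ^ 4
          - Polynomial.C (eigSum m x ^ 2 - 2 * eigProd m x - 2) * Polynomial.X ^ 2 +
          Polynomial.C ((eigProd m x + 1) ^ 2 - eigSum m x ^ 2)) :=
  charpoly_scaledStability h.hω h.norm_eq h.line h.injective (h.charpoly_interaction hm hx)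

end LineEquilibrium

theorem IsGroupI.exists_lineEquilibrium {m ω : ℝ} {z : Config 4} (hm : -1 < m)
    (h : IsGroupI m ω z) : ∃ z₀ e a b c, LineEquilibrium m ω z z₀ e a b c ∧
      (a * b + a * c + b * c) / (a + b + c) ^ 2 = ratioI m := by
  obtain ⟨hrel, hcol, hext⟩ := h
  obtain ⟨z₀, e, a, b, c, h⟩ := PointVortex.exists_lineEquilibrium hrel hcol
  have hpos : ∀ i j : Fin 4, i ≠ 3 → j ≠ 3 → 0 < ![a, b, c, 0] i * ![a, b, c, 0] j := by
    intro i j hi hj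
    have h1 := hext i j hi hj
    rw [h.wbtw_iff hi hj] at h1
    exact lt_of_le_of_ne (not_lt.1 h1)
      (mul_ne_zero (h.injective.ne hi) (h.injective.ne hj)).symm
  exact ⟨z₀, e, a, b, c, h, h.ratio_eq_ratioI hm (hpos 0 1 (by decide) (by decide))
    (hpos 0 2 (by decide) (by decide)) (hpos 1 2 (by decide) (by decide))⟩

theorem IsGroupII.exists_lineEquilibrium {m ω : ℝ} {z : Config 4} (hm : -1 / 2 < m)
    (h : IsGroupII m ω z) : ∃ z₀ e a b c, LineEquilibrium m ω z z₀ e a b c ∧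
      (a * b + a * c + b * c) / (a + b + c) ^ 2 = ratioII m := by
  obtain ⟨hrel, hcol, i, j, hi, hj, hbtw⟩ := h
  obtain ⟨z₀, e, a, b, c, h⟩ := PointVortex.exists_lineEquilibrium hrel hcol
  refine ⟨z₀, e, a, b, c, h, h.ratio_eq_ratioII hm ?_⟩
  have hneg := (h.wbtw_iff hi hj).1 hbtw.wbtw
  fin_cases i <;> fin_cases j <;> simp at hi hj hneg <;>
    first
    | exact absurd hneg (mul_self_nonneg _).not_gt
    | (rw [mul_comm] at hneg; simp [hneg])
    | simp [hneg]

/-! ### The bifurcation values -/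

theorem hasDerivAt_Psi (m : ℝ) : HasDerivAt Psi
    (384 * m ^ 5 + 1600 * m ^ 4 + 384 * m ^ 3 - 660 * m ^ 2 + 1010 * m + 522) m := by
  have h := ((((((hasDerivAt_pow 6 m).const_mul 64).add ((hasDerivAt_pow 5 m).const_mul 320)).add
    ((hasDerivAt_pow 4 m).const_mul 96)).sub ((hasDerivAt_pow 3 m).const_mul 220)).add
    ((hasDerivAt_pow 2 m).const_mul 505)).add ((hasDerivAt_id m).const_mul 522) |>.add_const 9
  refine h.congr_deriv ?_
  norm_num
  ring

theorem continuous_Psi : Continuous Psi := by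
  unfold Psi; fun_prop

theorem strictAntiOn_Psi : StrictAntiOn Psi (Set.Icc (-1) (-1 / 2)) := by
  refine strictAntiOn_of_deriv_neg (convex_Icc _ _) continuous_Psi.continuousOn fun m hm => ?_
  rw [interior_Icc] at hm
  rw [(hasDerivAt_Psi m).deriv]
  obtain ⟨n, rfl⟩ : ∃ n : ℝ, m = n - 1 := ⟨m + 1, by ring⟩
  have h0 : 0 < n := by linarith [hm.1]
  have h1 : n < 1 / 2 := by linarith [hm.2]
  have h2 : n ^ 4 * (384 * n - 320) ≤ 0 :=
    mul_nonpos_of_nonneg_of_nonpos (by positivity) (by linarith)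
  have h3 : n * (1 / 2 - n) > 0 := mul_pos h0 (by linarith)
  have h4 : n ^ 2 * (1 / 2 - n) > 0 := mul_pos (by positivity) (by linarith)
  nlinarith

theorem strictMonoOn_Psi : StrictMonoOn Psi (Set.Icc (-1 / 10) 1) := by
  refine strictMonoOn_of_deriv_pos (convex_Icc _ _) continuous_Psi.continuousOn fun m hm => ?_
  rw [interior_Icc] at hm
  rw [(hasDerivAt_Psi m).deriv]
  obtain ⟨h0, h1⟩ := hm
  have h2 : 0 < 384 * m ^ 2 + 1600 * m + 384 := by nlinarith
  have h3 : m ^ 3 * (384 * m ^ 2 + 1600 * m + 384) ≥ -1 := by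
    rcases le_or_gt 0 m with h | h
    · have : 0 ≤ m ^ 3 := by positivity
      nlinarith [mul_nonneg this h2.le]
    · have h5 : -(1 / 1000) ≤ m ^ 3 := by
        nlinarith [mul_pos_of_neg_of_neg h h, sq_nonneg (m + 1 / 10)]
      nlinarith
  nlinarith

theorem Psi_neg_of_mem {m : ℝ} (h : m ∈ Set.Icc (-1 / 2 : ℝ) (-1 / 10)) : Psi m < 0 := by
  obtain ⟨u, rfl⟩ : ∃ u : ℝ, m = -u := ⟨-m, by ring⟩
  obtain ⟨h1, h2⟩ := h
  have hu1 : 1 / 10 ≤ u := by linarith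
  have hu2 : u ≤ 1 / 2 := by linarith
  have hu0 : 0 < u := by linarith
  have h3 : 0 ≤ (u - 1 / 10) * (1 / 2 - u) := mul_nonneg (by linarith) (by linarith)
  have h4 : 0 ≤ u * ((u - 1 / 10) * (1 / 2 - u)) := mul_nonneg hu0.le h3
  have h5 : 0 ≤ u ^ 4 := by positivity
  have h6 : u ^ 5 * (64 * u - 320) ≤ 0 :=
    mul_nonpos_of_nonneg_of_nonpos (by positivity) (by linarith)
  have h7 : u ^ 4 ≤ u ^ 2 / 4 := by nlinarith [sq_nonneg u]
  simp only [Psi]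
  nlinarith

/-- The roots `m*`, `m_c` of `Ψ` in `(-1, 0)`, and the sign of `Ψ` on the intervals they bound. -/
theorem exists_roots_Psi : ∃ mstar mc : ℝ, -0.8564137 < mstar ∧ mstar < -0.8564135 ∧
    -0.0175414 < mc ∧ mc < -0.0175412 ∧ Psi mstar = 0 ∧ Psi mc = 0 ∧
    (∀ m, -1 < m → m < mstar → 0 < Psi m) ∧ (∀ m, mstar < m → m < mc → Psi m < 0) ∧
    (∀ m, mc < m → m ≤ 1 → 0 < Psi m) := by
  obtain ⟨mstar, ⟨h1, h2⟩, h3⟩ : (0 : ℝ) ∈ Psi '' Set.Ioo (-0.8564137) (-0.8564135) :=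
    intermediate_value_Ioo' (by norm_num) continuous_Psi.continuousOn
      ⟨by norm_num [Psi], by norm_num [Psi]⟩
  obtain ⟨mc, ⟨h4, h5⟩, h6⟩ : (0 : ℝ) ∈ Psi '' Set.Ioo (-0.0175414) (-0.0175412) :=
    intermediate_value_Ioo (by norm_num) continuous_Psi.continuousOn
      ⟨by norm_num [Psi], by norm_num [Psi]⟩
  have hs : mstar ∈ Set.Icc (-1 : ℝ) (-1 / 2) := ⟨by linarith, by linarith⟩
  have hc : mc ∈ Set.Icc (-1 / 10 : ℝ) 1 := ⟨by linarith, by linarith⟩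
  refine ⟨mstar, mc, h1, h2, h4, h5, h3, h6, fun m ha hb => ?_, fun m ha hb => ?_,
    fun m ha hb => ?_⟩
  · rw [← h3]
    exact strictAntiOn_Psi ⟨ha.le, by linarith⟩ hs hb
  · rcases le_total m (-1 / 2) with h | h
    · rw [← h3]
      exact strictAntiOn_Psi hs ⟨by linarith, h⟩ ha
    rcases le_total m (-1 / 10) with h' | h'
    · exact Psi_neg_of_mem ⟨h, h'⟩
    · rw [← h6]
      exact strictMonoOn_Psi ⟨h', by linarith⟩ hc hb
  · rw [← h6]
    exact strictMonoOn_Psi hc ⟨by linarith, hb⟩ ha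

/-! ### Signs of the invariants of the nontrivial eigenvalues -/

/-- The discriminant of `t² - s t + p`. -/
noncomputable def eigDisc (m x : ℝ) : ℝ := eigSum m x ^ 2 - 4 * eigProd m x

section

variable {m x : ℝ}

theorem one_sub_eigSum_add_eigProd (hm : m + 3 ≠ 0) (hx : x ≠ 0) :
    eigProd m x + 1 - eigSum m x =
      2 * (x - (1 - m) * (2 * m + 3) / (2 * (m + 3) ^ 2)) / x := by
  simp only [eigProd, eigSum, sigma]; field_simp; ring

theorem eigDisc_eq (hm : m + 3 ≠ 0) (hx : x ≠ 0) (hq : ratioQuad m x = 0) :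
    eigDisc m x = ((m - 1) * (27 - 16 * m) * x + (8 * m ^ 2 - 7 * m + 8)) /
      (6 * ((m + 3) * x) ^ 2) := by
  simp only [ratioQuad] at hq
  simp only [eigDisc, eigProd, eigSum, sigma]
  field_simp
  linear_combination hq

theorem eigSum_sub (hm : m + 3 ≠ 0) (hx : x ≠ 0) (r : ℝ) (hr : r ≠ 0) :
    eigSum m x - (5 - r) = r * (x - (1 - m) / (r * (m + 3))) / x := by
  simp only [eigSum, sigma]; field_simp; ring

theorem one_sub_pos_ratioI (hm : -1 < m) :
    0 < eigProd m (ratioI m) + 1 - eigSum m (ratioI m) := by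
  have hx := ratioI_pos hm
  rw [one_sub_eigSum_add_eigProd (by linarith) hx.ne']
  have := lt_ratioI_of_one_sub hm
  exact div_pos (by linarith) hx

theorem one_sub_pos_ratioII (hm : -1 / 2 < m) :
    0 < eigProd m (ratioII m) + 1 - eigSum m (ratioII m) := by
  have hx := ratioII_neg hm
  rw [one_sub_eigSum_add_eigProd (by linarith) hx.ne]
  have := ratioII_lt_of_one_sub hm
  exact div_pos_of_neg_of_neg (by linarith) hx

theorem eigSum_pos_ratioI (hm : -1 < m) : 0 < eigSum m (ratioI m) := by
  have hx := ratioI_pos hm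
  have hk : 0 < m + 3 := by linarith
  have h := eigSum_sub hk.ne' hx.ne' 5 (by norm_num)
  rw [sub_self, sub_zero] at h
  rw [h]
  refine div_pos (mul_pos (by norm_num) (sub_pos.2 ?_)) hx
  rcases le_or_gt m 1 with h1 | h1
  · refine lt_of_le_of_lt ?_ (lt_ratioI_of_prod hm)
    rw [div_le_div_iff₀ (by positivity) (by positivity)]
    have h2 : 0 ≤ (1 - m) * (m + 3) := mul_nonneg (by linarith) hk.le
    nlinarith [mul_nonneg h2 (show 0 ≤ 3 * m + 4 by linarith)]
  · exact (div_neg_of_neg_of_pos (by linarith) (by positivity)).trans hx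

theorem eigProd_pos_ratioI (hm : -1 < m) : 0 < eigProd m (ratioI m) := by
  have hx := ratioI_pos hm
  have hk : 0 < m + 3 := by linarith
  have h : eigProd m (ratioI m) =
      6 * (ratioI m - (1 - m) * (m + 2) / (2 * (m + 3) ^ 2)) / ratioI m := by
    simp only [eigProd, sigma]; field_simp; ring
  rw [h]
  have := lt_ratioI_of_prod hm
  exact div_pos (by linarith) hx

theorem two_lt_eigSum_ratioI (hm : -1 / 10 < m) : 2 < eigSum m (ratioI m) := by
  have hx := ratioI_pos (show -1 < m by linarith)
  have hk : 0 < m + 3 := by linarith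
  have h := eigSum_sub hk.ne' hx.ne' 3 (by norm_num)
  have hlt : (1 - m) / (3 * (m + 3)) < ratioI m := by
    refine lt_ratioI (by linarith) ?_
    rw [ratioQuad_div m (by positivity), div_neg_iff]
    refine Or.inr ⟨?_, by positivity⟩
    have h1 : 0 < 24 * m ^ 3 + 96 * m ^ 2 + 141 * m + 63 := by
      nlinarith [mul_nonneg (show 0 ≤ m + 1 / 10 by linarith) (sq_nonneg m), sq_nonneg m]
    have h2 : 6 * (m + 3) ^ 2 * (1 - m) ^ 2 + (4 * m + 9) * (m - 1) * (1 - m) * (3 * (m + 3))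
        - (m + 2) * (2 * m + 1) * (3 * (m + 3)) ^ 2 =
        -((m + 3) * (24 * m ^ 3 + 96 * m ^ 2 + 141 * m + 63)) := by ring
    rw [h2, neg_lt_zero]
    positivity
  have : 0 < 3 * (ratioI m - (1 - m) / (3 * (m + 3))) / ratioI m :=
    div_pos (by linarith) hx
  linarith

theorem eigSum_ratioI_lt_two (hm : -1 < m) (hm' : m < -4 / 5) : eigSum m (ratioI m) < 2 := by
  have hx := ratioI_pos hm
  have hk : 0 < m + 3 := by linarith
  have h := eigSum_sub hk.ne' hx.ne' 3 (by norm_num)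
  have hlt : ratioI m < (1 - m) / (3 * (m + 3)) := by
    refine ratioI_lt hm ?_ ?_
    · rw [ratioQuad_div m (by positivity)]
      have h1 : 24 * m ^ 3 + 96 * m ^ 2 + 141 * m + 63 < 0 := by
        have : 0 < (-4 / 5 - m) * (24 * (m + 4 / 5) ^ 2 + 192 / 5 * (m + 4 / 5) + 168 / 5) :=
          mul_pos (by linarith) (by nlinarith [sq_nonneg (m + 4 / 5 + 4 / 5)])
        nlinarith
      have h2 : 6 * (m + 3) ^ 2 * (1 - m) ^ 2 + (4 * m + 9) * (m - 1) * (1 - m) * (3 * (m + 3))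
          - (m + 2) * (2 * m + 1) * (3 * (m + 3)) ^ 2 =
          (m + 3) * -(24 * m ^ 3 + 96 * m ^ 2 + 141 * m + 63) := by ring
      rw [h2]
      exact div_pos (mul_pos hk (by linarith)) (by positivity)
    · have : 12 * (m + 3) ^ 2 * ((1 - m) / (3 * (m + 3))) = 4 * (m + 3) * (1 - m) := by
        field_simp; ring
      rw [this]
      nlinarith
  have : 3 * (ratioI m - (1 - m) / (3 * (m + 3))) / ratioI m < 0 :=
    div_neg_of_neg_of_pos (by linarith) hx
  linarith

/-- The ratio at which the nontrivial eigenvalues of the interaction matrix collide; that it is a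
root of `ratioQuad m` is the equation `Ψ(m) = 0`. -/
theorem ratioQuad_collision (hm : m < 1) :
    ratioQuad m ((8 * m ^ 2 - 7 * m + 8) / ((1 - m) * (27 - 16 * m))) =
      6 * Psi m / ((1 - m) * (27 - 16 * m)) ^ 2 := by
  rw [ratioQuad_div m (mul_pos (by linarith) (by linarith)).ne', Psi]
  congr 1
  ring

theorem critical_lt_collision (hm : -1 < m) (hm' : m < 1) :
    0 < 12 * (m + 3) ^ 2 * ((8 * m ^ 2 - 7 * m + 8) / ((1 - m) * (27 - 16 * m))) +
      (4 * m + 9) * (m - 1) := by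
  have hg : 0 < (1 - m) * (27 - 16 * m) := mul_pos (by linarith) (by linarith)
  have h1 : 0 < 160 * m ^ 4 + 400 * m ^ 3 + 205 * m ^ 2 + 342 * m + 621 := by
    obtain ⟨n, rfl⟩ : ∃ n : ℝ, m = n - 1 := ⟨m + 1, by ring⟩
    have hn : 0 < n := by linarith
    have hn2 : n < 2 := by linarith
    have h : 160 * (n - 1) ^ 4 + 400 * (n - 1) ^ 3 + 205 * (n - 1) ^ 2 + 342 * (n - 1) + 621 =
        160 * n ^ 4 - 240 * n ^ 3 - 35 * n ^ 2 + 492 * n + 244 := by ring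
    rw [h]
    nlinarith [mul_nonneg (sq_nonneg n) (sq_nonneg (n - 3 / 4)), mul_pos hn (sub_pos.2 hn2)]
  have h2 : 12 * (m + 3) ^ 2 * ((8 * m ^ 2 - 7 * m + 8) / ((1 - m) * (27 - 16 * m))) +
      (4 * m + 9) * (m - 1) = (12 * (m + 3) ^ 2 * (8 * m ^ 2 - 7 * m + 8) +
        (4 * m + 9) * (m - 1) * ((1 - m) * (27 - 16 * m))) / ((1 - m) * (27 - 16 * m)) := by
    rw [eq_div_iff hg.ne', add_mul, mul_assoc (12 * _), div_mul_cancel₀ _ hg.ne']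
  rw [h2]
  refine div_pos ?_ hg
  nlinarith

theorem eigDisc_ratioI_eq (hm : -1 < m) :
    eigDisc m (ratioI m) = ((m - 1) * (27 - 16 * m) * ratioI m + (8 * m ^ 2 - 7 * m + 8)) /
      (6 * ((m + 3) * ratioI m) ^ 2) :=
  eigDisc_eq (by linarith) (ratioI_pos hm).ne' (ratioQuad_ratioI hm)

theorem eigDisc_ratioI_pos (hm : -1 < m) (hm' : m < 1) (h : 0 < Psi m) :
    0 < eigDisc m (ratioI m) := by
  have hg : 0 < (1 - m) * (27 - 16 * m) := mul_pos (by linarith) (by linarith)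
  have hx := ratioI_pos hm
  have hk : 0 < m + 3 := by linarith
  have hlt := ratioI_lt hm (by rw [ratioQuad_collision hm']; positivity)
    (critical_lt_collision hm hm').le
  rw [lt_div_iff₀ hg] at hlt
  rw [eigDisc_ratioI_eq hm]
  exact div_pos (by linarith) (by positivity)

theorem eigDisc_ratioI_neg (hm : -1 < m) (hm' : m < 1) (h : Psi m < 0) :
    eigDisc m (ratioI m) < 0 := by
  have hg : 0 < (1 - m) * (27 - 16 * m) := mul_pos (by linarith) (by linarith)
  have hx := ratioI_pos hm
  have hk : 0 < m + 3 := by linarith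
  have hlt := lt_ratioI hm (x := (8 * m ^ 2 - 7 * m + 8) / ((1 - m) * (27 - 16 * m)))
    (by rw [ratioQuad_collision hm']
        exact div_neg_of_neg_of_pos (by linarith) (by positivity))
  rw [div_lt_iff₀ hg] at hlt
  rw [eigDisc_ratioI_eq hm]
  exact div_neg_of_neg_of_pos (by linarith) (by positivity)

theorem eigDisc_ratioI_eq_zero (hm : -1 < m) (hm' : m < 1) (h : Psi m = 0) :
    eigDisc m (ratioI m) = 0 := by
  have hg : 0 < (1 - m) * (27 - 16 * m) := mul_pos (by linarith) (by linarith)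
  have hk : 0 < m + 3 := by linarith
  have heq : (8 * m ^ 2 - 7 * m + 8) / ((1 - m) * (27 - 16 * m)) = ratioI m := by
    refine (eq_ratioI_or_eq_ratioII hm (by rw [ratioQuad_collision hm', h]; simp)).resolve_right
      fun hII => ?_
    have h1 := critical_lt_collision hm hm'
    rw [hII, ratioII_spec hm] at h1
    exact absurd h1 (by simp [Real.sqrt_nonneg])
  rw [div_eq_iff hg.ne'] at heq
  rw [eigDisc_ratioI_eq hm, div_eq_zero_iff]
  left
  linear_combination heq

theorem eigDisc_ratioI_pos_of_one_le (hm : 1 ≤ m) : 0 < eigDisc m (ratioI m) := by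
  have hm1 : -1 < m := by linarith
  have hx := ratioI_pos hm1
  have hx3 := ratioI_lt_third hm1
  have hk : 0 < m + 3 := by linarith
  rw [eigDisc_ratioI_eq hm1]
  refine div_pos ?_ (by positivity)
  -- the expression is linear in the ratio, and positive for the ratios `0` and `1/3`
  have h0 : 0 < 8 * m ^ 2 - 7 * m + 8 := by nlinarith
  have h1 : 0 < 8 * m ^ 2 + 22 * m - 3 := by nlinarith
  nlinarith [mul_pos h0 (sub_pos.2 hx3), mul_pos h1 hx]

theorem sigma_ratioII_lower (hm : -1 / 2 < m) : -3 < sigma m (ratioII m) := by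
  have hx := ratioII_neg hm
  have hk : 0 < m + 3 := by linarith
  have h := eigSum_sub hk.ne' hx.ne 3 (by norm_num)
  have hlt : ratioII m < (1 - m) / (3 * (m + 3)) := by
    rcases le_or_gt m 1 with h1 | h1
    · exact hx.trans_le (div_nonneg (by linarith) (by positivity))
    · refine (ratioII_lt_of_one_sub hm).trans_le ?_
      rw [div_le_div_iff₀ (by positivity) (by positivity)]
      nlinarith [mul_nonneg (mul_nonneg (sub_pos.2 h1).le hk.le) (show 0 ≤ 4 * m + 3 by linarith)]
  have h2 : 0 < 3 * (ratioII m - (1 - m) / (3 * (m + 3))) / ratioII m :=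
    div_pos_of_neg_of_neg (by linarith) hx
  simp only [eigSum] at h
  linarith

theorem two_lt_eigSum_ratioII (hm : -1 / 2 < m) : 2 < eigSum m (ratioII m) := by
  have := sigma_ratioII_lower hm
  simp only [eigSum]
  linarith

theorem eigDisc_ratioII_pos (hm : -1 / 2 < m) : 0 < eigDisc m (ratioII m) := by
  have hx := ratioII_neg hm
  have hk : 0 < m + 3 := by linarith
  have h : eigDisc m (ratioII m) =
      (1 + sigma m (ratioII m)) ^ 2 - 4 * (m / (m + 3) * sigma m (ratioII m)) := by
    simp only [eigDisc, eigSum, eigProd]; ring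
  have hσ : (m - 1) * sigma m (ratioII m) ≤ 0 := by
    rw [sigma, ← mul_div_assoc]
    exact div_nonpos_of_nonneg_of_nonpos (mul_self_nonneg _)
      (mul_nonpos_of_nonneg_of_nonpos hk.le hx.le)
  set σ := sigma m (ratioII m)
  rw [h]
  rcases lt_trichotomy m 1 with h1 | rfl | h1
  · have hσ0 : 0 ≤ σ := by nlinarith
    have h2 : m / (m + 3) < 1 / 2 := by rw [div_lt_div_iff₀ hk (by norm_num)]; linarith
    nlinarith [mul_le_mul_of_nonneg_right h2.le hσ0, sq_nonneg (1 - σ)]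
  · have : σ = 0 := by simp [σ, sigma]
    rw [this]; norm_num
  · have hσ0 : σ ≤ 0 := by nlinarith
    rcases hσ0.lt_or_eq with h2 | h2
    · have : 0 < m / (m + 3) := by positivity
      nlinarith [mul_pos this (neg_pos.2 h2), sq_nonneg (1 + σ)]
    · rw [h2]; norm_num

end

/-! ### From the characteristic polynomial to the eigenvalues -/

/-- The form of the characteristic polynomial of the scaled stability matrix when the nontrivial
eigenvalues of the scaled interaction matrix are the roots of `t² - s t + p`. -/
def HasInvariants (Γ : Fin 4 → ℝ) (ω : ℝ) (z : Config 4) (s p : ℝ) : Prop :=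
  (scaledStability Γ ω z).charpoly =
    Polynomial.X ^ 2 * (Polynomial.X ^ 2 + 1) *
      (Polynomial.X ^ 4 - Polynomial.C (s ^ 2 - 2 * p - 2) * Polynomial.X ^ 2 +
        Polynomial.C ((p + 1) ^ 2 - s ^ 2))

/-- The nontrivial eigenvalues are read off from a factorization of the quartic factor; the other
factor `X² (X² + 1)` gives the trivial ones. -/
theorem HasInvariants.hasNontrivialEigenvalues {Γ : Fin 4 → ℝ} {ω : ℝ} {z : Config 4} {s p : ℝ}
    (h : HasInvariants Γ ω z s p) {w₁ w₂ w₃ w₄ : ℂ}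
    (hw : (Polynomial.X - Polynomial.C w₁) * (Polynomial.X - Polynomial.C w₂) *
      (Polynomial.X - Polynomial.C w₃) * (Polynomial.X - Polynomial.C w₄) =
      Polynomial.X ^ 4 - Polynomial.C ((s : ℂ) ^ 2 - 2 * p - 2) * Polynomial.X ^ 2 +
        Polynomial.C (((p : ℂ) + 1) ^ 2 - s ^ 2)) :
    HasNontrivialEigenvalues Γ ω z {w₁, w₂, w₃, w₄} := by
  have hI : (Polynomial.X - Polynomial.C Complex.I) * (Polynomial.X - Polynomial.C (-Complex.I)) =
      Polynomial.X ^ 2 + 1 := by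
    have : Polynomial.C Complex.I * Polynomial.C Complex.I = -1 := by
      rw [← Polynomial.C_mul, Complex.I_mul_I, Polynomial.C_neg, Polynomial.C_1]
    rw [Polynomial.C_neg]
    linear_combination -this
  rw [HasNontrivialEigenvalues, normalizedEigenvalues, h, Polynomial.aroots,
    ← Polynomial.roots_multiset_prod_X_sub_C (({0, 0, Complex.I, -Complex.I} : Multiset ℂ) + _)]
  congr 1
  simp only [Polynomial.map_mul, Polynomial.map_add, Polynomial.map_sub, Polynomial.map_pow,
    Polynomial.map_X, Polynomial.map_C, Polynomial.map_one, Multiset.map_add, Multiset.prod_add,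
    Multiset.insert_eq_cons, Multiset.map_cons, Multiset.map_singleton, Multiset.prod_cons,
    Multiset.prod_singleton, Complex.coe_algebraMap]
  push_cast
  rw [← hw, ← hI, Polynomial.C_0]
  ring

/-- The larger root of `t² - s t + p`, if the roots are real. -/
noncomputable def rootPlus (s p : ℝ) : ℝ := (s + √(s ^ 2 - 4 * p)) / 2

/-- The smaller root of `t² - s t + p`, if the roots are real. -/
noncomputable def rootMinus (s p : ℝ) : ℝ := (s - √(s ^ 2 - 4 * p)) / 2

section

variable {s p : ℝ}

theorem rootPlus_add_rootMinus (s p : ℝ) : rootPlus s p + rootMinus s p = s := by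
  simp only [rootPlus, rootMinus]; ring

theorem rootPlus_mul_rootMinus (h : 0 ≤ s ^ 2 - 4 * p) : rootPlus s p * rootMinus s p = p := by
  simp only [rootPlus, rootMinus]
  linear_combination -(Real.sq_sqrt h) / 4

theorem rootMinus_le_rootPlus (s p : ℝ) : rootMinus s p ≤ rootPlus s p := by
  have := Real.sqrt_nonneg (s ^ 2 - 4 * p)
  simp only [rootPlus, rootMinus]; linarith

theorem rootMinus_lt_rootPlus (h : 0 < s ^ 2 - 4 * p) : rootMinus s p < rootPlus s p := by
  have := Real.sqrt_pos.2 h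
  simp only [rootPlus, rootMinus]; linarith

theorem one_lt_rootMinus (h : 0 ≤ s ^ 2 - 4 * p) (hs : 2 < s) (h1 : 0 < p + 1 - s) :
    1 < rootMinus s p := by
  have h2 := rootPlus_add_rootMinus s p
  have h3 := rootPlus_mul_rootMinus h
  have h4 := rootMinus_le_rootPlus s p
  by_contra hle
  have h5 : (rootPlus s p - 1) * (rootMinus s p - 1) > 0 := by nlinarith
  nlinarith [mul_nonneg (show 0 ≤ rootPlus s p - 1 by linarith)
    (show 0 ≤ 1 - rootMinus s p by linarith)]

theorem roots_mem_Ioo (h : 0 ≤ s ^ 2 - 4 * p) (hs : s < 2) (hs' : 0 < s) (h1 : 0 < p + 1 - s) :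
    -1 < rootMinus s p ∧ rootPlus s p < 1 := by
  have h3 := rootPlus_add_rootMinus s p
  have h4 := rootPlus_mul_rootMinus h
  have h5 := rootMinus_le_rootPlus s p
  have h6 : rootPlus s p < 1 := by
    by_contra hle
    have h7 : (rootPlus s p - 1) * (1 - rootMinus s p) < 0 := by nlinarith
    nlinarith [mul_nonneg (show 0 ≤ rootPlus s p - 1 by linarith)
      (show 0 ≤ 1 - rootMinus s p by linarith)]
  refine ⟨?_, h6⟩
  by_contra hle
  nlinarith [mul_nonneg (show 0 ≤ rootPlus s p + 1 by linarith)
      (show 0 ≤ -1 - rootMinus s p by linarith)]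

end

/-- The real eigenvalue `√(μ² - 1)` for an eigenvalue `μ` of the scaled interaction matrix. -/
noncomputable def realRate (μ : ℝ) : ℝ := √(μ ^ 2 - 1)

/-- The frequency `√(1 - μ²)` for an eigenvalue `μ` of the scaled interaction matrix. -/
noncomputable def frequency (μ : ℝ) : ℝ := √(1 - μ ^ 2)

theorem realRate_pos {μ : ℝ} (h : 1 < μ) : 0 < realRate μ :=
  Real.sqrt_pos.2 (by nlinarith)

theorem realRate_lt {μ ν : ℝ} (h : 1 < μ) (h' : μ < ν) : realRate μ < realRate ν :=
  Real.sqrt_lt_sqrt (by nlinarith) (by nlinarith)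

theorem frequency_pos {μ : ℝ} (h : -1 < μ) (h' : μ < 1) : 0 < frequency μ :=
  Real.sqrt_pos.2 (by nlinarith)

namespace HasInvariants

variable {ω s p : ℝ} {z : Config 4} {m : ℝ}

theorem hasRealPairs (h : HasInvariants (circ m) ω z s p) (hN : 0 ≤ s ^ 2 - 4 * p) (hs : 2 < s)
    (h1 : 0 < p + 1 - s) :
    HasRealPairs m ω z (realRate (rootPlus s p)) (realRate (rootMinus s p)) := by
  have h2 := rootPlus_add_rootMinus s p
  have h3 := rootPlus_mul_rootMinus hN
  have h4 := one_lt_rootMinus hN hs h1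
  have h5 := rootMinus_le_rootPlus s p
  have ha : realRate (rootPlus s p) ^ 2 = rootPlus s p ^ 2 - 1 := Real.sq_sqrt (by nlinarith)
  have hb : realRate (rootMinus s p) ^ 2 = rootMinus s p ^ 2 - 1 := Real.sq_sqrt (by nlinarith)
  refine h.hasNontrivialEigenvalues ?_
  set a := realRate (rootPlus s p)
  set b := realRate (rootMinus s p)
  have hsum : s ^ 2 - 2 * p - 2 = a ^ 2 + b ^ 2 := by
    rw [ha, hb]; nth_rw 1 [← h2]; nth_rw 3 [← h3]; ring
  have hprod : (p + 1) ^ 2 - s ^ 2 = a ^ 2 * b ^ 2 := by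
    rw [ha, hb]; linear_combination (p + rootPlus s p * rootMinus s p) * (-h3) +
      (s + (rootPlus s p + rootMinus s p)) * h2 - 2 * h3
  have hsum' : (s : ℂ) ^ 2 - 2 * p - 2 = a ^ 2 + b ^ 2 := by exact_mod_cast hsum
  have hprod' : ((p : ℂ) + 1) ^ 2 - s ^ 2 = a ^ 2 * b ^ 2 := by exact_mod_cast hprod
  rw [hsum', hprod']
  simp only [Polynomial.C_neg, Polynomial.C_add, Polynomial.C_mul, Polynomial.C_pow]
  ring

theorem hasImaginaryPairs (h : HasInvariants (circ m) ω z s p) (hN : 0 ≤ s ^ 2 - 4 * p)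
    (hs : s < 2) (hs' : 0 < s) (h1 : 0 < p + 1 - s) :
    HasImaginaryPairs m ω z (frequency (rootPlus s p)) (frequency (rootMinus s p)) := by
  have h2 := rootPlus_add_rootMinus s p
  have h3 := rootPlus_mul_rootMinus hN
  have h4 := roots_mem_Ioo hN hs hs' h1
  have h5 := rootMinus_le_rootPlus s p
  have ha : frequency (rootPlus s p) ^ 2 = 1 - rootPlus s p ^ 2 :=
    Real.sq_sqrt (by nlinarith [h4.1, h4.2])
  have hb : frequency (rootMinus s p) ^ 2 = 1 - rootMinus s p ^ 2 :=
    Real.sq_sqrt (by nlinarith [h4.1, h4.2])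
  refine h.hasNontrivialEigenvalues ?_
  set a := frequency (rootPlus s p)
  set b := frequency (rootMinus s p)
  have hsum : s ^ 2 - 2 * p - 2 = -(a ^ 2 + b ^ 2) := by
    rw [ha, hb]; nth_rw 1 [← h2]; nth_rw 3 [← h3]; ring
  have hprod : (p + 1) ^ 2 - s ^ 2 = a ^ 2 * b ^ 2 := by
    rw [ha, hb]; linear_combination (p + rootPlus s p * rootMinus s p) * (-h3) +
      (s + (rootPlus s p + rootMinus s p)) * h2 - 2 * h3
  have hsum' : (s : ℂ) ^ 2 - 2 * p - 2 = -(a ^ 2 + b ^ 2) := by exact_mod_cast hsum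
  have hprod' : ((p : ℂ) + 1) ^ 2 - s ^ 2 = a ^ 2 * b ^ 2 := by exact_mod_cast hprod
  have hI : Polynomial.C Complex.I ^ 2 = -1 := by
    rw [← Polynomial.C_pow, Complex.I_sq, Polynomial.C_neg, Polynomial.C_1]
  rw [hsum', hprod']
  simp only [Polynomial.C_neg, Polynomial.C_add, Polynomial.C_mul, Polynomial.C_pow]
  set A := Polynomial.C (a : ℂ)
  set B := Polynomial.C (b : ℂ)
  linear_combination (-(A ^ 2 + B ^ 2) * Polynomial.X ^ 2 +
    A ^ 2 * B ^ 2 * (Polynomial.C Complex.I ^ 2 - 1)) * hI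

/-- If `S` has no real nontrivial eigenvalue, then `X⁴ - U X² + V` has
`U² - 4 V = s² (s² - 4 p) < 0`, so its roots form a quartuplet with `a² - b² = U / 2` and
`a² + b² = √V`. -/
theorem exists_hasQuartuplet (hN : s ^ 2 - 4 * p < 0) (hs : 0 < s) :
    ∃ a b : ℝ, 0 < a ∧ 0 < b ∧ ∀ m ω z, HasInvariants (circ m) ω z s p →
      HasQuartuplet m ω z a b := by
  set U := s ^ 2 - 2 * p - 2 with hU
  set V := (p + 1) ^ 2 - s ^ 2 with hV
  have hUV : U ^ 2 < 4 * V := by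
    have : U ^ 2 - 4 * V = s ^ 2 * (s ^ 2 - 4 * p) := by rw [hU, hV]; ring
    nlinarith [mul_pos_of_neg_of_neg hN (neg_lt_zero.2 (pow_pos hs 2))]
  have hV0 : 0 < V := by nlinarith [sq_nonneg U]
  have hlt : |U| < 2 * √V := by
    have : 2 * √V = √(4 * V) := by
      rw [Real.sqrt_mul (by norm_num), show √4 = 2 by
        rw [show (4 : ℝ) = 2 ^ 2 by norm_num]; exact Real.sqrt_sq (by norm_num)]
    rw [this]
    exact Real.lt_sqrt_of_sq_lt (by rwa [sq_abs])
  obtain ⟨hlt1, hlt2⟩ := abs_lt.1 hlt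
  have ha0 : 0 < (√V + U / 2) / 2 := by linarith
  have hb0 : 0 < (√V - U / 2) / 2 := by linarith
  refine ⟨√((√V + U / 2) / 2), √((√V - U / 2) / 2), Real.sqrt_pos.2 ha0, Real.sqrt_pos.2 hb0,
    fun m ω z h => h.hasNontrivialEigenvalues ?_⟩
  have ha := Real.sq_sqrt ha0.le
  have hb := Real.sq_sqrt hb0.le
  set a := √((√V + U / 2) / 2)
  set b := √((√V - U / 2) / 2)
  have hsum : s ^ 2 - 2 * p - 2 = 2 * (a ^ 2 - b ^ 2) := by rw [ha, hb, ← hU]; ring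
  have hprod : (p + 1) ^ 2 - s ^ 2 = (a ^ 2 + b ^ 2) ^ 2 := by
    rw [ha, hb, ← hV]
    linear_combination -(Real.sq_sqrt hV0.le)
  have hsum' : (s : ℂ) ^ 2 - 2 * p - 2 = 2 * (a ^ 2 - b ^ 2) := by exact_mod_cast hsum
  have hprod' : ((p : ℂ) + 1) ^ 2 - s ^ 2 = (a ^ 2 + b ^ 2) ^ 2 := by exact_mod_cast hprod
  have hI : Polynomial.C Complex.I ^ 2 = -1 := by
    rw [← Polynomial.C_pow, Complex.I_sq, Polynomial.C_neg, Polynomial.C_1]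
  have h2 : Polynomial.C (2 : ℂ) = 2 := rfl
  rw [hsum', hprod']
  simp only [Polynomial.C_neg, Polynomial.C_add, Polynomial.C_sub, Polynomial.C_mul,
    Polynomial.C_pow, h2]
  set A := Polynomial.C (a : ℂ)
  set B := Polynomial.C (b : ℂ)
  set i := Polynomial.C Complex.I
  have hfac : (Polynomial.X - (A + i * B)) * (Polynomial.X - (A - i * B)) *
      (Polynomial.X - (-A + i * B)) * (Polynomial.X - (-A - i * B)) =
      ((Polynomial.X - A) ^ 2 - i ^ 2 * B ^ 2) * ((Polynomial.X + A) ^ 2 - i ^ 2 * B ^ 2) := by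
    ring
  rw [hfac, hI]
  ring

end HasInvariants

theorem HasNontrivialEigenvalues.isUnstable {Γ : Fin 4 → ℝ} {ω : ℝ} {z : Config 4}
    {t : Multiset ℂ} (h : HasNontrivialEigenvalues Γ ω z t) {μ : ℂ} (hμ : μ ∈ t) (hre : 0 < μ.re) :
    IsUnstable Γ ω z :=
  ⟨μ, by rw [h]; exact Multiset.mem_add.2 (Or.inr hμ), hre⟩

theorem HasRealPairs.isUnstable {m ω a b : ℝ} {z : Config 4} (h : HasRealPairs m ω z a b)
    (ha : 0 < a) : IsUnstable (circ m) ω z :=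
  HasNontrivialEigenvalues.isUnstable h (μ := (a : ℂ)) (by simp) (by simpa using ha)

theorem HasQuartuplet.isUnstable {m ω a b : ℝ} {z : Config 4} (h : HasQuartuplet m ω z a b)
    (ha : 0 < a) : IsUnstable (circ m) ω z :=
  HasNontrivialEigenvalues.isUnstable h (μ := a + Complex.I * b) (by simp) (by simpa using ha)

theorem HasImaginaryPairs.isSpectrallyStable {m ω a b : ℝ} {z : Config 4}
    (h : HasImaginaryPairs m ω z a b) (ha : 0 < a) (hb : 0 < b) :
    IsSpectrallyStable (circ m) ω z := by
  refine ⟨_, h, fun μ hμ => ?_⟩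
  simp only [Multiset.insert_eq_cons, Multiset.mem_cons, Multiset.mem_singleton] at hμ
  rcases hμ with rfl | rfl | rfl | rfl <;> simp [ha.ne', hb.ne']

/-! ### Linear stability -/

/-- The interaction operator is symmetric for the bilinear form `∑ i, Γ i u i v i`. -/
theorem interaction_symm {n : ℕ} (Γ y u v : Fin n → ℝ) :
    ∑ i, Γ i * (u i * interaction Γ y v i) = ∑ i, Γ i * (interaction Γ y u i * v i) := by
  have h : ∀ i, Γ i * (u i * interaction Γ y v i) =
      ∑ j, Γ i * Γ j * (u i * v i) / (y i - y j) ^ 2 -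
        ∑ j, Γ i * Γ j * (u i * v j) / (y i - y j) ^ 2 := fun i => by
    rw [interaction_apply, ← Finset.sum_sub_distrib, Finset.mul_sum, Finset.mul_sum]
    exact Finset.sum_congr rfl fun j _ => by ring
  have h' : ∀ i, Γ i * (interaction Γ y u i * v i) =
      ∑ j, Γ i * Γ j * (u i * v i) / (y i - y j) ^ 2 -
        ∑ j, Γ i * Γ j * (u j * v i) / (y i - y j) ^ 2 := fun i => by
    rw [interaction_apply, ← Finset.sum_sub_distrib, Finset.sum_mul, Finset.mul_sum]
    exact Finset.sum_congr rfl fun j _ => by ring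
  rw [Finset.sum_congr rfl fun i _ => h i, Finset.sum_congr rfl fun i _ => h' i,
    Finset.sum_sub_distrib, Finset.sum_sub_distrib]
  congr 1
  rw [Finset.sum_comm]
  exact Finset.sum_congr rfl fun i _ => Finset.sum_congr rfl fun j _ => by
    rw [show (y j - y i) ^ 2 = (y i - y j) ^ 2 by ring]; ring

theorem frame_add {n : ℕ} (e : Plane) (u u' v v' : Fin n → ℝ) :
    frame e u v + frame e u' v' = frame e (u + u') (v + v') := by
  ext1 i; simp only [frame, Pi.add_apply]; module

theorem smul_frame {n : ℕ} (e : Plane) (r : ℝ) (u v : Fin n → ℝ) :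
    r • frame e u v = frame e (r • u) (r • v) := by
  ext1 i; simp only [frame, Pi.smul_apply, smul_eq_mul]; module

theorem frame_injective {n : ℕ} {e : Plane} (he : ‖e‖ = 1) {u u' v v' : Fin n → ℝ}
    (h : frame e u v = frame e u' v') : u = u' ∧ v = v' := by
  have h1 : frameEquiv he (Sum.elim u v) = frameEquiv he (Sum.elim u' v') := by
    simpa [frameEquiv_apply] using h
  have h2 := (frameEquiv he).injective h1
  exact ⟨funext fun i => by simpa using congrFun h2 (Sum.inl i),
    funext fun i => by simpa using congrFun h2 (Sum.inr i)⟩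

theorem exists_frame_eq {n : ℕ} {e : Plane} (he : ‖e‖ = 1) (w : Config n) :
    ∃ u v : Fin n → ℝ, frame e u v = w :=
  ⟨_, _, (frameEquiv he).apply_symm_apply w⟩

theorem sum_frame {n : ℕ} {ι : Type*} (t : Finset ι) (e : Plane) (u v : ι → Fin n → ℝ) :
    ∑ k ∈ t, frame e (u k) (v k) = frame e (∑ k ∈ t, u k) (∑ k ∈ t, v k) := by
  ext1 i
  simp only [frame, Finset.sum_apply, Finset.sum_sub_distrib, Finset.sum_smul]

theorem frame_mem_perp_iff {n : ℕ} {Γ : Fin n → ℝ} {z : Config n} {e : Plane} (he : ‖e‖ = 1)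
    {x : Fin n → ℝ} (hx : ∀ i, z i - center Γ z = x i • e) (u v : Fin n → ℝ) :
    frame e u v ∈ perp Γ z ↔ ∑ i, Γ i * (x i * u i) = 0 ∧ ∑ i, Γ i * (x i * v i) = 0 := by
  have hee : inner ℝ e e = 1 := by rw [real_inner_self_eq_norm_sq, he, one_pow]
  have hJJ : inner ℝ (J e) (J e) = 1 := by
    rw [real_inner_self_eq_norm_sq, norm_J, he, one_pow]
  have hJe : inner ℝ (J e) e = 0 := by rw [real_inner_comm]; exact inner_self_J e
  have hJx : ∀ i, J (z i - center Γ z) = x i • J e := fun i => by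
    rw [hx, ← rotL_apply, map_smul, rotL_apply]
  have h1 : ∀ i, Γ i * inner ℝ (z i - center Γ z) (frame e u v i) = Γ i * (x i * u i) := fun i => by
    rw [hx, frame, inner_smul_left, inner_sub_right, inner_smul_right, inner_smul_right, hee,
      inner_self_J]
    simp
  have h2 : ∀ i, Γ i * inner ℝ (J (z i - center Γ z)) (frame e u v i) = -(Γ i * (x i * v i)) :=
    fun i => by
    rw [hJx, frame, inner_smul_left, inner_sub_right, inner_smul_right, inner_smul_right, hJJ, hJe]
    simp
  change (∑ i, Γ i * inner ℝ (z i - center Γ z) (frame e u v i) = 0 ∧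
    ∑ i, Γ i * inner ℝ (J (z i - center Γ z)) (frame e u v i) = 0) ↔ _
  rw [Finset.sum_congr rfl fun i _ => h1 i, Finset.sum_congr rfl fun i _ => h2 i,
    Finset.sum_neg_distrib, neg_eq_zero]

/-- If the scaled interaction matrix has eigenvectors `v k` that form a basis of the orthogonal
complement of the coordinates `x` relative to the center, with eigenvalues `μ k` in `(-1, 1)`,
then the scaled stability matrix rotates each plane spanned by the parallel and the normal
displacement along `v k`, with frequency `√(1 - μ k ²)`. -/
theorem exists_rotation_basis {n k : ℕ} {Γ : Fin n → ℝ} {ω : ℝ} (hω : ω ≠ 0) {z : Config n}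
    {z₀ e : Plane} (he : ‖e‖ = 1) {y x : Fin n → ℝ} (hz : ∀ i, z i = z₀ + y i • e)
    (hy : Function.Injective y) (hx : ∀ i, z i - center Γ z = x i • e)
    {v : Fin k → Fin n → ℝ} {μ : Fin k → ℝ} (hμ : ∀ l, -1 < μ l ∧ μ l < 1)
    (hv : ∀ l, (ω⁻¹ • interaction Γ y) (v l) = μ l • v l) (hli : LinearIndependent ℝ v)
    (hmem : ∀ l, ∑ i, Γ i * (x i * v l i) = 0)
    (hspan : ∀ u : Fin n → ℝ, ∑ i, Γ i * (x i * u i) = 0 → ∃ d : Fin k → ℝ, ∑ l, d l • v l = u) :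
    ∃ (b : Module.Basis (Fin k × Fin 2) ℝ (perp Γ z)) (β : Fin k → ℝ), ∀ l,
      scaledStability Γ ω z (b (l, 0)) = -β l • (b (l, 1) : Config n) ∧
      scaledStability Γ ω z (b (l, 1)) = β l • (b (l, 0) : Config n) := by
  set α : Fin k → ℝ := fun l => √((1 - μ l) / (1 + μ l)) with hα
  have hαpos : ∀ l, 0 < α l := fun l =>
    Real.sqrt_pos.2 (div_pos (by linarith [(hμ l).2]) (by linarith [(hμ l).1]))
  have hαsq : ∀ l, α l ^ 2 * (1 + μ l) = 1 - μ l := fun l => by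
    have h1 : 0 < 1 + μ l := by linarith [(hμ l).1]
    rw [hα, Real.sq_sqrt (div_nonneg (by linarith [(hμ l).2]) h1.le), div_mul_cancel₀ _ h1.ne']
  have h0 : ∑ i, Γ i * (x i * (0 : Fin n → ℝ) i) = 0 := by simp
  have hα0 : ∀ l, ∑ i, Γ i * (x i * (α l • v l) i) = 0 := fun l => by
    have : ∀ i, Γ i * (x i * (α l • v l) i) = α l * (Γ i * (x i * v l i)) := fun i => by
      rw [Pi.smul_apply, smul_eq_mul]; ring
    rw [Finset.sum_congr rfl fun i _ => this i, ← Finset.mul_sum, hmem, mul_zero]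
  let f : Fin k × Fin 2 → perp Γ z := fun q => if q.2 = 0
    then ⟨frame e (α q.1 • v q.1) 0, (frame_mem_perp_iff he hx _ _).2 ⟨hα0 q.1, h0⟩⟩
    else ⟨frame e 0 (v q.1), (frame_mem_perp_iff he hx _ _).2 ⟨h0, hmem q.1⟩⟩
  have hf0 : ∀ l, (f (l, 0) : Config n) = frame e (α l • v l) 0 := fun l => by simp [f]
  have hf1 : ∀ l, (f (l, 1) : Config n) = frame e 0 (v l) := fun l => by simp [f]
  have hsum : ∀ g : Fin k × Fin 2 → ℝ, ((∑ q, g q • f q : perp Γ z) : Config n) =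
      frame e (∑ l, (g (l, 0) * α l) • v l) (∑ l, g (l, 1) • v l) := fun g => by
    rw [Fintype.sum_prod_type]
    simp only [Fin.sum_univ_two, Submodule.coe_sum, Submodule.coe_add, Submodule.coe_smul, hf0, hf1,
      smul_frame, frame_add, sum_frame, smul_zero, add_zero, zero_add, smul_smul]
  have hfli : LinearIndependent ℝ f := by
    rw [Fintype.linearIndependent_iff] at hli ⊢
    intro g hg
    have h1 : frame e (∑ l, (g (l, 0) * α l) • v l) (∑ l, g (l, 1) • v l) =
        frame e 0 0 := by
      rw [← hsum, hg]; ext1 i; simp [frame]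
    obtain ⟨h2, h3⟩ := frame_injective he h1
    rintro ⟨l, j⟩
    fin_cases j
    · exact (mul_eq_zero.1 (hli _ h2 l)).resolve_right (hαpos l).ne'
    · exact hli _ h3 l
  have hfspan : ⊤ ≤ Submodule.span ℝ (Set.range f) := by
    rintro ⟨w, hw⟩ -
    obtain ⟨u, u', rfl⟩ := exists_frame_eq he w
    obtain ⟨h1, h2⟩ := (frame_mem_perp_iff he hx _ _).1 hw
    obtain ⟨d, hd⟩ := hspan u h1
    obtain ⟨d', hd'⟩ := hspan u' h2
    rw [Submodule.mem_span_range_iff_exists_fun]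
    refine ⟨fun q => if q.2 = 0 then d q.1 / α q.1 else d' q.1, Subtype.ext ?_⟩
    rw [hsum]
    simp only [if_true, one_ne_zero, if_false, hd']
    congr 1
    rw [← hd]
    exact Finset.sum_congr rfl fun l _ => by rw [div_mul_cancel₀ _ (hαpos l).ne']
  refine ⟨Module.Basis.mk hfli hfspan, fun l => α l * (1 + μ l), fun l => ?_⟩
  rw [Module.Basis.mk_apply, Module.Basis.mk_apply, hf0, hf1,
    scaledStability_frame Γ hω he hz hy, scaledStability_frame Γ hω he hz hy, map_smul, hv,
    map_zero, smul_frame, smul_frame]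
  constructor
  · congr 1
    · simp
    · module
  · congr 1
    · rw [smul_smul, show α l * (1 + μ l) * α l = 1 - μ l by rw [← hαsq]; ring]; module
    · simp

namespace LineEquilibrium

variable {m ω a b c : ℝ} {z : Config 4} {z₀ e : Plane}

theorem isLinearlyStable (h : LineEquilibrium m ω z z₀ e a b c) (hm : 3 + m ≠ 0) {μ₁ μ₂ : ℝ}
    (hS : ∀ t : ℝ, (ω⁻¹ • interaction (circ m) ![a, b, c, 0]).charpoly.eval t =
      t * (t - 1) * ((t - μ₁) * (t - μ₂)))
    (h₁ : -1 < μ₁ ∧ μ₁ < 1) (h₂ : -1 < μ₂ ∧ μ₂ < 1) (h₁₀ : μ₁ ≠ 0) (h₂₀ : μ₂ ≠ 0) (h₁₂ : μ₁ ≠ μ₂)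
    (hspec : IsSpectrallyStable (circ m) ω z) : IsLinearlyStable (circ m) ω z := by
  set y : Fin 4 → ℝ := ![a, b, c, 0] with hy
  set S := ω⁻¹ • interaction (circ m) y with hSdef
  have hω := h.hω
  have hΓ : ∑ i, circ m i ≠ 0 := by rwa [sum_circ]
  set x : Fin 4 → ℝ := fun i => y i - (∑ i, circ m i * y i) / ∑ i, circ m i with hxdef
  have hx : ∀ i, z i - center (circ m) z = x i • e := fun i => by
    rw [center_line hΓ h.line, h.line i]; module
  have hSx : S x = x := by
    have h1 := (h.isRelativeEquilibrium hm).2.2.2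
    rw [rotatingField_line_eq_zero_iff hΓ ω h.norm_eq h.line] at h1
    ext i
    rw [hSdef, LinearMap.smul_apply, Pi.smul_apply, smul_eq_mul, inv_mul_eq_iff_eq_mul₀ hω,
      ← h1 i, interaction_apply]
    refine Finset.sum_congr rfl fun j _ => ?_
    have : x i - x j = y i - y j := by simp only [hxdef]; ring
    rw [this]
    rcases eq_or_ne (y i - y j) 0 with h0 | h0
    · simp [h0, ← hy]
    · rw [sq, mul_div_mul_right _ _ h0]
  have hroot : ∀ l : Fin 3, ∃ v, Module.End.HasEigenvector S (![0, μ₁, μ₂] l) v := fun l => by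
    refine Module.End.HasEigenvalue.exists_hasEigenvector ?_
    rw [Module.End.hasEigenvalue_iff_isRoot_charpoly, Polynomial.IsRoot, hS]
    fin_cases l <;> simp
  choose v hv using hroot
  have hbound : ∀ l : Fin 3, -1 < ![0, μ₁, μ₂] l ∧ ![0, μ₁, μ₂] l < 1 := fun l => by
    fin_cases l
    · norm_num
    · exact h₁
    · exact h₂
  have hx0 : x 0 ≠ x 1 := by
    simp only [hxdef, hy]
    exact fun h0 => h.hab (by simpa using h0)
  have hxv : ∀ l : Fin 4, Module.End.HasEigenvector S ((Fin.cons 1 ![0, μ₁, μ₂] : Fin 4 → ℝ) l)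
      ((Fin.cons x v : Fin 4 → Fin 4 → ℝ) l) := fun l => by
    refine Fin.cases ?_ (fun l => hv l) l
    exact ⟨Module.End.mem_eigenspace_iff.2 (by simpa using hSx), fun h0 => hx0 (by
      have h0' : x = 0 := h0
      rw [h0']; rfl)⟩
  have hinj : Function.Injective (Fin.cons 1 ![0, μ₁, μ₂] : Fin 4 → ℝ) := by
    rw [Fin.cons_injective_iff]
    refine ⟨?_, ?_⟩
    · rintro ⟨l, hl⟩
      exact absurd hl (hbound l).2.ne
    · intro i j hij
      fin_cases i <;> fin_cases j <;> simp_all [h₁₀.symm, h₂₀.symm, h₁₂.symm]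
  have hli := Module.End.eigenvectors_linearIndependent' S _ hinj _ hxv
  have horth : ∀ l, ∑ i, circ m i * (x i * v l i) = 0 := fun l => by
    have h1 := interaction_symm (circ m) y x (v l)
    have h2 : interaction (circ m) y (v l) = (ω * ![0, μ₁, μ₂] l) • v l := by
      have := (hv l).apply_eq_smul
      rw [hSdef, LinearMap.smul_apply, inv_smul_eq_iff₀ hω] at this
      rw [this, smul_smul]
    have h3 : interaction (circ m) y x = ω • x := by
      have := hSx
      rwa [hSdef, LinearMap.smul_apply, inv_smul_eq_iff₀ hω] at this
    rw [h2, h3] at h1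
    have h4 : ω * (![0, μ₁, μ₂] l - 1) * ∑ i, circ m i * (x i * v l i) = 0 := by
      have h5 := sub_eq_zero.2 h1
      rw [← Finset.sum_sub_distrib] at h5
      rw [Finset.mul_sum]
      refine (Finset.sum_congr rfl fun i _ => ?_).trans h5
      simp only [Pi.smul_apply, smul_eq_mul]
      ring
    exact (mul_eq_zero.1 h4).resolve_left
      (mul_ne_zero hω (sub_ne_zero.2 (hbound l).2.ne))
  have hcomb : ∀ u : Fin 4 → ℝ, ∃ (r : ℝ) (d : Fin 3 → ℝ), r • x + ∑ l, d l • v l = u := by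
    intro u
    have hspan := hli.span_eq_top_of_card_eq_finrank' (by simp)
    have hu : u ∈ Submodule.span ℝ (Set.range (Fin.cons x v : Fin 4 → Fin 4 → ℝ)) := by
      rw [hspan]; trivial
    obtain ⟨d, hd⟩ := (Submodule.mem_span_range_iff_exists_fun ℝ).1 hu
    rw [Fin.sum_univ_succ] at hd
    exact ⟨d 0, fun l => d l.succ, hd⟩
  have hform : ∀ (r : ℝ) (d : Fin 3 → ℝ), ∑ i, circ m i * (x i * (r • x + ∑ l, d l • v l) i) =
      r * ∑ i, circ m i * (x i * x i) := by
    intro r d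
    have h1 : ∀ i, circ m i * (x i * (r • x + ∑ l, d l • v l) i) =
        r * (circ m i * (x i * x i)) + ∑ l, d l * (circ m i * (x i * v l i)) := fun i => by
      rw [Pi.add_apply, Finset.sum_apply, mul_add, mul_add, Finset.mul_sum, Finset.mul_sum]
      congr 1
      · rw [Pi.smul_apply, smul_eq_mul]; ring
      · exact Finset.sum_congr rfl fun l _ => by rw [Pi.smul_apply, smul_eq_mul]; ring
    rw [Finset.sum_congr rfl fun i _ => h1 i, Finset.sum_add_distrib, ← Finset.mul_sum,
      Finset.sum_comm]
    simp only [← Finset.mul_sum, horth, mul_zero, Finset.sum_const_zero, add_zero]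
  -- `x` is not isotropic: otherwise it would be orthogonal to everything
  have hxx : ∑ i, circ m i * (x i * x i) ≠ 0 := by
    intro h0
    have hall : ∀ u : Fin 4 → ℝ, ∑ i, circ m i * (x i * u i) = 0 := fun u => by
      obtain ⟨r, d, rfl⟩ := hcomb u
      rw [hform, h0, mul_zero]
    have e0 := hall ![1, 0, 0, 0]
    have e1 := hall ![0, 1, 0, 0]
    simp [Fin.sum_univ_four, circ] at e0 e1
    exact hx0 (by rw [e0, e1])
  obtain ⟨B, β, hB⟩ := exists_rotation_basis (Γ := circ m) hω h.norm_eq h.line h.injective hx hbound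
    (fun l => (hv l).apply_eq_smul) ((linearIndependent_finCons.1 hli).1) horth (fun u hu => by
      obtain ⟨r, d, rfl⟩ := hcomb u
      rw [hform] at hu
      have hr := (mul_eq_zero.1 hu).resolve_right hxx
      exact ⟨d, by rw [hr, zero_smul, zero_add]⟩)
  exact ⟨hspec, 3, B, β, hB⟩

end LineEquilibrium

/-! ### Stability and eigenvalues of the two groups -/

theorem IsGroupI.hasInvariants {m ω : ℝ} {z : Config 4} (hm : -1 < m) (h : IsGroupI m ω z) :
    HasInvariants (circ m) ω z (eigSum m (ratioI m)) (eigProd m (ratioI m)) := by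
  obtain ⟨_, _, _, _, _, h, hr⟩ := h.exists_lineEquilibrium hm
  exact h.charpoly_eq hm hr

theorem IsGroupII.hasInvariants {m ω : ℝ} {z : Config 4} (hm : -1 / 2 < m)
    (h : IsGroupII m ω z) :
    HasInvariants (circ m) ω z (eigSum m (ratioII m)) (eigProd m (ratioII m)) := by
  obtain ⟨_, _, _, _, _, h, hr⟩ := h.exists_lineEquilibrium hm
  exact h.charpoly_eq (by linarith) hr

/-- The larger nontrivial eigenvalue of the scaled interaction matrix for Group I. -/
noncomputable def muPlusI (m : ℝ) : ℝ := rootPlus (eigSum m (ratioI m)) (eigProd m (ratioI m))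

/-- The smaller nontrivial eigenvalue of the scaled interaction matrix for Group I. -/
noncomputable def muMinusI (m : ℝ) : ℝ := rootMinus (eigSum m (ratioI m)) (eigProd m (ratioI m))

/-- The larger nontrivial eigenvalue of the scaled interaction matrix for Group II. -/
noncomputable def muPlusII (m : ℝ) : ℝ :=
  rootPlus (eigSum m (ratioII m)) (eigProd m (ratioII m))

/-- The smaller nontrivial eigenvalue of the scaled interaction matrix for Group II. -/
noncomputable def muMinusII (m : ℝ) : ℝ :=
  rootMinus (eigSum m (ratioII m)) (eigProd m (ratioII m))

theorem IsGroupI.hasImaginaryPairs {m ω : ℝ} {z : Config 4} (hm : -1 < m) (hm' : m < -4 / 5)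
    (hN : 0 ≤ eigDisc m (ratioI m)) (h : IsGroupI m ω z) :
    HasImaginaryPairs m ω z (frequency (muPlusI m)) (frequency (muMinusI m)) :=
  (h.hasInvariants hm).hasImaginaryPairs hN (eigSum_ratioI_lt_two hm hm') (eigSum_pos_ratioI hm)
    (one_sub_pos_ratioI hm)

theorem IsGroupI.isSpectrallyStable {m ω : ℝ} {z : Config 4} (hm : -1 < m) (hm' : m < -4 / 5)
    (hN : 0 ≤ eigDisc m (ratioI m)) (h : IsGroupI m ω z) : IsSpectrallyStable (circ m) ω z := by
  obtain ⟨h1, h2⟩ := roots_mem_Ioo hN (eigSum_ratioI_lt_two hm hm') (eigSum_pos_ratioI hm)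
    (one_sub_pos_ratioI hm)
  have h3 := rootMinus_le_rootPlus (eigSum m (ratioI m)) (eigProd m (ratioI m))
  exact (h.hasImaginaryPairs hm hm' hN).isSpectrallyStable (frequency_pos (h1.trans_le h3) h2)
    (frequency_pos h1 (h3.trans_lt h2))

theorem IsGroupI.isLinearlyStable {m ω : ℝ} {z : Config 4} (hm : -1 < m) (hm' : m < -4 / 5)
    (hN : 0 < eigDisc m (ratioI m)) (h : IsGroupI m ω z) : IsLinearlyStable (circ m) ω z := by
  have hspec := h.isSpectrallyStable hm hm' hN.le
  obtain ⟨h1, h2⟩ := roots_mem_Ioo hN.le (eigSum_ratioI_lt_two hm hm') (eigSum_pos_ratioI hm)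
    (one_sub_pos_ratioI hm)
  obtain ⟨z₀, e, a, b, c, h, hr⟩ := h.exists_lineEquilibrium hm
  have h3 := rootMinus_lt_rootPlus hN
  have h4 := rootPlus_mul_rootMinus hN.le
  have h5 := rootPlus_add_rootMinus (eigSum m (ratioI m)) (eigProd m (ratioI m))
  have h6 : rootPlus (eigSum m (ratioI m)) (eigProd m (ratioI m)) *
      rootMinus (eigSum m (ratioI m)) (eigProd m (ratioI m)) ≠ 0 := by
    rw [h4]; exact (eigProd_pos_ratioI hm).ne'
  refine h.isLinearlyStable (by linarith) (fun t => ?_) ⟨h1.trans h3, h2⟩ ⟨h1, h3.trans h2⟩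
    (left_ne_zero_of_mul h6) (right_ne_zero_of_mul h6) h3.ne' hspec
  rw [h.charpoly_interaction hm hr]
  linear_combination (t * (t - 1)) * (t * h5 - h4)

theorem IsGroupI.hasRealPairs {m ω : ℝ} {z : Config 4} (hm : -1 / 10 < m)
    (hN : 0 ≤ eigDisc m (ratioI m)) (h : IsGroupI m ω z) :
    HasRealPairs m ω z (realRate (muPlusI m)) (realRate (muMinusI m)) :=
  (h.hasInvariants (by linarith)).hasRealPairs hN (two_lt_eigSum_ratioI hm)
    (one_sub_pos_ratioI (by linarith))

theorem one_lt_muMinusI {m : ℝ} (hm : -1 / 10 < m) (hN : 0 ≤ eigDisc m (ratioI m)) :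
    1 < muMinusI m :=
  one_lt_rootMinus hN (two_lt_eigSum_ratioI hm) (one_sub_pos_ratioI (by linarith))

theorem IsGroupII.hasRealPairs {m ω : ℝ} {z : Config 4} (hm : -1 / 2 < m) (h : IsGroupII m ω z) :
    HasRealPairs m ω z (realRate (muPlusII m)) (realRate (muMinusII m)) :=
  (h.hasInvariants hm).hasRealPairs (eigDisc_ratioII_pos hm).le (two_lt_eigSum_ratioII hm)
    (one_sub_pos_ratioII hm)

theorem one_lt_muMinusII {m : ℝ} (hm : -1 / 2 < m) : 1 < muMinusII m :=
  one_lt_rootMinus (eigDisc_ratioII_pos hm).le (two_lt_eigSum_ratioII hm) (one_sub_pos_ratioII hm)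

theorem muMinusII_lt_muPlusII {m : ℝ} (hm : -1 / 2 < m) : muMinusII m < muPlusII m :=
  rootMinus_lt_rootPlus (eigDisc_ratioII_pos hm)

/-! ### Limits -/

theorem continuous_realRate : Continuous realRate := by unfold realRate; fun_prop

theorem continuous_frequency : Continuous frequency := by unfold frequency; fun_prop

section

variable {l : Filter ℝ} {s p x q : ℝ → ℝ} {s₀ p₀ x₀ q₀ : ℝ}

theorem tendsto_rootPlus (hs : Tendsto s l (𝓝 s₀)) (hp : Tendsto p l (𝓝 p₀)) :
    Tendsto (fun m => rootPlus (s m) (p m)) l (𝓝 (rootPlus s₀ p₀)) :=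
  (hs.add (((hs.pow 2).sub (hp.const_mul 4)).sqrt)).div_const 2

theorem tendsto_rootMinus (hs : Tendsto s l (𝓝 s₀)) (hp : Tendsto p l (𝓝 p₀)) :
    Tendsto (fun m => rootMinus (s m) (p m)) l (𝓝 (rootMinus s₀ p₀)) :=
  (hs.sub (((hs.pow 2).sub (hp.const_mul 4)).sqrt)).div_const 2

theorem tendsto_eigSum {σ₀ : ℝ} (hσ : Tendsto (fun m => sigma m (x m)) l (𝓝 σ₀)) :
    Tendsto (fun m => eigSum m (x m)) l (𝓝 (5 + σ₀)) :=
  hσ.const_add 5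

theorem tendsto_eigProd {σ₀ : ℝ} (hσ : Tendsto (fun m => sigma m (x m)) l (𝓝 σ₀))
    (hq : Tendsto (fun m : ℝ => m / (m + 3)) l (𝓝 q₀)) :
    Tendsto (fun m => eigProd m (x m)) l (𝓝 (6 + 2 * σ₀ + q₀ * σ₀)) :=
  ((hσ.const_mul 2).const_add 6).add (hq.mul hσ)

end

theorem continuousAt_ratioI {m : ℝ} (hm : m + 3 ≠ 0) : ContinuousAt ratioI m := by
  unfold ratioI ratioDisc
  refine ContinuousAt.div (by fun_prop) (by fun_prop) (by positivity)

theorem continuousAt_ratioII {m : ℝ} (hm : m + 3 ≠ 0) : ContinuousAt ratioII m := by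
  unfold ratioII ratioDisc
  refine ContinuousAt.div (by fun_prop) (by fun_prop) (by positivity)

theorem continuousAt_sigma_ratioI {m : ℝ} (hm : m + 3 ≠ 0) (hx : ratioI m ≠ 0) :
    ContinuousAt (fun m => sigma m (ratioI m)) m := by
  unfold sigma
  have := continuousAt_ratioI hm
  exact ContinuousAt.div (by fun_prop) (by fun_prop) (mul_ne_zero hm hx)

theorem continuousAt_div_add_three {m : ℝ} (hm : m + 3 ≠ 0) :
    ContinuousAt (fun m : ℝ => m / (m + 3)) m :=
  ContinuousAt.div (by fun_prop) (by fun_prop) hm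

theorem continuousAt_muPlusI {m : ℝ} (hm : m + 3 ≠ 0) (hx : ratioI m ≠ 0) :
    ContinuousAt muPlusI m :=
  tendsto_rootPlus (tendsto_eigSum (continuousAt_sigma_ratioI hm hx))
    (tendsto_eigProd (continuousAt_sigma_ratioI hm hx) (continuousAt_div_add_three hm))

theorem continuousAt_muMinusI {m : ℝ} (hm : m + 3 ≠ 0) (hx : ratioI m ≠ 0) :
    ContinuousAt muMinusI m :=
  tendsto_rootMinus (tendsto_eigSum (continuousAt_sigma_ratioI hm hx))
    (tendsto_eigProd (continuousAt_sigma_ratioI hm hx) (continuousAt_div_add_three hm))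

theorem ratioI_neg_one : ratioI (-1) = 1 / 4 := by
  have h : √(ratioDisc (-1)) = 2 := by
    rw [show ratioDisc (-1) = 2 ^ 2 by norm_num [ratioDisc]]
    exact Real.sqrt_sq (by norm_num)
  rw [ratioI, h]
  norm_num

theorem muPlusI_neg_one : muPlusI (-1) = 1 := by
  norm_num [muPlusI, rootPlus, eigSum, eigProd, sigma, ratioI_neg_one]

theorem muMinusI_neg_one : muMinusI (-1) = 0 := by
  norm_num [muMinusI, rootMinus, eigSum, eigProd, sigma, ratioI_neg_one]

/-- Near infinity the ratios are functions of `1 / m` that are continuous at `0`. -/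
theorem tendsto_ratio_atTop (ε : ℝ) :
    Tendsto (fun m => (-((4 * m + 9) * (m - 1)) + ε * √(ratioDisc m)) / (12 * (m + 3) ^ 2)) atTop
      (𝓝 ((-4 + ε * 8) / 12)) := by
  set G : ℝ → ℝ := fun h => (-((4 + 9 * h) * (1 - h)) +
    ε * √(64 + 448 * h + 1153 * h ^ 2 + 1278 * h ^ 3 + 513 * h ^ 4)) / (12 * (1 + 3 * h) ^ 2)
  have hG : ContinuousAt G 0 := by
    refine ContinuousAt.div (by fun_prop) (by fun_prop) (by norm_num)
  have hG0 : G 0 = (-4 + ε * 8) / 12 := by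
    have : √(64 : ℝ) = 8 := by
      rw [show (64 : ℝ) = 8 ^ 2 by norm_num]; exact Real.sqrt_sq (by norm_num)
    simp [G, this]
  have h1 : Tendsto (fun m : ℝ => G m⁻¹) atTop (𝓝 (G 0)) := hG.tendsto.comp tendsto_inv_atTop_zero
  rw [hG0] at h1
  refine h1.congr' ?_
  filter_upwards [eventually_gt_atTop 0] with m hm
  have h2 : √(ratioDisc m) = m ^ 2 * √(64 + 448 * m⁻¹ + 1153 * m⁻¹ ^ 2 + 1278 * m⁻¹ ^ 3
      + 513 * m⁻¹ ^ 4) := by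
    have : ratioDisc m = (m ^ 2) ^ 2 * (64 + 448 * m⁻¹ + 1153 * m⁻¹ ^ 2 + 1278 * m⁻¹ ^ 3
      + 513 * m⁻¹ ^ 4) := by
      simp only [ratioDisc]; field_simp
    rw [this, Real.sqrt_mul (by positivity), Real.sqrt_sq (by positivity)]
  rw [h2]
  simp only [G]
  generalize √(64 + 448 * m⁻¹ + 1153 * m⁻¹ ^ 2 + 1278 * m⁻¹ ^ 3 + 513 * m⁻¹ ^ 4) = r
  field_simp

theorem tendsto_add_div_add_atTop (r : ℝ) :
    Tendsto (fun m : ℝ => (m + r) / (m + 3)) atTop (𝓝 1) := by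
  have hG : ContinuousAt (fun h : ℝ => (1 + r * h) / (1 + 3 * h)) 0 :=
    ContinuousAt.div (by fun_prop) (by fun_prop) (by norm_num)
  have h1 : Tendsto (fun m : ℝ => (1 + r * m⁻¹) / (1 + 3 * m⁻¹)) atTop (𝓝 1) := by
    simpa [Function.comp_def] using hG.tendsto.comp tendsto_inv_atTop_zero
  refine h1.congr' ?_
  filter_upwards [eventually_gt_atTop 0] with m hm
  field_simp

theorem tendsto_sigma_atTop {x : ℝ → ℝ} {x₀ : ℝ} (hx : Tendsto x atTop (𝓝 x₀)) (h0 : x₀ ≠ 0) :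
    Tendsto (fun m => sigma m (x m)) atTop (𝓝 (1 / x₀)) := by
  refine ((tendsto_add_div_add_atTop (-1)).div hx h0).congr fun m => ?_
  rw [Pi.div_apply, sigma, div_div, sub_eq_add_neg]

theorem tendsto_div_add_three_atTop : Tendsto (fun m : ℝ => m / (m + 3)) atTop (𝓝 1) := by
  simpa using tendsto_add_div_add_atTop 0

theorem tendsto_sigma_ratioI_atTop :
    Tendsto (fun m => sigma m (ratioI m)) atTop (𝓝 3) := by
  have h : Tendsto ratioI atTop (𝓝 (1 / 3)) := by
    convert tendsto_ratio_atTop 1 using 2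
    · simp [ratioI]
    · norm_num
  simpa using tendsto_sigma_atTop h (by norm_num)

theorem tendsto_sigma_ratioII_atTop :
    Tendsto (fun m => sigma m (ratioII m)) atTop (𝓝 (-1)) := by
  have h : Tendsto ratioII atTop (𝓝 (-1)) := by
    convert tendsto_ratio_atTop (-1) using 2
    · simp [ratioII, sub_eq_add_neg]
    · norm_num
  simpa using tendsto_sigma_atTop h (by norm_num)

theorem sqrt_four : √(4 : ℝ) = 2 := by
  rw [show (4 : ℝ) = 2 ^ 2 by norm_num]; exact Real.sqrt_sq (by norm_num)

theorem realRate_three : realRate 3 = 2 * √2 := by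
  rw [realRate, show (3 : ℝ) ^ 2 - 1 = 4 * 2 by norm_num, Real.sqrt_mul (by norm_num), sqrt_four]

theorem realRate_five : realRate 5 = 2 * √6 := by
  rw [realRate, show (5 : ℝ) ^ 2 - 1 = 4 * 6 by norm_num, Real.sqrt_mul (by norm_num), sqrt_four]

theorem realRate_nine_fifths : realRate (9 / 5) = 2 * √14 / 5 := by
  rw [realRate, show (9 / 5 : ℝ) ^ 2 - 1 = (2 / 5) ^ 2 * 14 by norm_num,
    Real.sqrt_mul (by norm_num), Real.sqrt_sq (by norm_num)]
  ring

theorem tendsto_muPlusI_atTop : Tendsto muPlusI atTop (𝓝 5) := by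
  have h := tendsto_rootPlus (tendsto_eigSum tendsto_sigma_ratioI_atTop)
    (tendsto_eigProd tendsto_sigma_ratioI_atTop tendsto_div_add_three_atTop)
  have hv : rootPlus (5 + 3) (6 + 2 * 3 + 1 * 3) = 5 := by norm_num [rootPlus, sqrt_four]
  rwa [hv] at h

theorem tendsto_muMinusI_atTop : Tendsto muMinusI atTop (𝓝 3) := by
  have h := tendsto_rootMinus (tendsto_eigSum tendsto_sigma_ratioI_atTop)
    (tendsto_eigProd tendsto_sigma_ratioI_atTop tendsto_div_add_three_atTop)
  have hv : rootMinus (5 + 3) (6 + 2 * 3 + 1 * 3) = 3 := by norm_num [rootMinus, sqrt_four]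
  rwa [hv] at h

theorem tendsto_muPlusII_atTop : Tendsto muPlusII atTop (𝓝 3) := by
  have h := tendsto_rootPlus (tendsto_eigSum tendsto_sigma_ratioII_atTop)
    (tendsto_eigProd tendsto_sigma_ratioII_atTop tendsto_div_add_three_atTop)
  have hv : rootPlus (5 + -1) (6 + 2 * -1 + 1 * -1) = 3 := by norm_num [rootPlus, sqrt_four]
  rwa [hv] at h

theorem tendsto_muMinusII_atTop : Tendsto muMinusII atTop (𝓝 1) := by
  have h := tendsto_rootMinus (tendsto_eigSum tendsto_sigma_ratioII_atTop)
    (tendsto_eigProd tendsto_sigma_ratioII_atTop tendsto_div_add_three_atTop)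
  have hv : rootMinus (5 + -1) (6 + 2 * -1 + 1 * -1) = 1 := by norm_num [rootMinus, sqrt_four]
  rwa [hv] at h

theorem ratioII_neg_half : ratioII (-1 / 2) = 0 := by
  have h : √(ratioDisc (-1 / 2)) = 21 / 2 := by
    rw [show ratioDisc (-1 / 2) = (21 / 2) ^ 2 by norm_num [ratioDisc]]
    exact Real.sqrt_sq (by norm_num)
  rw [ratioII, h]
  norm_num

/-- The reciprocal of `σ` for Group II tends to zero. -/
theorem tendsto_inv_sigma_ratioII :
    Tendsto (fun m => (m + 3) * ratioII m / (m - 1)) (𝓝[>] (-1 / 2)) (𝓝[>] 0) := by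
  refine tendsto_nhdsWithin_iff.2 ⟨?_, ?_⟩
  · have h : ContinuousAt (fun m => (m + 3) * ratioII m / (m - 1)) (-1 / 2) := by
      have := continuousAt_ratioII (m := -1 / 2) (by norm_num)
      exact ContinuousAt.div (by fun_prop) (by fun_prop) (by norm_num)
    have h' := h.tendsto
    rw [ratioII_neg_half, mul_zero, zero_div] at h'
    exact h'.mono_left nhdsWithin_le_nhds
  · filter_upwards [Ioo_mem_nhdsGT (show (-1 / 2 : ℝ) < 1 by norm_num)] with m hm
    exact div_pos_of_neg_of_neg (mul_neg_of_pos_of_neg (by linarith [hm.1]) (ratioII_neg hm.1))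
      (by linarith [hm.2])

theorem sigma_ratioII_eq_inv (m : ℝ) :
    sigma m (ratioII m) = ((m + 3) * ratioII m / (m - 1))⁻¹ := by
  rw [sigma, inv_div]

theorem tendsto_muPlusII_neg_half : Tendsto muPlusII (𝓝[>] (-1 / 2)) atTop := by
  have h1 : Tendsto (fun m => sigma m (ratioII m)) (𝓝[>] (-1 / 2)) atTop := by
    simp only [sigma_ratioII_eq_inv]
    exact tendsto_inv_nhdsGT_zero.comp tendsto_inv_sigma_ratioII
  have h2 : Tendsto (fun m => eigSum m (ratioII m) / 2) (𝓝[>] (-1 / 2)) atTop :=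
    (tendsto_atTop_add_const_left _ 5 h1).atTop_div_const (by norm_num)
  refine tendsto_atTop_mono (fun m => ?_) h2
  have := Real.sqrt_nonneg (eigSum m (ratioII m) ^ 2 - 4 * eigProd m (ratioII m))
  simp only [muPlusII, rootPlus]
  linarith

/-- With `w = 1 / σ → 0`, both the sum and the product of the eigenvalues are `O(1 / w)`, and the
smaller eigenvalue is the product divided by the larger one. -/
theorem tendsto_muMinusII_neg_half : Tendsto muMinusII (𝓝[>] (-1 / 2)) (𝓝 (9 / 5)) := by
  set w : ℝ → ℝ := fun m => (m + 3) * ratioII m / (m - 1) with hw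
  have hw0 : Tendsto w (𝓝[>] (-1 / 2)) (𝓝 0) :=
    (tendsto_nhdsWithin_iff.1 tendsto_inv_sigma_ratioII).1
  have hq : Tendsto (fun m : ℝ => m / (m + 3)) (𝓝[>] (-1 / 2)) (𝓝 (-1 / 2 / (-1 / 2 + 3))) :=
    (continuousAt_div_add_three (m := -1 / 2) (by norm_num)).tendsto.mono_left nhdsWithin_le_nhds
  have hs : Tendsto (fun m => 5 * w m + 1) (𝓝[>] (-1 / 2)) (𝓝 (5 * 0 + 1)) :=
    (hw0.const_mul 5).add_const 1
  have hp : Tendsto (fun m => 6 * w m + 2 + m / (m + 3)) (𝓝[>] (-1 / 2))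
      (𝓝 (6 * 0 + 2 + -1 / 2 / (-1 / 2 + 3))) :=
    ((hw0.const_mul 6).add_const 2).add hq
  have hr := tendsto_rootPlus hs (hp.mul hw0)
  have hlim := hp.div hr (by norm_num [rootPlus])
  have hval : (6 * 0 + 2 + -1 / 2 / (-1 / 2 + 3) : ℝ) /
      rootPlus (5 * 0 + 1) ((6 * 0 + 2 + -1 / 2 / (-1 / 2 + 3)) * 0) = 9 / 5 := by
    norm_num [rootPlus]
  rw [hval] at hlim
  refine hlim.congr' ?_
  filter_upwards [Ioo_mem_nhdsGT (show (-1 / 2 : ℝ) < 1 by norm_num)] with m hm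
  have hwpos : 0 < w m :=
    div_pos_of_neg_of_neg (mul_neg_of_pos_of_neg (by linarith [hm.1]) (ratioII_neg hm.1))
      (by linarith [hm.2])
  have hσ : sigma m (ratioII m) * w m = 1 := by
    rw [sigma_ratioII_eq_inv]; exact inv_mul_cancel₀ hwpos.ne'
  have hs' : 5 * w m + 1 = w m * eigSum m (ratioII m) := by
    simp only [eigSum]; linear_combination -hσ
  have hp' : 6 * w m + 2 + m / (m + 3) = w m * eigProd m (ratioII m) := by
    simp only [eigProd]; linear_combination (-2 - m / (m + 3)) * hσ
  have hr' : rootPlus (5 * w m + 1) ((6 * w m + 2 + m / (m + 3)) * w m) = w m * muPlusII m := by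
    rw [hs', hp', muPlusII, rootPlus, rootPlus,
      show (w m * eigSum m (ratioII m)) ^ 2 - 4 * (w m * eigProd m (ratioII m) * w m) =
        w m ^ 2 * (eigSum m (ratioII m) ^ 2 - 4 * eigProd m (ratioII m)) by ring,
      Real.sqrt_mul (by positivity), Real.sqrt_sq hwpos.le]
    ring
  have hplus : 0 < muPlusII m := by
    linarith [one_lt_muMinusII hm.1, muMinusII_lt_muPlusII hm.1]
  rw [Pi.div_apply, hr', hp', mul_div_mul_left _ _ hwpos.ne', div_eq_iff hplus.ne', mul_comm]
  exact (rootPlus_mul_rootMinus (eigDisc_ratioII_pos hm.1).le).symm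

end PointVortex

theorem theorem3p4 :
    ∃ mstar mc : ℝ,
      -- the two bifurcation values are the roots of `Ψ` in `(-1, 0)`
      -1 < mstar ∧ mstar < mc ∧ mc < 0 ∧
      (∀ m : ℝ, -1 < m → m < 0 → (Psi m = 0 ↔ m = mstar ∨ m = mc)) ∧
      |mstar - (-0.8564136)| < 1e-7 ∧ |mc - (-0.0175413)| < 1e-7 ∧
      -- the solutions of both groups exist
      (∀ m : ℝ, -1 < m → ∃ ω z, IsGroupI m ω z) ∧
      (∀ m : ℝ, -1 / 2 < m → ∃ ω z, IsGroupII m ω z) ∧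
      -- (i) stability of Group I
      (∀ m ω z, -1 < m → m < mstar → IsGroupI m ω z → IsLinearlyStable (circ m) ω z) ∧
      (∀ ω z, IsGroupI mstar ω z → IsSpectrallyStable (circ mstar) ω z) ∧
      (∀ m ω z, mstar < m → IsGroupI m ω z → IsUnstable (circ m) ω z) ∧
      -- (ii) eigenvalues of Group I, for `m ≥ mc` and as `m → ∞`
      (∃ lam₁ lam₂ : ℝ → ℝ,
        (∀ m, mc < m → 0 < lam₂ m ∧ lam₂ m < lam₁ m ∧
          ∀ ω z, IsGroupI m ω z → HasRealPairs m ω z (lam₁ m) (lam₂ m)) ∧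
        (∃ lamc : ℝ, 0 < lamc ∧
          (∀ ω z, IsGroupI mc ω z → HasRealPairs mc ω z lamc lamc) ∧
          Tendsto lam₁ (𝓝[>] mc) (𝓝 lamc) ∧ Tendsto lam₂ (𝓝[>] mc) (𝓝 lamc)) ∧
        Tendsto lam₁ atTop (𝓝 (2 * √6)) ∧ Tendsto lam₂ atTop (𝓝 (2 * √2))) ∧
      -- for `mstar < m < mc`
      (∀ m, mstar < m → m < mc → ∃ a b : ℝ, 0 < a ∧ 0 < b ∧
        ∀ ω z, IsGroupI m ω z → HasQuartuplet m ω z a b) ∧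
      -- as `m → -1⁺`
      (∃ ν₁ ν₂ : ℝ → ℝ,
        (∀ m ω z, -1 < m → m < mstar → IsGroupI m ω z →
          HasImaginaryPairs m ω z (ν₁ m) (ν₂ m)) ∧
        Tendsto ν₁ (𝓝[>] (-1)) (𝓝 0) ∧ Tendsto ν₂ (𝓝[>] (-1)) (𝓝 1)) ∧
      -- (iii) Group II
      (∀ m ω z, -1 / 2 < m → IsGroupII m ω z → IsUnstable (circ m) ω z) ∧
      (∃ lam₁ lam₂ : ℝ → ℝ,
        (∀ m, -1 / 2 < m → 0 < lam₂ m ∧ lam₂ m < lam₁ m ∧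
          ∀ ω z, IsGroupII m ω z → HasRealPairs m ω z (lam₁ m) (lam₂ m)) ∧
        Tendsto lam₁ (𝓝[>] (-1 / 2)) atTop ∧
        Tendsto lam₂ (𝓝[>] (-1 / 2)) (𝓝 (2 * √14 / 5)) ∧
        Tendsto lam₁ atTop (𝓝 (2 * √2)) ∧ Tendsto lam₂ atTop (𝓝 0)) := by
  obtain ⟨mstar, mc, hs1, hs2, hc1, hc2, hs0, hc0, hpos, hneg, hpos'⟩ := exists_roots_Psi
  have hsm : -1 < mstar := by linarith
  have hcm : -1 < mc := by linarith
  have hdisc_left : ∀ m, -1 < m → m < mstar → 0 < eigDisc m (ratioI m) := fun m h1 h2 =>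
    eigDisc_ratioI_pos h1 (by linarith) (hpos m h1 h2)
  have hdisc_mid : ∀ m, mstar < m → m < mc → eigDisc m (ratioI m) < 0 := fun m h1 h2 =>
    eigDisc_ratioI_neg (by linarith) (by linarith) (hneg m h1 h2)
  have hdisc_right : ∀ m, mc < m → 0 < eigDisc m (ratioI m) := fun m h1 => by
    rcases lt_or_ge m 1 with h2 | h2
    · exact eigDisc_ratioI_pos (by linarith) h2 (hpos' m h1 h2.le)
    · exact eigDisc_ratioI_pos_of_one_le h2
  have hdisc_s : eigDisc mstar (ratioI mstar) = 0 :=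
    eigDisc_ratioI_eq_zero hsm (by linarith) hs0
  have hdisc_c : eigDisc mc (ratioI mc) = 0 := eigDisc_ratioI_eq_zero hcm (by linarith) hc0
  -- at `m_c` the two eigenvalues of the interaction matrix coincide
  have hmu_c : muMinusI mc = muPlusI mc := by
    have h : eigSum mc (ratioI mc) ^ 2 - 4 * eigProd mc (ratioI mc) = 0 := hdisc_c
    simp only [muMinusI, muPlusI, rootPlus, rootMinus, h, Real.sqrt_zero, sub_zero, add_zero]
  have hquart : ∀ m, mstar < m → m < mc → ∃ a b : ℝ, 0 < a ∧ 0 < b ∧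
      ∀ ω z, IsGroupI m ω z → HasQuartuplet m ω z a b := fun m h1 h2 => by
    obtain ⟨a, b, ha, hb, h⟩ := HasInvariants.exists_hasQuartuplet (hdisc_mid m h1 h2)
      (eigSum_pos_ratioI (show -1 < m by linarith))
    exact ⟨a, b, ha, hb, fun ω z hz => h m ω z (hz.hasInvariants (by linarith))⟩
  have hcont : ∀ {f : ℝ → ℝ} {m : ℝ}, ContinuousAt f m → Tendsto f (𝓝[>] m) (𝓝 (f m)) :=
    fun hf => hf.tendsto.mono_left nhdsWithin_le_nhds
  have hxc := (ratioI_pos hcm).ne'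
  have hkc : mc + 3 ≠ 0 := by linarith
  refine ⟨mstar, mc, hsm, by linarith, by linarith, fun m h1 h2 => ⟨fun h => ?_, ?_⟩, ?_, ?_,
    fun m => exists_isGroupI, fun m => exists_isGroupII,
    fun m ω z h1 h2 h => h.isLinearlyStable h1 (by linarith) (hdisc_left m h1 h2),
    fun ω z h => h.isSpectrallyStable hsm (by linarith) hdisc_s.ge, fun m ω z h1 h => ?_,
    ⟨realRate ∘ muPlusI, realRate ∘ muMinusI, fun m h1 => ?_,
      ⟨realRate (muPlusI mc), ?_, fun ω z h => ?_, ?_, ?_⟩, ?_, ?_⟩, hquart,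
    ⟨frequency ∘ muPlusI, frequency ∘ muMinusI, fun m ω z h1 h2 h =>
      h.hasImaginaryPairs h1 (by linarith) (hdisc_left m h1 h2).le, ?_, ?_⟩,
    fun m ω z h1 h => (h.hasRealPairs h1).isUnstable (realRate_pos
      ((one_lt_muMinusII h1).trans (muMinusII_lt_muPlusII h1))),
    ⟨realRate ∘ muPlusII, realRate ∘ muMinusII, fun m h1 => ⟨realRate_pos (one_lt_muMinusII h1),
      realRate_lt (one_lt_muMinusII h1) (muMinusII_lt_muPlusII h1), fun ω z h => h.hasRealPairs h1⟩,
      ?_, ?_, ?_, ?_⟩⟩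
  · by_contra! hne
    rcases lt_or_gt_of_ne hne.1 with h3 | h3
    · exact (hpos m h1 h3).ne' h
    rcases lt_or_gt_of_ne hne.2 with h4 | h4
    · exact (hneg m h3 h4).ne h
    · exact (hpos' m h4 (by linarith)).ne' h
  · rintro (rfl | rfl) <;> assumption
  · rw [abs_lt]; constructor <;> linarith
  · rw [abs_lt]; constructor <;> linarith
  · rcases lt_or_ge m mc with h2 | h2
    · obtain ⟨a, b, ha, -, hq⟩ := hquart m h1 h2
      exact (hq ω z h).isUnstable ha
    · have hN : 0 ≤ eigDisc m (ratioI m) := by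
        rcases h2.eq_or_lt with rfl | h2
        · exact hdisc_c.ge
        · exact (hdisc_right m h2).le
      exact (h.hasRealPairs (by linarith) hN).isUnstable (realRate_pos
        ((one_lt_muMinusI (by linarith) hN).trans_le (rootMinus_le_rootPlus _ _)))
  · have hN := hdisc_right m h1
    have h2 := one_lt_muMinusI (by linarith) hN.le
    exact ⟨realRate_pos h2, realRate_lt h2 (rootMinus_lt_rootPlus hN),
      fun ω z h => h.hasRealPairs (by linarith) hN.le⟩
  · rw [← hmu_c]
    exact realRate_pos (one_lt_muMinusI (by linarith) hdisc_c.ge)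
  · have h1 := h.hasRealPairs (by linarith) hdisc_c.ge
    rwa [hmu_c] at h1
  · exact hcont (continuous_realRate.continuousAt.comp (continuousAt_muPlusI hkc hxc))
  · rw [← hmu_c]
    exact hcont (continuous_realRate.continuousAt.comp (continuousAt_muMinusI hkc hxc))
  · rw [← realRate_five]
    exact (continuous_realRate.tendsto 5).comp tendsto_muPlusI_atTop
  · rw [← realRate_three]
    exact (continuous_realRate.tendsto 3).comp tendsto_muMinusI_atTop
  · have h := hcont (continuous_frequency.continuousAt.comp
      (continuousAt_muPlusI (m := -1) (by norm_num) (by norm_num [ratioI_neg_one])))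
    simpa [muPlusI_neg_one, frequency] using h
  · have h := hcont (continuous_frequency.continuousAt.comp
      (continuousAt_muMinusI (m := -1) (by norm_num) (by norm_num [ratioI_neg_one])))
    simpa [muMinusI_neg_one, frequency] using h
  · refine Real.tendsto_sqrt_atTop.comp (tendsto_atTop_add_const_right _ (-1) ?_)
    exact (tendsto_pow_atTop two_ne_zero).comp tendsto_muPlusII_neg_half
  · rw [← realRate_nine_fifths]
    exact (continuous_realRate.tendsto _).comp tendsto_muMinusII_neg_half
  · rw [← realRate_three]
    exact (continuous_realRate.tendsto 3).comp tendsto_muPlusII_atTop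
  · have h := (continuous_realRate.tendsto 1).comp tendsto_muMinusII_atTop
    rwa [show realRate 1 = 0 by simp [realRate]] at h
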